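/- **Theorem 3.4 (Monotonicity formula).** Let $M\subset\mathbb R^L$ be a smooth embedded $m$-dimensional submanifold (without boundary) whose second fundamental form in $\mathbb R^L$ satisfies $|A^M|\le\Lambda$ for some constant $\Lambda>0$, and let $N\subset M$ be a compact smooth embedded $n$-dimensional submanifold without boundary. Let $V\in\mathcal V_k(M)$, i.e. $V$ is a $k$-varifold in $\mathbb R^L$ (a Radon measure on $\mathbb R^L\times G(L,k)$) supported in $M$ which lies in the weak closure of the rectifiable $k$-varifolds in $\mathbb R^L$ supported in $M$; let $\|V\|$ be its weight. Suppose that $V$ is stationary with free boundary on $N$: for every smooth compactly supported vector field $X$ on $\mathbb R^L$ with $X(x)\in T_xM$ for all $x\in M$ and $X(q)\in T_qN$ for all $q\in N$, with flow $\phi_t$, $$\delta V(X)=\frac{d}{dt}\Big|_{t=0}\|(\phi_t)_\sharp V\|(\operatorname{supp}X)=0 .$$ Let $\kappa=\inf\{t\ge 0:\ |\nu(x)(y-x)|\le \tfrac t2|y-x|^2\ \text{for all }x,y\in N\}$, where $\nu(x)$ is the orthogonal projection of $\mathbb R^L$ onto $(T_xN)^\perp$, and put $R_0=\kappa^{-1}\in(0,\infty]$,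 $\gamma=2/R_0$ and $\Lambda_1=k(\Lambda+3\gamma)$. For $p\in N$ let $r(x)=|x-p|$, let $\widetilde B(p,s)$ be the open Euclidean ball in $\mathbb R^L$, and for a $k$-plane $S$ let $\nabla_S^\perp r$ be the projection of $\nabla r$ to $S^\perp$. Then for all $p\in N$ and $0<\sigma<\rho<\tfrac12R_0$, $$e^{\Lambda_1\sigma}\frac{\|V\|(\widetilde B(p,\sigma))}{\sigma^k}\le e^{\Lambda_1\rho}\frac{\|V\|(\widetilde B(p,\rho))}{\rho^k}-\int_{(\widetilde B(p,\rho)\setminus\widetilde B(p,\sigma))\times G(L,k)}\frac{e^{\Lambda_1 r}\,|\nabla_S^\perp r|^2}{(1+\gamma r)\,r^k}\,dV(x,S),$$ where the last integral converges. -/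

import Mathlib

open MeasureTheory Set Filter Topology
open scoped ENNReal NNReal ContDiff CompactlySupported

noncomputable section

namespace FreeBdry

/-- Euclidean space `ℝ^L`. -/
abbrev E (L : ℕ) : Type := EuclideanSpace ℝ (Fin L)

/-! ### Embedded submanifolds of Euclidean space -/

/-- `M ⊆ ℝ^L` is a smooth embedded `m`-dimensional submanifold (without boundary): near each of its
points a smooth diffeomorphism between open subsets of `ℝ^L` straightens `M` to an `m`-dimensional
linear subspace. -/
def IsEmbeddedSubmanifold {L : ℕ} (m : ℕ) (M : Set (E L)) : Prop :=
  ∀ p ∈ M, ∃ (Φ : OpenPartialHomeomorph (E L) (E L)) (P : Submodule ℝ (E L)),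
    p ∈ Φ.source ∧ ContDiffOn ℝ ∞ Φ Φ.source ∧ ContDiffOn ℝ ∞ Φ.symm Φ.target ∧
    Module.finrank ℝ P = m ∧ ∀ x ∈ Φ.source, (x ∈ M ↔ Φ x ∈ P)

/-- The tangent space `T_x M`. On an embedded submanifold the tangent cone is already a linear
subspace, the usual tangent space. -/
def tangentSpace {L : ℕ} (M : Set (E L)) (x : E L) : Submodule ℝ (E L) :=
  Submodule.span ℝ (tangentConeAt ℝ M x)

/-- `τ_M(x)`: the orthogonal projection of `ℝ^L` onto `T_x M`. -/
def tangentProj {L : ℕ} (M : Set (E L)) (x : E L) : E L →L[ℝ] E L :=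
  (tangentSpace M x).starProjection

/-- `ν_M(x)`: the orthogonal projection of `ℝ^L` onto `(T_x M)^⊥`. -/
def normalProj {L : ℕ} (M : Set (E L)) (x : E L) : E L →L[ℝ] E L :=
  (tangentSpace M x)ᗮ.starProjection

/-- The second fundamental form `A^M_x(v, w)` of `M` in `ℝ^L`, for `v, w ∈ T_x M`: it is
`(D_v τ_M) w`, where `τ_M` is differentiated along `M`. If `W` is a smooth tangent field of `M` with
`W(x) = w`, then differentiating `W = τ_M W` gives `D_v W = (D_v τ_M) w + τ_M(x) (D_v W)`, so this
is the normal part of `D_v W`. (The derivative along a submanifold is unique on `T_x M`.) -/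
def secondFundamentalForm {L : ℕ} (M : Set (E L)) (x v w : E L) : E L :=
  (fderivWithin ℝ (tangentProj M) M x v) w

/-- `|A^M| ≤ Λ`, for the norm of `A^M_x` as a bilinear map on `T_x M` (no larger than its
Hilbert-Schmidt norm). -/
def SecondFundamentalFormBound {L : ℕ} (M : Set (E L)) (Λ : ℝ) : Prop :=
  ∀ x ∈ M, ∀ v ∈ tangentSpace M x, ∀ w ∈ tangentSpace M x,
    ‖secondFundamentalForm M x v w‖ ≤ Λ * ‖v‖ * ‖w‖

/-- `κ = inf {t ≥ 0 : |ν(x)(y - x)| ≤ (t/2) |y - x|² for all x, y ∈ N}`. -/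
def kappa {L : ℕ} (N : Set (E L)) : ℝ :=
  sInf {t : ℝ | 0 ≤ t ∧ ∀ x ∈ N, ∀ y ∈ N, ‖normalProj N x (y - x)‖ ≤ t / 2 * ‖y - x‖ ^ 2}

/-- The radius of curvature `R₀ = κ⁻¹ ∈ (0, ∞]` of `N`. -/
def radiusOfCurvature {L : ℕ} (N : Set (E L)) : ℝ≥0∞ :=
  (ENNReal.ofReal (kappa N))⁻¹

/-! ### Varifolds -/

/-- The Grassmannian `G(L,k)` of `k`-dimensional linear subspaces of `ℝ^L`; a subspace is identified
with the orthogonal projection onto it. It carries the topology of the operator norm and its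
Borel σ-algebra. -/
abbrev Grassmannian (L k : ℕ) : Type :=
  {S : E L →L[ℝ] E L // IsStarProjection S ∧ Module.finrank ℝ S.range = k}

/-- A `k`-varifold in `ℝ^L`: a Radon measure on `ℝ^L × G(L,k)`. -/
structure Varifold (L k : ℕ) where
  /-- the underlying measure -/
  toMeasure : Measure (E L × Grassmannian L k)
  /-- the measure is finite on compact sets -/
  finiteOnCompacts : IsFiniteMeasureOnCompacts toMeasure

/-- The weak topology on varifolds: the coarsest one for which `V ↦ ∫ f dV` is continuous for all
continuous compactly supported `f` on `ℝ^L × G(L,k)`. -/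
instance instTopologicalSpaceVarifold (L k : ℕ) : TopologicalSpace (Varifold L k) :=
  TopologicalSpace.induced
    (fun V (f : C_c(E L × Grassmannian L k, ℝ)) => ∫ z, f z ∂V.toMeasure) inferInstance

/-- The weight `‖V‖`, a measure on `ℝ^L`. -/
def Varifold.weight {L k : ℕ} (V : Varifold L k) : Measure (E L) :=
  V.toMeasure.map Prod.fst

/-- `R` is countably `k`-rectifiable: up to an `ℋ^k`-null set it is covered by countably many
Lipschitz images of `ℝ^k`. -/
def CountablyRectifiable {L : ℕ} (k : ℕ) (R : Set (E L)) : Prop :=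
  ∃ F : ℕ → E k → E L, (∀ j, ∃ C : ℝ≥0, LipschitzWith C (F j)) ∧
    μH[(k : ℝ)] (R \ ⋃ j, range (F j)) = 0

/-- `S` is the approximate tangent plane of `μ` at `x`, with multiplicity `θ`: the rescalings of `μ`
at `x` converge weakly to `θ` times `ℋ^k` on `S`. -/
def IsApproxTangentPlane {L k : ℕ} (μ : Measure (E L)) (x : E L) (θ : ℝ) (S : Grassmannian L k) :
    Prop :=
  ∀ f : C_c(E L, ℝ),
    Tendsto (fun l : ℝ => (l ^ k)⁻¹ * ∫ y, f (l⁻¹ • (y - x)) ∂μ) (𝓝[>] 0)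
      (𝓝 (θ * ∫ y in {y | S.1 y = y}, f y ∂μH[(k : ℝ)]))

/-- `V` is a rectifiable `k`-varifold: its weight is `θ ℋ^k ⌞ R` for a countably `k`-rectifiable
set `R` and a positive multiplicity `θ` (locally integrable, as `V` is Radon), and `V` is carried by
the approximate tangent planes of that measure. (The normalization of `ℋ^k` is irrelevant, since
multiplicities are real.) -/
def Varifold.IsRectifiable {L k : ℕ} (V : Varifold L k) : Prop :=
  ∃ (R : Set (E L)) (θ : E L → ℝ≥0) (T : E L → Grassmannian L k),
    MeasurableSet R ∧ Measurable θ ∧ Measurable T ∧ (∀ x ∈ R, 0 < θ x) ∧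
    CountablyRectifiable k R ∧
    (∀ᵐ x ∂((μH[(k : ℝ)] : Measure (E L)).restrict R),
      IsApproxTangentPlane
        (((μH[(k : ℝ)] : Measure (E L)).restrict R).withDensity (fun y => (θ y : ℝ≥0∞)))
        x (θ x) (T x)) ∧
    V.toMeasure =
      (((μH[(k : ℝ)] : Measure (E L)).restrict R).withDensity (fun y => (θ y : ℝ≥0∞))).map
        (fun x => (x, T x))

/-- `𝒱_k(M)`: the weak closure of the rectifiable `k`-varifolds in `ℝ^L` supported in `M`; its
members are themselves supported in `M` (which is automatic if `M` is a closed set). -/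
def varifoldsIn {L : ℕ} (k : ℕ) (M : Set (E L)) : Set (Varifold L k) :=
  {V | V ∈ closure {W : Varifold L k | W.IsRectifiable ∧ W.weight.support ⊆ M} ∧
    V.weight.support ⊆ M}

/-! ### First variation -/

/-- The Jacobian `J_S A` of a linear map `A` on the `k`-plane `S`, the square root of
`det ((A|_S)^* (A|_S))`. The determinant is taken on `ℝ^L = S ⊕ S^⊥` after extending
`(A|_S)^* (A|_S) : S → S` by the identity of `S^⊥`, which does not change it. -/
def jacobian {L k : ℕ} (A : E L →L[ℝ] E L) (S : Grassmannian L k) : ℝ :=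
  √((S.1 ∘L (ContinuousLinearMap.adjoint A) ∘L A ∘L S.1 + (1 - S.1)).det)

/-- The weight `‖f_♯ V‖` of the pushforward of `V` by a diffeomorphism `f` of `ℝ^L`:
`‖f_♯ V‖(B) = ∫_{f(x) ∈ B} J_S f(x) dV(x, S)`. -/
def Varifold.pushforwardWeight {L k : ℕ} (V : Varifold L k) (f : E L → E L) : Measure (E L) :=
  (V.toMeasure.withDensity (fun z => ENNReal.ofReal (jacobian (fderiv ℝ f z.1) z.2))).map
    (fun z => f z.1)

/-- `φ` is the flow (one-parameter group of diffeomorphisms) of the vector field `X`. -/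
def IsFlow {L : ℕ} (X : E L → E L) (φ : ℝ → E L → E L) : Prop :=
  (∀ x, φ 0 x = x) ∧ ∀ t x, HasDerivAt (fun s => φ s x) (X (φ t x)) t

/-- `𝔛(M, N)`: smooth compactly supported vector fields on `ℝ^L` tangent to `M` along `M` and to `N`
along `N`. -/
def admissibleFields {L : ℕ} (M N : Set (E L)) : Set (E L → E L) :=
  {X | ContDiff ℝ ∞ X ∧ HasCompactSupport X ∧
    (∀ x ∈ M, X x ∈ tangentSpace M x) ∧ ∀ p ∈ N, X p ∈ tangentSpace N p}

/-- `V` is stationary with free boundary on `N`: for every `X ∈ 𝔛(M, N)` with flow `φ_t`,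
`δV(X) = d/dt|_{t=0} ‖(φ_t)_♯ V‖ = 0`. The mass is taken on the compact set `supp X`, which `φ_t`
maps to itself and off which `φ_t` is the identity, so that it is finite also if `V` has infinite
total mass. -/
def Varifold.IsStationaryFreeBoundary {L k : ℕ} (V : Varifold L k) (M N : Set (E L)) : Prop :=
  ∀ X ∈ admissibleFields M N, ∀ φ : ℝ → E L → E L, IsFlow X φ →
    HasDerivAt (fun t => (V.pushforwardWeight (φ t)).real (tsupport X)) 0 0

/-- `|∇_S^⊥ r|²` at `x`, for `r = |· - p|`: the squared length of the projection of `∇r(x)` to the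
orthogonal complement of `S`. -/
def sqNormPerpGradDist {L k : ℕ} (p x : E L) (S : Grassmannian L k) : ℝ :=
  ‖(1 - S.1) (gradient (fun y => ‖y - p‖) x)‖ ^ 2

end FreeBdry

end

/-!
The proof tests the stationarity of `V` with a radial field corrected near `N`. Write `r = |x - p|`,
let `ξ` be the nearest point projection onto `N`, and put `ζ(x) = -ν(ξ(x)) (ξ(x) - p)`
(`radialCorrection`). The field `Y = x - p + ζ` is tangent to `N` along `N`. The definition of `κ`
gives `|ζ| ≤ 2κ r²`, and, since it also bounds the derivative of the tangential projection along `N`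
by `κ` (`norm_fderiv_fderiv_nearestPoint_le`), `|Dζ| ≤ 4κ r` on the ball of radius `1/(2κ)`. The
chord estimate makes `ξ` well defined and monotone where `κ d(·, N) < 1`
(`IsEmbeddedSubmanifold.nearestPoint_monotone`), and the implicit function theorem makes it smooth
there (`contDiffAt_nearestPoint`).

The fields that may be tested are tangent to `M`, while `η(r) Y` is only tangent to `N` along `N`.
Projecting it to the tangent spaces of `M` changes the divergence along a plane `S ⊆ T_x M` by at
most `k Λ |η Y|` (`IsEmbeddedSubmanifold.traceOn_fderiv_sub_le`). That the planes of `V` are tangent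
to `M` holds for rectifiable varifolds by comparing approximate and true tangent planes, and passes
to the weak closure (`IsEmbeddedSubmanifold.ae_tangent_of_mem_varifoldsIn`). The derivative of the
mass under a flow is the integral of the divergence (`hasDerivAt_pushforwardWeight_flow`), by
expanding the Jacobian uniformly in the plane.

With `η' = -g`, `a = 2κ` and `b = 4κ` this yields
`∫ η k (1 - b r - Λ r (1 + a r)) - g r (1 + a r) + g r |∇_S^⊥ r|² dV ≤ 0`
(`Varifold.IsStationaryFreeBoundary.integral_radial_le`). For `h(s) = e^{Λ₁ s} / s^k` the choice
`g = h(s) / (s (1 + a s))` on `[σ, ρ)`, and `0` elsewhere, makes the last term the integrand of the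
theorem, and the inequality `-h'(s) ≤ g(s) k (1 - b r - Λ r (1 + a r))` for `r ≤ s`
(`exp_div_pow_sub_le`) bounds the other terms below by `h(σ) 1_{r < σ} - h(ρ) 1_{r < ρ}`.
Integrating over the ball of radius `ρ` gives the claim; here `γ = 2κ` and `Λ₁ = k (Λ + a + b)`.
-/

namespace FreeBdry

/-! ### Flows of compactly supported vector fields -/

section

section Flow

variable {F : Type*} [NormedAddCommGroup F] [NormedSpace ℝ F]

/-- A bounded Lipschitz field has global integral curves: the Picard solutions on the intervals
`[-(n + 1), n + 1]` agree by uniqueness, and are glued. -/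
theorem exists_forall_hasDerivAt [CompleteSpace F] {X : F → F} {K C : ℝ≥0} (hX : LipschitzWith K X)
    (hb : ∀ x, ‖X x‖ ≤ C) (x : F) :
    ∃ α : ℝ → F, α 0 = x ∧ ∀ t, HasDerivAt α (X (α t)) t := by
  have h0 : ∀ n : ℕ, (0 : ℝ) ∈ Icc (-((n : ℝ) + 1)) ((n : ℝ) + 1) := fun n =>
    ⟨by have : (0 : ℝ) ≤ n := n.cast_nonneg
        linarith, by positivity⟩
  have hex : ∀ n : ℕ, ∃ α : ℝ → F, α 0 = x ∧ ∀ t ∈ Icc (-((n : ℝ) + 1)) ((n : ℝ) + 1),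
      HasDerivWithinAt α (X (α t)) (Icc (-((n : ℝ) + 1)) ((n : ℝ) + 1)) t := by
    intro n
    have hP : IsPicardLindelof (fun _ => X) (⟨0, h0 n⟩ : Icc (-((n : ℝ) + 1)) ((n : ℝ) + 1)) x
        (C * (n + 1)) 0 C K := by
      refine IsPicardLindelof.of_time_independent (fun y _ => hb y) hX.lipschitzOnWith ?_
      simp
    exact hP.exists_eq_forall_mem_Icc_hasDerivWithinAt₀
  choose α hα0 hα using hex
  have hd : ∀ n : ℕ, ∀ t ∈ Ioo (-((n : ℝ) + 1)) ((n : ℝ) + 1),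
      HasDerivAt (α n) (X (α n t)) t := fun n t ht =>
    (hα n t (Ioo_subset_Icc_self ht)).hasDerivAt (Icc_mem_nhds ht.1 ht.2)
  have hagree : ∀ n m : ℕ, n ≤ m → ∀ t : ℝ, |t| < n + 1 → α n t = α m t := by
    intro n m hnm t ht
    have hnm' : (n : ℝ) ≤ m := by exact_mod_cast hnm
    refine ODE_solution_unique_of_mem_Ioo (v := fun _ => X) (s := fun _ => univ) (K := K)
      (a := -((n : ℝ) + 1)) (b := (n : ℝ) + 1) (t₀ := 0)
      (fun _ _ => hX.lipschitzOnWith) ?_ (fun s hs => ⟨hd n s hs, trivial⟩)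
      (fun s hs => ⟨hd m s ⟨by linarith [hs.1], by linarith [hs.2]⟩, trivial⟩)
      ((hα0 n).trans (hα0 m).symm) (abs_lt.1 ht)
    have : (0 : ℝ) ≤ n := n.cast_nonneg
    constructor <;> linarith
  refine ⟨fun t => α ⌈|t|⌉₊ t, by simpa using hα0 _, fun t => ?_⟩
  have hlt : ∀ s : ℝ, |s| < ⌈|s|⌉₊ + 1 := fun s => (Nat.le_ceil _).trans_lt (by linarith)
  have key : ∀ s : ℝ, |s| < (⌈|t|⌉₊ + 1 : ℕ) → α ⌈|s|⌉₊ s = α (⌈|t|⌉₊ + 1) s := fun s hs =>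
    hagree _ _ (Nat.ceil_le.2 hs.le) s (hlt s)
  have ht : |t| < (⌈|t|⌉₊ + 1 : ℕ) := by exact_mod_cast hlt t
  have hev : (fun s => α ⌈|s|⌉₊ s) =ᶠ[𝓝 t] α (⌈|t|⌉₊ + 1) := by
    filter_upwards [(continuous_abs.tendsto t).eventually_lt_const ht] with s hs using key s hs
  have h2 := hd (⌈|t|⌉₊ + 1) t (abs_lt.1 (ht.trans (by linarith)))
  simp only [key t ht]
  exact h2.congr_of_eventuallyEq hev

/-- Integral curves of a Lipschitz vector field separate at most exponentially in positive time. -/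
theorem dist_integralCurve_le {X : F → F} {K : ℝ≥0} (hX : LipschitzWith K X) {α β : ℝ → F}
    (hα : ∀ t, HasDerivAt α (X (α t)) t) (hβ : ∀ t, HasDerivAt β (X (β t)) t) {t : ℝ}
    (ht : 0 ≤ t) : dist (α t) (β t) ≤ dist (α 0) (β 0) * Real.exp (K * t) := by
  have := dist_le_of_trajectories_ODE (v := fun _ => X) (a := 0) (b := t) (fun _ => hX)
    (fun s _ => (hα s).continuousAt.continuousWithinAt) (fun s _ => (hα s).hasDerivWithinAt)
    (fun s _ => (hβ s).continuousAt.continuousWithinAt) (fun s _ => (hβ s).hasDerivWithinAt)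
    le_rfl t ⟨ht, le_rfl⟩
  simpa using this

/-- The flow `φ_t`, `0 ≤ t ≤ T`, of a bounded vector field with bounded and Lipschitz derivative is
differentiable in the initial point, with derivative `1 + t DX + O(t²)` uniformly in the point. The
derivative is the solution of the linearized equation `A' = DX(φ_t) A`. -/
theorem hasFDerivAt_flow_forward [CompleteSpace F] {X : F → F} {K C₂ C : ℝ≥0}
    (hd : Differentiable ℝ X) (hK : ∀ x, ‖fderiv ℝ X x‖ ≤ K) (h2 : LipschitzWith C₂ (fderiv ℝ X))
    (hb : ∀ x, ‖X x‖ ≤ C) {φ : ℝ → F → F} (h0 : ∀ x, φ 0 x = x)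
    (hφ : ∀ t x, HasDerivAt (fun s => φ s x) (X (φ t x)) t) {t : ℝ} (ht : 0 ≤ t)
    (htK : t * (2 * K + 1) ≤ 1) (x : F) :
    ∃ A : F →L[ℝ] F, HasFDerivAt (φ t) A x ∧
      ‖A - 1 - t • fderiv ℝ X x‖ ≤ (2 * C₂ * C + 2 * K * K) * t ^ 2 := by
  set T : ℝ := 1 / (2 * K + 1) with hT
  have hT0 : 0 < T := by positivity
  have htT : t ≤ T := by rw [hT, le_div_iff₀ (by positivity)]; exact htK
  have hX : LipschitzWith K X := lipschitzWith_of_nnnorm_fderiv_le hd fun x => hK x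
  have hcont : ∀ x, Continuous fun s => φ s x := fun x =>
    continuous_iff_continuousAt.2 fun s => (hφ s x).continuousAt
  have hcont2 : Continuous fun s => fderiv ℝ X (φ s x) := h2.continuous.comp (hcont x)
  -- The solution of the linearized equation stays in the unit ball around `1` up to time `T`.
  have hP : IsPicardLindelof (fun s (A : F →L[ℝ] F) => fderiv ℝ X (φ s x) ∘L A)
      (⟨0, ⟨by linarith, hT0.le⟩⟩ : Icc (-T) T) (1 : F →L[ℝ] F) 1 0 (2 * K) K := by
    have hn1 : ‖(1 : F →L[ℝ] F)‖ ≤ 1 := ContinuousLinearMap.norm_id_le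
    refine ⟨fun s _ => ?_, fun A _ => ?_, fun s _ A hA => ?_, ?_⟩
    · refine LipschitzWith.lipschitzOnWith (LipschitzWith.of_dist_le_mul fun A B => ?_)
      rw [dist_eq_norm, dist_eq_norm, ← ContinuousLinearMap.comp_sub]
      exact (ContinuousLinearMap.opNorm_comp_le _ _).trans (by gcongr; exact hK _)
    · exact (hcont2.clm_comp continuous_const).continuousOn
    · have : ‖A‖ ≤ 2 := by
        have h := norm_le_norm_add_norm_sub' A 1
        rw [mem_closedBall_iff_norm] at hA
        simp only [NNReal.coe_one] at hA
        linarith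
      refine (ContinuousLinearMap.opNorm_comp_le _ _).trans ?_
      push_cast
      rw [mul_comm (2 : ℝ)]
      gcongr
      exact hK _
    · simp only [sub_zero, zero_sub, neg_neg, max_self, NNReal.coe_zero, NNReal.coe_one]
      push_cast
      rw [hT, mul_one_div, div_le_one (by positivity)]
      linarith
  obtain ⟨A, hA0, hA⟩ := hP.exists_eq_forall_mem_Icc_hasDerivWithinAt₀
  simp only at hA0
  have hA' : ∀ s ∈ Ico 0 t, HasDerivWithinAt A (fderiv ℝ X (φ s x) ∘L A s) (Ici s) s := by
    intro s hs
    refine (hA s ⟨by linarith [hs.1], by linarith [hs.2]⟩).mono_of_mem_nhdsWithin ?_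
    exact mem_of_superset (Icc_mem_nhdsGE (show s < T by linarith [hs.2]))
      (Icc_subset_Icc_left (by linarith [hs.1]))
  have hAc : ContinuousOn A (Icc 0 t) := fun s hs =>
    ((hA s ⟨by linarith [hs.1], by linarith [hs.2]⟩).continuousWithinAt).mono
      (Icc_subset_Icc (by linarith) htT)
  have hn1 : ‖(1 : F →L[ℝ] F)‖ ≤ 1 := ContinuousLinearMap.norm_id_le
  have hK0 : (0 : ℝ) ≤ K := K.2
  have hKt : K * t ≤ 1 / 2 := by nlinarith
  have hA1 : ∀ s ∈ Icc 0 t, ‖A s - 1‖ ≤ 2 * K * s ∧ ‖A s‖ ≤ 2 := by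
    have hgr : ∀ s ∈ Icc 0 t, ‖A s - 1‖ ≤ gronwallBound 0 K K (s - 0) := by
      refine norm_le_gronwallBound_of_norm_deriv_right_le (f' := fun s => fderiv ℝ X (φ s x) ∘L A s)
        (hAc.sub continuousOn_const) (fun s hs => (hA' s hs).sub_const _) (by simp [hA0]) ?_
      intro s hs
      calc ‖fderiv ℝ X (φ s x) ∘L A s‖ ≤ K * ‖A s‖ :=
            (ContinuousLinearMap.opNorm_comp_le _ _).trans (by gcongr; exact hK _)
        _ ≤ K * (‖A s - 1‖ + 1) := by
            gcongr
            have := norm_le_norm_sub_add (A s) 1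
            linarith
        _ = K * ‖A s - 1‖ + K := by ring
    intro s hs
    have h1 : ‖A s - 1‖ ≤ 2 * K * s := by
      refine (hgr s hs).trans ?_
      have hKs0 : 0 ≤ K * s := mul_nonneg hK0 hs.1
      have hKs : K * s ≤ 1 / 2 := (mul_le_mul_of_nonneg_left hs.2 hK0).trans hKt
      rcases eq_or_ne (K : ℝ) 0 with hz | hz
      · rw [hz, gronwallBound_K0]; simp
      · rw [gronwallBound_of_K_ne_0 hz]
        simp only [sub_zero, zero_mul, zero_add, div_self hz, one_mul]
        have := Real.abs_exp_sub_one_le (x := K * s) (by rw [abs_of_nonneg hKs0]; linarith)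
        rw [abs_of_nonneg hKs0] at this
        linarith [le_abs_self (Real.exp (K * s) - 1)]
    refine ⟨h1, ?_⟩
    have h3 := norm_le_norm_sub_add (A s) 1
    have h4 : K * s ≤ 1 / 2 := (mul_le_mul_of_nonneg_left hs.2 hK0).trans hKt
    linarith
  refine ⟨A t, ?_, ?_⟩
  · -- quadratic remainder estimate by Grönwall
    have hmv : ∀ y z : F, ‖X z - X y - fderiv ℝ X y (z - y)‖ ≤ C₂ * ‖z - y‖ ^ 2 := by
      intro y z
      have := (convex_segment y z).norm_image_sub_le_of_norm_hasFDerivWithin_le'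
        (f := X) (f' := fderiv ℝ X) (φ := fderiv ℝ X y) (C := C₂ * ‖z - y‖)
        (fun w _ => (hd w).hasFDerivAt.hasFDerivWithinAt) (fun w hw => ?_)
        (left_mem_segment ℝ y z) (right_mem_segment ℝ y z)
      · calc _ ≤ C₂ * ‖z - y‖ * ‖z - y‖ := this
          _ = _ := by ring
      · rw [← dist_eq_norm]
        refine (h2.dist_le_mul _ _).trans ?_
        gcongr
        rw [dist_eq_norm]
        have := norm_sub_le_of_mem_segment hw
        simpa [norm_sub_rev] using this
    have hest : ∀ h : F, ‖φ t (x + h) - φ t x - A t h‖ ≤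
        C₂ * (Real.exp (K * t)) ^ 2 * gronwallBound 0 K 1 t * ‖h‖ ^ 2 := by
      intro h
      set e : ℝ := C₂ * (Real.exp (K * t)) ^ 2 * ‖h‖ ^ 2 with he
      have hgr := norm_le_gronwallBound_of_norm_deriv_right_le (a := 0) (b := t) (δ := 0) (K := K)
        (ε := e) (f := fun s => φ s (x + h) - φ s x - A s h)
        (f' := fun s => X (φ s (x + h)) - X (φ s x) - (fderiv ℝ X (φ s x) ∘L A s) h)
        (((hcont _).sub (hcont _)).continuousOn.sub (hAc.clm_apply continuousOn_const))
        (fun s hs => (((hφ s (x + h)).sub (hφ s x)).hasDerivWithinAt).sub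
          (by simpa using (hA' s hs).clm_apply (hasDerivWithinAt_const s (Ici s) h)))
        (by simp [hA0, h0]) ?_ t ⟨ht, le_rfl⟩
      · refine hgr.trans (le_of_eq ?_)
        rcases eq_or_ne (K : ℝ) 0 with hz | hz
        · rw [hz, gronwallBound_K0, gronwallBound_K0, he, hz]; simp; ring
        · rw [gronwallBound_of_K_ne_0 hz, gronwallBound_of_K_ne_0 hz, he]; simp; ring
      · intro s hs
        have hdist : ‖φ s (x + h) - φ s x‖ ≤ ‖h‖ * Real.exp (K * t) := by
          have := dist_integralCurve_le hX (hφ · (x + h)) (hφ · x) hs.1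
          rw [h0, h0, dist_eq_norm, dist_eq_norm, add_sub_cancel_left] at this
          refine this.trans ?_
          have := hs.2.le
          gcongr
        have e1 : X (φ s (x + h)) - X (φ s x) - (fderiv ℝ X (φ s x) ∘L A s) h =
            (X (φ s (x + h)) - X (φ s x) - fderiv ℝ X (φ s x) (φ s (x + h) - φ s x)) +
              fderiv ℝ X (φ s x) (φ s (x + h) - φ s x - A s h) := by
          simp only [map_sub, ContinuousLinearMap.comp_apply]; abel
        rw [e1]
        refine (norm_add_le _ _).trans ?_
        rw [add_comm]
        refine add_le_add ((ContinuousLinearMap.le_opNorm _ _).trans (by gcongr; exact hK _)) ?_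
        refine (hmv _ _).trans ?_
        rw [he, mul_assoc]
        gcongr
        calc ‖φ s (x + h) - φ s x‖ ^ 2 ≤ (‖h‖ * Real.exp (K * t)) ^ 2 := by gcongr
          _ = _ := by ring
    rw [hasFDerivAt_iff_isLittleO_nhds_zero]
    refine Asymptotics.IsBigO.trans_isLittleO (g := fun h : F => ‖h‖ ^ 2) ?_ ?_
    · exact Asymptotics.IsBigO.of_bound _ (Eventually.of_forall fun h => by
        simpa using hest h)
    · exact Asymptotics.isLittleO_norm_right.1 (by
        simpa using (Asymptotics.isLittleO_norm_pow_id (E' := F) (one_lt_two)).norm_right)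
  · have := image_norm_le_of_norm_deriv_right_le_deriv_boundary
      (f := fun s => A s - 1 - s • fderiv ℝ X x)
      (f' := fun s => fderiv ℝ X (φ s x) ∘L A s - fderiv ℝ X x) (a := 0) (b := t)
      (B := fun s => (C₂ * C + K * K) * s ^ 2 )
      (B' := fun s => (C₂ * C + K * K) * (2 * s))
      ((hAc.sub continuousOn_const).sub (by fun_prop))
      (fun s hs => ((hA' s hs).sub_const _).sub (by
        simpa using ((hasDerivAt_id s).smul_const (fderiv ℝ X x)).hasDerivWithinAt))
      (by simp [hA0]) (fun s => by simpa using (hasDerivAt_pow 2 s).const_mul (C₂ * C + K * K : ℝ))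
      ?_ (x := t) ⟨ht, le_rfl⟩
    · refine this.trans ?_
      have : (0 : ℝ) ≤ C₂ * C + K * K := by positivity
      nlinarith [sq_nonneg t]
    · intro s hs
      have hs' : s ∈ Icc 0 t := ⟨hs.1, hs.2.le⟩
      have e1 : fderiv ℝ X (φ s x) ∘L A s - fderiv ℝ X x =
          (fderiv ℝ X (φ s x) - fderiv ℝ X x) ∘L A s + fderiv ℝ X x ∘L (A s - 1) := by
        rw [ContinuousLinearMap.sub_comp, ContinuousLinearMap.comp_sub]
        ext; simp
      rw [e1]
      refine (norm_add_le _ _).trans ?_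
      have hm : ‖φ s x - x‖ ≤ C * s := by
        have := norm_image_sub_le_of_norm_deriv_le_segment_01' (f := fun u => φ (u * s) x)
          (f' := fun u => s • X (φ (u * s) x)) (C := C * s)
          (fun u _ => by
            have := (hφ (u * s) x).scomp u ((hasDerivAt_id u).mul_const s)
            simpa [Function.comp_def] using this.hasDerivWithinAt)
          (fun u _ => by
            rw [norm_smul, Real.norm_of_nonneg hs.1, mul_comm]
            have := hs.1
            gcongr
            exact hb _)
        simpa [h0] using this
      have i1 : ‖(fderiv ℝ X (φ s x) - fderiv ℝ X x) ∘L A s‖ ≤ C₂ * (C * s) * 2 := by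
        refine (ContinuousLinearMap.opNorm_comp_le _ _).trans ?_
        gcongr
        · have := hs.1
          positivity
        · rw [← dist_eq_norm]
          refine (h2.dist_le_mul _ _).trans ?_
          rw [dist_eq_norm]; gcongr
        · exact (hA1 s hs').2
      have i2 : ‖fderiv ℝ X x ∘L (A s - 1)‖ ≤ K * (2 * K * s) := by
        refine (ContinuousLinearMap.opNorm_comp_le _ _).trans ?_
        gcongr
        · exact hK _
        · exact (hA1 s hs').1
      linarith

end Flow

variable {L : ℕ}

theorem fderiv_bounds_of_hasCompactSupport {X : E L → E L} (hX : ContDiff ℝ ∞ X)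
    (hc : HasCompactSupport X) : ∃ K C₂ C : ℝ≥0, (∀ x, ‖fderiv ℝ X x‖ ≤ K) ∧
      LipschitzWith C₂ (fderiv ℝ X) ∧ ∀ x, ‖X x‖ ≤ C := by
  have hX' : ContDiff ℝ ∞ (fderiv ℝ X) := hX.fderiv_right (by simp)
  obtain ⟨K, hK⟩ := hX'.continuous.bounded_above_of_compact_support (hc.fderiv ℝ)
  obtain ⟨C, hC⟩ := hX.continuous.bounded_above_of_compact_support hc
  obtain ⟨C₂, hC₂⟩ := hX'.lipschitzWith_of_hasCompactSupport (hc.fderiv ℝ) (by simp)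
  exact ⟨K.toNNReal, C₂, C.toNNReal, fun x => (hK x).trans (Real.le_coe_toNNReal K), hC₂,
    fun x => (hC x).trans (Real.le_coe_toNNReal C)⟩

theorem exists_isFlow {X : E L → E L} (hX : ContDiff ℝ ∞ X) (hc : HasCompactSupport X) :
    ∃ φ, IsFlow X φ := by
  obtain ⟨K, C₂, C, hK, -, hC⟩ := fderiv_bounds_of_hasCompactSupport hX hc
  have hL : LipschitzWith K X :=
    lipschitzWith_of_nnnorm_fderiv_le (hX.differentiable (by simp)) fun x => hK x
  choose α hα0 hα using exists_forall_hasDerivAt hL hC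
  exact ⟨fun t x => α x t, hα0, fun t x => hα x t⟩

theorem IsFlow.neg {X : E L → E L} {φ : ℝ → E L → E L} (h : IsFlow X φ) :
    IsFlow (-X) (fun t => φ (-t)) := by
  refine ⟨by simpa using h.1, fun t x => ?_⟩
  have := (h.2 (-t) x).scomp t (hasDerivAt_neg t)
  simpa [Function.comp_def] using this

/-- `Dφ_t = 1 + t DX + O(t²)` for the flow of a smooth compactly supported field, uniformly on
`ℝ^L`. -/
theorem exists_fderiv_flow_expansion {X : E L → E L} (hX : ContDiff ℝ ∞ X)
    (hc : HasCompactSupport X) : ∃ T > 0, ∃ C, ∀ φ, IsFlow X φ → ∀ t, |t| ≤ T → ∀ x,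
      ‖fderiv ℝ (φ t) x - 1 - t • fderiv ℝ X x‖ ≤ C * t ^ 2 := by
  obtain ⟨K, C₂, C, hK, hC₂, hC⟩ := fderiv_bounds_of_hasCompactSupport hX hc
  have hd : Differentiable ℝ X := hX.differentiable (by simp)
  refine ⟨1 / (2 * K + 1), by positivity, 2 * C₂ * C + 2 * K * K, fun φ hφ t ht x => ?_⟩
  have htK : |t| * (2 * K + 1) ≤ 1 := by rwa [le_div_iff₀ (by positivity)] at ht
  rcases le_total 0 t with h | h
  · rw [abs_of_nonneg h] at htK
    obtain ⟨A, hA, hA'⟩ := hasFDerivAt_flow_forward hd hK hC₂ hC hφ.1 hφ.2 h htK x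
    rwa [hA.fderiv]
  · rw [abs_of_nonpos h] at htK
    have hfn : fderiv ℝ (-X) = -fderiv ℝ X := by ext y; simp [fderiv_neg]
    obtain ⟨A, hA, hA'⟩ := hasFDerivAt_flow_forward (X := -X) hd.neg
      (by simpa [hfn] using hK) (by rw [hfn]; exact hC₂.neg) (by simpa using hC) hφ.neg.1 hφ.neg.2
      (neg_nonneg.2 h) htK x
    rw [neg_neg] at hA
    rw [hA.fderiv]
    simpa [hfn] using hA'

theorem IsFlow.continuous {X : E L → E L} (hX : ContDiff ℝ ∞ X)
    (hc : HasCompactSupport X) {φ : ℝ → E L → E L} (h : IsFlow X φ) (t : ℝ) :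
    Continuous (φ t) := by
  have key : ∀ {Y : E L → E L} (_ : ContDiff ℝ ∞ Y) (_ : HasCompactSupport Y)
      {ψ : ℝ → E L → E L} (_ : IsFlow Y ψ) {s : ℝ}, 0 ≤ s → Continuous (ψ s) := by
    intro Y hY hcY ψ hψ s hs
    obtain ⟨K, C₂, C, hK, -, -⟩ := fderiv_bounds_of_hasCompactSupport hY hcY
    have hL : LipschitzWith K Y :=
      lipschitzWith_of_nnnorm_fderiv_le (hY.differentiable (by simp)) fun x => hK x
    refine LipschitzWith.continuous
      (LipschitzWith.of_dist_le_mul (K := (Real.exp (K * s)).toNNReal) fun x y => ?_)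
    have := dist_integralCurve_le hL (hψ.2 · x) (hψ.2 · y) hs
    rwa [hψ.1, hψ.1, mul_comm, ← Real.coe_toNNReal _ (Real.exp_pos (K * s)).le] at this
  rcases le_total 0 t with ht | ht
  · exact key hX hc h ht
  · simpa using key hX.neg (hc.comp_left (g := Neg.neg) neg_zero) h.neg (neg_nonneg.2 ht)

/-- A flow fixes the zeros of its field, and hence maps the support of the field to itself. -/
theorem IsFlow.mem_tsupport_iff {X : E L → E L} (hX : ContDiff ℝ ∞ X)
    (hc : HasCompactSupport X) {φ : ℝ → E L → E L} (h : IsFlow X φ) (t : ℝ) (x : E L) :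
    φ t x ∈ tsupport X ↔ x ∈ tsupport X := by
  obtain ⟨K, C₂, C, hK, -, -⟩ := fderiv_bounds_of_hasCompactSupport hX hc
  have hL : LipschitzWith K X :=
    lipschitzWith_of_nnnorm_fderiv_le (hX.differentiable (by simp)) fun x => hK x
  have key : ∀ y s, X y = 0 → φ s x = y → ∀ u, φ u x = y := by
    intro y s hy hs u
    refine congrFun (ODE_solution_unique_univ (v := fun _ => X) (s := fun _ => univ) (K := K)
      (t₀ := s) (f := fun u => φ u x) (g := fun _ => y)
      (fun _ => hL.lipschitzOnWith) (fun v => ⟨h.2 v x, trivial⟩)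
      (fun v => ⟨by simpa [hy] using hasDerivAt_const v y, trivial⟩) hs) u
  constructor
  · intro hx
    by_contra hn
    rw [key x 0 (image_eq_zero_of_notMem_tsupport hn) (h.1 x) t] at hx
    exact hn hx
  · intro hx
    by_contra hn
    have := key _ t (image_eq_zero_of_notMem_tsupport hn) rfl 0
    rw [h.1] at this
    exact hn (this ▸ hx)

end

/-! ### Traces on planes and the expansion of the Jacobian -/

section

variable {L k : ℕ}

/-- The trace, as a continuous linear functional on the endomorphisms of `ℝ^L`. -/
noncomputable def traceL (L : ℕ) : (E L →L[ℝ] E L) →L[ℝ] ℝ :=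
  LinearMap.toContinuousLinearMap (LinearMap.trace ℝ (E L) ∘ₗ ContinuousLinearMap.coeLM ℝ)

theorem traceL_apply (A : E L →L[ℝ] E L) : traceL L A = LinearMap.trace ℝ (E L) A := rfl

theorem traceL_eq_sum (A : E L →L[ℝ] E L) {ι : Type*} [Fintype ι]
    (b : OrthonormalBasis ι ℝ (E L)) : traceL L A = ∑ i, inner ℝ (b i) (A (b i)) :=
  LinearMap.trace_eq_sum_inner _ b

theorem traceL_adjoint (A : E L →L[ℝ] E L) :
    traceL L (ContinuousLinearMap.adjoint A) = traceL L A := by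
  rw [traceL_eq_sum _ (stdOrthonormalBasis ℝ (E L)), traceL_eq_sum _ (stdOrthonormalBasis ℝ (E L))]
  refine Finset.sum_congr rfl fun i _ => ?_
  rw [ContinuousLinearMap.adjoint_inner_right, real_inner_comm]

theorem differentiable_det : Differentiable ℝ fun A : E L →L[ℝ] E L => A.det := by
  have h : (fun A : E L →L[ℝ] E L => A.det) = fun A =>
      ∑ σ : Equiv.Perm (Fin L), (Equiv.Perm.sign σ : ℝ) *
        ∏ i, (A (EuclideanSpace.single i 1)) (σ i) := by
    ext A
    rw [ContinuousLinearMap.det,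
      ← LinearMap.det_toMatrix (EuclideanSpace.basisFun (Fin L) ℝ).toBasis, Matrix.det_apply']
    simp [LinearMap.toMatrix_apply]
  rw [h]
  fun_prop

theorem det_one_add_smul_expansion (B : E L →L[ℝ] E L) :
    HasDerivAt (fun t : ℝ => (1 + t • B).det) (traceL L B) 0 := by
  let b := (EuclideanSpace.basisFun (Fin L) ℝ).toBasis
  set M := LinearMap.toMatrix b b (B : E L →ₗ[ℝ] E L) with hM
  have h : (fun t : ℝ => (1 + t • B).det) = fun t : ℝ => 1 + M.trace * t +
      ((1 + (Polynomial.X : Polynomial ℝ) • M.map Polynomial.C).det.divX.divX).eval t * t ^ 2 := by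
    ext t
    rw [← Matrix.det_one_add_smul, ContinuousLinearMap.det, ← LinearMap.det_toMatrix b]
    congr 1
    simp [hM, LinearMap.toMatrix_one]
  have htr : traceL L B = M.trace := by
    rw [traceL_apply, LinearMap.trace_eq_matrix_trace ℝ b]
  rw [h, htr]
  have h1 := (((hasDerivAt_id (0 : ℝ)).const_mul M.trace).const_add 1).add
    ((Polynomial.hasDerivAt (1 + (Polynomial.X : Polynomial ℝ) • M.map Polynomial.C).det.divX.divX
      0).mul (hasDerivAt_pow 2 (0 : ℝ)))
  exact h1.congr_deriv (by simp)

/-- `√det(1 + B) = 1 + tr B / 2 + o(‖B‖)`. -/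
theorem hasFDerivAt_sqrt_det_one_add :
    HasFDerivAt (fun B : E L →L[ℝ] E L => √((1 + B).det)) ((2⁻¹ : ℝ) • traceL L) 0 := by
  have hd : DifferentiableAt ℝ (fun B : E L →L[ℝ] E L => (1 + B).det) 0 :=
    (differentiable_det.comp (differentiable_id.const_add 1)) 0
  have hf : fderiv ℝ (fun B : E L →L[ℝ] E L => (1 + B).det) 0 = traceL L := by
    ext B
    have h1 := hd.hasFDerivAt
    have h2 : HasDerivAt (fun t : ℝ => t • B) B 0 := by
      simpa using (hasDerivAt_id (0 : ℝ)).smul_const B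
    have h3 := HasFDerivAt.comp_hasDerivAt_of_eq (x := (0 : ℝ)) h1 h2 (zero_smul ℝ B).symm
    exact h3.unique (det_one_add_smul_expansion B)
  have h := hd.hasFDerivAt
  rw [hf] at h
  have h1 : ((1 : E L →L[ℝ] E L) + 0).det = 1 := by
    rw [add_zero]; exact LinearMap.det_id
  have := h.sqrt (by rw [h1]; norm_num)
  rw [h1] at this
  simpa using this

/-- `div_S D = tr (S D S)`, the trace of `D` on the `k`-plane `S`. -/
noncomputable def traceOn (D : E L →L[ℝ] E L) (S : Grassmannian L k) : ℝ :=
  traceL L (S.1 ∘L D ∘L S.1)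

theorem Grassmannian.comp_self (S : Grassmannian L k) : S.1 ∘L S.1 = S.1 := S.2.1.isIdempotentElem

theorem Grassmannian.apply_apply (S : Grassmannian L k) (v : E L) : S.1 (S.1 v) = S.1 v :=
  DFunLike.congr_fun S.comp_self v

theorem Grassmannian.adjoint_eq (S : Grassmannian L k) :
    ContinuousLinearMap.adjoint S.1 = S.1 := S.2.1.isSelfAdjoint

theorem Grassmannian.norm_le (S : Grassmannian L k) : ‖S.1‖ ≤ 1 :=
  IsStarProjection.norm_le S.1 S.2.1

theorem Grassmannian.norm_conj_le (S : Grassmannian L k) (D : E L →L[ℝ] E L) :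
    ‖S.1 ∘L D ∘L S.1‖ ≤ ‖D‖ := by
  calc ‖S.1 ∘L D ∘L S.1‖ ≤ ‖S.1‖ * (‖D‖ * ‖S.1‖) :=
        (ContinuousLinearMap.opNorm_comp_le _ _).trans
          (by gcongr; exact ContinuousLinearMap.opNorm_comp_le _ _)
    _ ≤ 1 * (‖D‖ * 1) := by gcongr <;> exact S.norm_le
    _ = ‖D‖ := by ring

theorem abs_traceOn_le (D : E L →L[ℝ] E L) (S : Grassmannian L k) :
    |traceOn D S| ≤ ‖traceL L‖ * ‖D‖ :=
  ((traceL L).le_opNorm _).trans (by gcongr; exact S.norm_conj_le D)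

theorem trace_grassmannian (P : E L →L[ℝ] E L) (hP : IsStarProjection P) :
    traceL L P = Module.finrank ℝ P.range := by
  rw [traceL_apply]
  refine LinearMap.IsProj.trace (p := P.range) (f := (P : E L →ₗ[ℝ] E L)) ⟨fun x => ⟨x, rfl⟩, ?_⟩
  rintro _ ⟨y, rfl⟩
  exact DFunLike.congr_fun hP.isIdempotentElem y

/-- The Grassmannian is closed and bounded in the operator norm; the dimension of a plane is the
trace of its projection. -/
instance : CompactSpace (Grassmannian L k) := by
  have hs : {S : E L →L[ℝ] E L | IsStarProjection S ∧ Module.finrank ℝ S.range = k} =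
      {S | S * S = S} ∩ {S | star S = S} ∩ {S | traceL L S = k} := by
    ext S
    constructor
    · rintro ⟨h1, h2⟩
      exact ⟨⟨h1.isIdempotentElem, h1.isSelfAdjoint⟩, by
        rw [mem_ofPred_eq, trace_grassmannian S h1, h2]⟩
    · rintro ⟨⟨h1, h2⟩, h3⟩
      have h4 : IsStarProjection S := ⟨h1, h2⟩
      refine ⟨h4, ?_⟩
      rw [mem_ofPred_eq, trace_grassmannian S h4] at h3
      exact_mod_cast h3
  have hcl : IsClosed {S : E L →L[ℝ] E L | IsStarProjection S ∧ Module.finrank ℝ S.range = k} := by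
    rw [hs]
    exact ((isClosed_eq (continuous_id.mul continuous_id) continuous_id).inter
      (isClosed_eq ContinuousLinearMap.adjoint.continuous continuous_id)).inter
      (isClosed_eq (traceL L).continuous continuous_const)
  refine isCompact_iff_compactSpace.1 (Metric.isCompact_of_isClosed_isBounded hcl ?_)
  refine (Metric.isBounded_closedBall (x := 0) (r := 1)).subset fun S hS => ?_
  rw [mem_closedBall_zero_iff]
  exact IsStarProjection.norm_le S hS.1

/-- If `A = 1 + t D + O(t²)`, then `(A|_S)^* (A|_S)` extended by the identity of `S^⊥` is `1 + B`
with `B = O(t)` and `tr B = 2 t tr (S D S) + O(t²)`. -/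
theorem exists_jacobian_eq_sqrt_det {K C t : ℝ} (hK : 0 ≤ K) (hC : 0 ≤ C) (ht : |t| ≤ 1)
    {A D : E L →L[ℝ] E L} (S : Grassmannian L k) (hD : ‖D‖ ≤ K)
    (hA : ‖A - 1 - t • D‖ ≤ C * t ^ 2) :
    ∃ B : E L →L[ℝ] E L, jacobian A S = √((1 + B).det) ∧
      ‖B‖ ≤ (2 * K + (2 * C + (K + C) ^ 2)) * |t| ∧
      |2⁻¹ * traceL L B - t * traceOn D S| ≤
        ‖traceL L‖ * (2 * C + (K + C) ^ 2) * t ^ 2 := by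
  let adj : (E L →L[ℝ] E L) → (E L →L[ℝ] E L) := fun A => ContinuousLinearMap.adjoint A
  have adj_add : ∀ A B, adj (A + B) = adj A + adj B := fun A B => map_add _ A B
  have adj_one : adj 1 = 1 := star_one (E L →L[ℝ] E L)
  have adj_smul : ∀ (s : ℝ) A, adj (s • A) = s • adj A := fun s A => by simp [adj]
  have adj_norm : ∀ A, ‖adj A‖ = ‖A‖ := fun A => LinearIsometryEquiv.norm_map _ A
  set Q : ℝ := 2 * C + (K + C) ^ 2 with hQ
  have hQ0 : 0 ≤ Q := by positivity
  have ht0 := abs_nonneg t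
  have htt : t ^ 2 = |t| * |t| := by rw [← sq, sq_abs]
  -- write `A = 1 + t D + R`; then `A^* A = 1 + t (D + D^*) + W` with `W = O(t²)`
  obtain ⟨R, hR⟩ : ∃ R, R = A - 1 - t • D := ⟨_, rfl⟩
  rw [← hR] at hA
  obtain ⟨W, hW⟩ : ∃ W, W = R + adj R + adj (t • D + R) * (t • D + R) := ⟨_, rfl⟩
  have hAe : adj A * A - 1 = t • (D + adj D) + W := by
    have : A = 1 + (t • D + R) := by rw [hR]; abel
    rw [hW, this]
    simp only [adj_add, adj_one, adj_smul, add_mul, mul_add, one_mul, mul_one, smul_add]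
    abel
  have hRt : ‖R‖ ≤ C * |t| := hA.trans (by rw [htt]; nlinarith [mul_le_mul_of_nonneg_left ht ht0])
  have hsum : ‖t • D + R‖ ≤ (K + C) * |t| := by
    refine (norm_add_le _ _).trans ?_
    rw [norm_smul, Real.norm_eq_abs]
    nlinarith [mul_le_mul_of_nonneg_left hD ht0]
  have hWn : ‖W‖ ≤ Q * t ^ 2 := by
    rw [hW]
    refine (norm_add_le _ _).trans ?_
    have h1 : ‖R + adj R‖ ≤ 2 * (C * t ^ 2) :=
      (norm_add_le _ _).trans (by rw [adj_norm]; linarith)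
    have h2 : ‖adj (t • D + R) * (t • D + R)‖ ≤ ((K + C) * |t|) ^ 2 := by
      refine (ContinuousLinearMap.opNorm_comp_le _ _).trans ?_
      rw [adj_norm, sq]
      gcongr
    rw [mul_pow, sq_abs] at h2
    rw [hQ]; linarith
  obtain ⟨B, hB⟩ : ∃ B, B = S.1 ∘L (adj A * A - 1) ∘L S.1 := ⟨_, rfl⟩
  refine ⟨B, ?_, ?_, ?_⟩
  · rw [jacobian]
    congr 2
    have : B = S.1 ∘L (adj A * A) ∘L S.1 - S.1 := by
      rw [hB, ContinuousLinearMap.sub_comp, ContinuousLinearMap.comp_sub]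
      congr 1
      exact S.comp_self
    rw [this]
    change S.1 ∘L (adj A * A) ∘L S.1 + (1 - S.1) = _
    abel
  · rw [hB]
    refine (S.norm_conj_le _).trans ?_
    rw [hAe]
    refine (norm_add_le _ _).trans ?_
    have h1 : ‖t • (D + adj D)‖ ≤ |t| * (2 * K) := by
      rw [norm_smul, Real.norm_eq_abs]
      gcongr
      exact (norm_add_le _ _).trans (by rw [adj_norm]; linarith)
    have h2 : Q * t ^ 2 ≤ Q * |t| := by
      gcongr; rw [htt]; nlinarith
    linarith
  · have hstar : traceL L (S.1 ∘L adj D ∘L S.1) = traceL L (S.1 ∘L D ∘L S.1) := by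
      rw [← traceL_adjoint (S.1 ∘L D ∘L S.1), ContinuousLinearMap.adjoint_comp,
        ContinuousLinearMap.adjoint_comp, S.adjoint_eq]
      rfl
    have htrB : 2⁻¹ * traceL L B - t * traceOn D S = 2⁻¹ * traceL L (S.1 ∘L W ∘L S.1) := by
      rw [hB, hAe, ContinuousLinearMap.add_comp, ContinuousLinearMap.comp_add,
        ContinuousLinearMap.smul_comp, ContinuousLinearMap.comp_smul, ContinuousLinearMap.add_comp,
        ContinuousLinearMap.comp_add, map_add, map_smul, map_add, hstar, traceOn, smul_eq_mul]
      ring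
    rw [htrB, abs_mul, abs_of_pos (by norm_num : (0 : ℝ) < 2⁻¹)]
    have h1 : |traceL L (S.1 ∘L W ∘L S.1)| ≤ ‖traceL L‖ * (Q * t ^ 2) :=
      ((traceL L).le_opNorm _).trans (by gcongr; exact (S.norm_conj_le W).trans hWn)
    have h2 : 0 ≤ ‖traceL L‖ * (Q * t ^ 2) := by positivity
    linarith

/-- `J_S A = 1 + t tr (S D S) + o(t)` when `A = 1 + t D + O(t²)`, uniformly in `S` and in bounded
`D`. -/
theorem exists_jacobian_expansion {K C ε : ℝ} (hK : 0 ≤ K) (hC : 0 ≤ C) (hε : 0 < ε) :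
    ∃ δ > 0, ∀ (A D : E L →L[ℝ] E L) (t : ℝ) (S : Grassmannian L k), |t| < δ → ‖D‖ ≤ K →
      ‖A - 1 - t • D‖ ≤ C * t ^ 2 → |jacobian A S - 1 - t * traceOn D S| ≤ ε * |t| := by
  obtain ⟨q, hq⟩ : ∃ q, q = ‖traceL L‖ * (2 * C + (K + C) ^ 2) := ⟨_, rfl⟩
  have hq0 : 0 ≤ q := by rw [hq]; positivity
  obtain ⟨M, hM⟩ : ∃ M, M = 2 * K + (2 * C + (K + C) ^ 2) := ⟨_, rfl⟩
  have hM0 : 0 ≤ M := by rw [hM]; positivity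
  have hexp := hasFDerivAt_iff_isLittleO_nhds_zero.1 (hasFDerivAt_sqrt_det_one_add (L := L))
  have hη : 0 < ε / (2 * (M + 1)) := by positivity
  obtain ⟨δ₁, hδ₁, hδ⟩ := Metric.eventually_nhds_iff.1 (hexp.def hη)
  refine ⟨min 1 (min (δ₁ / (M + 1)) (ε / (2 * (q + 1)))), by positivity,
    fun A D t S ht hD hA => ?_⟩
  have ht1 : |t| ≤ 1 := (ht.trans_le (min_le_left _ _)).le
  have ht2 : |t| * (M + 1) < δ₁ := by
    rw [← lt_div_iff₀ (by positivity)]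
    exact ht.trans_le ((min_le_right _ _).trans (min_le_left _ _))
  have ht3 : |t| * (2 * (q + 1)) < ε := by
    rw [← lt_div_iff₀ (by positivity)]
    exact ht.trans_le ((min_le_right _ _).trans (min_le_right _ _))
  have ht0 := abs_nonneg t
  obtain ⟨B, hj, hBn, hBt⟩ := exists_jacobian_eq_sqrt_det hK hC ht1 S hD hA
  rw [← hq] at hBt
  rw [← hM] at hBn
  have hmain := hδ (y := B) (by rw [dist_zero_right]; nlinarith)
  have h1 : ((1 : E L →L[ℝ] E L) + 0).det = 1 := by
    rw [add_zero]; exact LinearMap.det_id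
  rw [zero_add, h1, Real.sqrt_one, ← hj, Real.norm_eq_abs] at hmain
  change |jacobian A S - 1 - 2⁻¹ * traceL L B| ≤ _ at hmain
  have hmB : ε / (2 * (M + 1)) * ‖B‖ ≤ ε / 2 * |t| := by
    calc ε / (2 * (M + 1)) * ‖B‖ ≤ ε / (2 * (M + 1)) * ((M + 1) * |t|) := by
          gcongr; nlinarith
      _ = ε / 2 * |t| := by field_simp
  have hqt : q * t ^ 2 ≤ ε / 2 * |t| := by
    rw [← sq_abs t, sq, ← mul_assoc]
    gcongr
    nlinarith
  rw [abs_le] at hmain hBt ⊢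
  constructor <;> linarith [hmain.1, hmain.2, hBt.1, hBt.2]

end

/-! ### The first variation of a varifold -/

section

variable {L k : ℕ}

theorem continuous_traceOn {D : E L → E L →L[ℝ] E L} (hD : Continuous D) :
    Continuous fun z : E L × Grassmannian L k => traceOn (D z.1) z.2 := by
  have h2 : Continuous fun z : E L × Grassmannian L k => z.2.1 :=
    continuous_subtype_val.comp continuous_snd
  exact (traceL L).continuous.comp
    (h2.clm_comp ((hD.comp continuous_fst).clm_comp h2))

theorem Varifold.measure_compact_prod_lt_top (V : Varifold L k) {K : Set (E L)}
    (hK : IsCompact K) : V.toMeasure (K ×ˢ univ) < ⊤ :=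
  have := V.finiteOnCompacts
  (hK.prod isCompact_univ).measure_lt_top

theorem traceOn_fderiv_eq_zero {X : E L → E L} {z : E L × Grassmannian L k}
    (hz : z ∉ tsupport X ×ˢ (univ : Set (Grassmannian L k))) :
    traceOn (fderiv ℝ X z.1) z.2 = 0 := by
  have h1 : fderiv ℝ X z.1 = 0 := by
    by_contra h
    exact hz ⟨support_fderiv_subset ℝ h, trivial⟩
  rw [h1, traceOn]
  simp

/-- A continuous function on `ℝ^L × G(L,k)` vanishing off a compact set of base points is integrable
for every varifold. -/
theorem Varifold.integrable_of_continuous (V : Varifold L k) {f : E L × Grassmannian L k → ℝ}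
    (hf : Continuous f) {K : Set (E L)} (hK : IsCompact K) (h0 : ∀ z, z.1 ∉ K → f z = 0) :
    Integrable f V.toMeasure := by
  have := V.finiteOnCompacts
  refine hf.integrable_of_hasCompactSupport ?_
  refine HasCompactSupport.intro (hK.prod isCompact_univ) fun z hz => h0 z fun h => hz ⟨h, trivial⟩

/-- The first variation formula `δV(X) = ∫ div_S X dV(x, S)`: the mass of the push-forward under the
flow of `X` has this derivative at time `0`. -/
theorem hasDerivAt_pushforwardWeight_flow (V : Varifold L k) {X : E L → E L}
    (hX : ContDiff ℝ ∞ X) (hc : HasCompactSupport X) {φ : ℝ → E L → E L} (hφ : IsFlow X φ) :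
    HasDerivAt (fun t => (V.pushforwardWeight (φ t)).real (tsupport X))
      (∫ z, traceOn (fderiv ℝ X z.1) z.2 ∂V.toMeasure) 0 := by
  have hX' : ContDiff ℝ ∞ (fderiv ℝ X) := hX.fderiv_right (by simp)
  set A : Set (E L × Grassmannian L k) := tsupport X ×ˢ univ with hA
  have hAm : MeasurableSet A := (isClosed_tsupport X).measurableSet.prod MeasurableSet.univ
  set μ := V.toMeasure.restrict A with hμ
  have hfin : IsFiniteMeasure μ :=
    isFiniteMeasure_restrict.2 (V.measure_compact_prod_lt_top hc).ne
  set c : E L × Grassmannian L k → ℝ := fun z => traceOn (fderiv ℝ X z.1) z.2 with hcdef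
  have hint : ∫ z, c z ∂V.toMeasure = ∫ z, c z ∂μ :=
    (setIntegral_eq_integral_of_forall_compl_eq_zero fun z hz => traceOn_fderiv_eq_zero hz).symm
  have hci : Integrable c μ :=
    (V.integrable_of_continuous (continuous_traceOn hX'.continuous) hc fun z hz =>
      traceOn_fderiv_eq_zero fun h => hz h.1).restrict
  have hmass : ∀ t, (V.pushforwardWeight (φ t)).real (tsupport X) =
      (∫⁻ z, ENNReal.ofReal (jacobian (fderiv ℝ (φ t) z.1) z.2) ∂μ).toReal := by
    intro t
    have hm : Measurable fun z : E L × Grassmannian L k => φ t z.1 :=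
      ((hφ.continuous hX hc t).comp continuous_fst).measurable
    rw [measureReal_def, Varifold.pushforwardWeight,
      Measure.map_apply hm (isClosed_tsupport X).measurableSet,
      withDensity_apply _ (hm (isClosed_tsupport X).measurableSet)]
    congr 3
    ext z
    simp [hA, hφ.mem_tsupport_iff hX hc]
  obtain ⟨K, hK⟩ := hX'.continuous.bounded_above_of_compact_support (hc.fderiv ℝ)
  have hK0 : 0 ≤ K := (norm_nonneg _).trans (hK 0)
  obtain ⟨T, hT, C, hC⟩ := exists_fderiv_flow_expansion hX hc
  have hC' : ∀ t, |t| ≤ T → ∀ x, ‖fderiv ℝ (φ t) x - 1 - t • fderiv ℝ X x‖ ≤ |C| * t ^ 2 :=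
    fun t ht x => (hC φ hφ t ht x).trans (by gcongr; exact le_abs_self C)
  -- the two-sided bound for the mass follows from the pointwise one for the Jacobian
  have hest : ∀ ε > 0, ∃ δ > 0, ∀ t, |t| < δ →
      |(V.pushforwardWeight (φ t)).real (tsupport X) - μ.real univ - t * ∫ z, c z ∂μ| ≤
        ε * |t| * μ.real univ := by
    intro ε hε
    obtain ⟨δ, hδ, hJ⟩ := exists_jacobian_expansion (L := L) (k := k) hK0 (abs_nonneg C) hε
    refine ⟨min δ (min T (1 / (ε + ‖traceL L‖ * K + 1))), by positivity, fun t ht => ?_⟩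
    have ht1 : |t| < δ := ht.trans_le (min_le_left _ _)
    have ht2 : |t| ≤ T := (ht.trans_le ((min_le_right _ _).trans (min_le_left _ _))).le
    have ht3 : |t| * (ε + ‖traceL L‖ * K + 1) < 1 := by
      rw [← lt_div_iff₀ (by positivity)]
      exact ht.trans_le ((min_le_right _ _).trans (min_le_right _ _))
    have hj : ∀ z : E L × Grassmannian L k,
        |jacobian (fderiv ℝ (φ t) z.1) z.2 - 1 - t * c z| ≤ ε * |t| := fun z =>
      hJ _ _ t z.2 ht1 (hK z.1) (hC' t ht2 z.1)
    have hcz : ∀ z, |t * c z| ≤ |t| * (‖traceL L‖ * K) := fun z => by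
      rw [abs_mul]
      gcongr
      exact (abs_traceOn_le _ _).trans (by gcongr; exact hK _)
    have hi : ∀ e : ℝ, Integrable (fun z => 1 + t * c z + e) μ := fun e =>
      ((integrable_const 1).add (hci.const_mul t)).add (integrable_const e)
    have hI : ∀ e : ℝ, ∫ z, (1 + t * c z + e) ∂μ =
        μ.real univ + t * ∫ z, c z ∂μ + e * μ.real univ := fun e => by
      have h1 : Integrable (fun z => 1 + t * c z) μ := (integrable_const 1).add (hci.const_mul t)
      rw [integral_add h1 (integrable_const e),
        integral_add (integrable_const 1) (hci.const_mul t), integral_const_mul]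
      simp [mul_comm]
    have hpos : ∀ e : ℝ, |e| ≤ ε * |t| → ∀ z, 0 ≤ 1 + t * c z + e := fun e he z => by
      have h1 := abs_le.1 (hcz z)
      have h2 := abs_le.1 he
      nlinarith [abs_nonneg t, h1.1, h2.1]
    have hεt : 0 ≤ ε * |t| := by positivity
    have hL : ∀ e : ℝ, |e| ≤ ε * |t| → ∫⁻ z, ENNReal.ofReal (1 + t * c z + e) ∂μ =
        ENNReal.ofReal (μ.real univ + t * ∫ z, c z ∂μ + e * μ.real univ) := fun e he => by
      rw [← hI, ofReal_integral_eq_lintegral_ofReal (hi e) (ae_of_all _ (hpos e he))]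
    have hnn : ∀ e : ℝ, |e| ≤ ε * |t| → 0 ≤ μ.real univ + t * ∫ z, c z ∂μ + e * μ.real univ :=
      fun e he => by
        rw [← hI]; exact integral_nonneg (hpos e he)
    have he1 : abs (ε * |t|) ≤ ε * |t| := by rw [abs_of_nonneg hεt]
    have he2 : abs (-(ε * |t|)) ≤ ε * |t| := by rw [abs_neg, abs_of_nonneg hεt]
    have hup : ∫⁻ z, ENNReal.ofReal (jacobian (fderiv ℝ (φ t) z.1) z.2) ∂μ ≤
        ENNReal.ofReal (μ.real univ + t * ∫ z, c z ∂μ + ε * |t| * μ.real univ) := by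
      rw [← hL _ he1]
      refine lintegral_mono fun z => ENNReal.ofReal_le_ofReal ?_
      linarith [(abs_le.1 (hj z)).2]
    have hlo : ENNReal.ofReal (μ.real univ + t * ∫ z, c z ∂μ + -(ε * |t|) * μ.real univ) ≤
        ∫⁻ z, ENNReal.ofReal (jacobian (fderiv ℝ (φ t) z.1) z.2) ∂μ := by
      rw [← hL _ he2]
      refine lintegral_mono fun z => ENNReal.ofReal_le_ofReal ?_
      linarith [(abs_le.1 (hj z)).1]
    rw [hmass]
    have h1 := ENNReal.toReal_mono ENNReal.ofReal_ne_top hup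
    have h2 := ENNReal.toReal_mono (hup.trans_lt ENNReal.ofReal_lt_top).ne hlo
    rw [ENNReal.toReal_ofReal (hnn _ he1)] at h1
    rw [ENNReal.toReal_ofReal (hnn _ he2)] at h2
    rw [abs_le]
    constructor <;> linarith
  have h0 : (V.pushforwardWeight (φ 0)).real (tsupport X) = μ.real univ := by
    obtain ⟨δ, hδ, h⟩ := hest 1 one_pos
    have := h 0 (by simpa using hδ)
    simpa [sub_eq_zero] using this
  change HasDerivAt _ (∫ z, c z ∂V.toMeasure) 0
  rw [hint, hasDerivAt_iff_isLittleO_nhds_zero]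
  refine Asymptotics.isLittleO_iff.2 fun ε hε => ?_
  have hm0 : 0 ≤ μ.real univ := measureReal_nonneg
  obtain ⟨δ, hδ, h⟩ := hest (ε / (μ.real univ + 1)) (by positivity)
  filter_upwards [Metric.ball_mem_nhds (0 : ℝ) hδ] with t ht
  rw [Metric.mem_ball, Real.dist_eq, sub_zero] at ht
  simp only [zero_add, h0, Real.norm_eq_abs, smul_eq_mul]
  refine (h t ht).trans ?_
  rw [div_mul_eq_mul_div, div_mul_eq_mul_div, div_le_iff₀ (by positivity)]
  have : 0 ≤ ε * |t| := by positivity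
  nlinarith

/-- Stationarity in divergence form: `∫ div_S X dV(x, S) = 0` for every admissible field. -/
theorem Varifold.IsStationaryFreeBoundary.integral_traceOn_eq_zero {V : Varifold L k}
    {M N : Set (E L)} (h : V.IsStationaryFreeBoundary M N) {X : E L → E L}
    (hX : X ∈ admissibleFields M N) :
    ∫ z, traceOn (fderiv ℝ X z.1) z.2 ∂V.toMeasure = 0 := by
  obtain ⟨φ, hφ⟩ := exists_isFlow hX.1 hX.2.1
  exact (hasDerivAt_pushforwardWeight_flow V hX.1 hX.2.1 hφ).unique (h X hX φ hφ)

end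

/-! ### Charts of embedded submanifolds -/

section

variable {L k m : ℕ}

/-- `Φ` is a smooth diffeomorphism between open sets that straightens `M` to the linear
subspace `P`. -/
structure Straightens (Φ : OpenPartialHomeomorph (E L) (E L)) (P : Submodule ℝ (E L))
    (M : Set (E L)) : Prop where
  contDiffOn : ContDiffOn ℝ ∞ Φ Φ.source
  contDiffOn_symm : ContDiffOn ℝ ∞ Φ.symm Φ.target
  mem_iff : ∀ x ∈ Φ.source, (x ∈ M ↔ Φ x ∈ P)

theorem IsEmbeddedSubmanifold.exists_straightens {M : Set (E L)} (hM : IsEmbeddedSubmanifold m M)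
    {p : E L} (hp : p ∈ M) : ∃ (Φ : OpenPartialHomeomorph (E L) (E L)) (P : Submodule ℝ (E L)),
      p ∈ Φ.source ∧ Straightens Φ P M := by
  obtain ⟨Φ, P, h1, h2, h3, -, h4⟩ := hM p hp
  exact ⟨Φ, P, h1, ⟨h2, h3, h4⟩⟩

section Chart

variable {Φ : OpenPartialHomeomorph (E L) (E L)} {P : Submodule ℝ (E L)} {M : Set (E L)}

theorem Straightens.hasFDerivAt (h : Straightens Φ P M) {y : E L} (hy : y ∈ Φ.source) :
    HasFDerivAt Φ (fderiv ℝ Φ y) y :=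
  ((h.contDiffOn.contDiffAt (Φ.open_source.mem_nhds hy)).differentiableAt (by simp)).hasFDerivAt

theorem Straightens.hasFDerivAt_symm (h : Straightens Φ P M) {w : E L} (hw : w ∈ Φ.target) :
    HasFDerivAt Φ.symm (fderiv ℝ Φ.symm w) w :=
  ((h.contDiffOn_symm.contDiffAt (Φ.open_target.mem_nhds hw)).differentiableAt
    (by simp)).hasFDerivAt

theorem Straightens.fderiv_symm_comp (h : Straightens Φ P M) {y : E L} (hy : y ∈ Φ.source) :
    fderiv ℝ Φ.symm (Φ y) ∘L fderiv ℝ Φ y = ContinuousLinearMap.id ℝ (E L) := by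
  have h1 := (h.hasFDerivAt_symm (Φ.map_source hy)).comp y (h.hasFDerivAt hy)
  refine h1.unique ((hasFDerivAt_id y).congr_of_eventuallyEq ?_)
  filter_upwards [Φ.open_source.mem_nhds hy] with z hz using Φ.left_inv hz

theorem Straightens.fderiv_comp_symm (h : Straightens Φ P M) {y : E L} (hy : y ∈ Φ.source) :
    fderiv ℝ Φ y ∘L fderiv ℝ Φ.symm (Φ y) = ContinuousLinearMap.id ℝ (E L) := by
  have h0 : HasFDerivAt Φ (fderiv ℝ Φ y) (Φ.symm (Φ y)) := by
    rw [Φ.left_inv hy]; exact h.hasFDerivAt hy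
  have h1 := h0.comp (Φ y) (h.hasFDerivAt_symm (Φ.map_source hy))
  refine h1.unique ((hasFDerivAt_id (Φ y)).congr_of_eventuallyEq ?_)
  filter_upwards [Φ.open_target.mem_nhds (Φ.map_source hy)] with z hz using Φ.right_inv hz

theorem submodule_subset_tangentConeAt {s : Set (E L)} {w : E L} (hw : w ∈ P)
    (hs : s ∈ 𝓝 w) : (P : Set (E L)) ⊆ tangentConeAt ℝ ((P : Set (E L)) ∩ s) w := by
  rw [tangentConeAt_inter_nhds hs]
  intro u hu
  exact mem_tangentConeAt_of_pow_smul (r := 1 / 2) (by norm_num) (by norm_num [abs_of_pos])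
    (Eventually.of_forall fun n => P.add_mem hw (P.smul_mem _ hu))

theorem tangentConeAt_submodule_subset {w : E L} (hw : w ∈ P) :
    tangentConeAt ℝ (P : Set (E L)) w ⊆ P := by
  intro v hv
  obtain ⟨c, d, hd0, hd, hcd⟩ := mem_tangentConeAt_iff_exists_seq.1 hv
  refine P.closed_of_finiteDimensional.mem_of_tendsto hcd ?_
  filter_upwards [hd] with n hn
  exact P.smul_mem _ (by simpa using P.sub_mem hn hw)

/-- In a straightening chart the tangent cone of `M` is the preimage of `P` under the derivative. -/
theorem Straightens.tangentConeAt_eq (h : Straightens Φ P M) {y : E L} (hy : y ∈ Φ.source)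
    (hyM : y ∈ M) :
    tangentConeAt ℝ M y = P.map (fderiv ℝ Φ.symm (Φ y) : E L →ₗ[ℝ] E L) := by
  have hP : Φ y ∈ P := (h.mem_iff y hy).1 hyM
  apply Subset.antisymm
  · intro v hv
    rw [← tangentConeAt_inter_nhds (Φ.open_source.mem_nhds hy)] at hv
    have h1 := (h.hasFDerivAt hy).hasFDerivWithinAt.mapsTo_tangent_cone hv
    have h2 := tangentConeAt_submodule_subset hP (tangentConeAt_mono (t := (P : Set (E L))) (by
      rintro _ ⟨z, hz, rfl⟩
      exact (h.mem_iff z hz.2).1 hz.1) h1)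
    exact ⟨_, h2, DFunLike.congr_fun (h.fderiv_symm_comp hy) v⟩
  · rintro _ ⟨u, hu, rfl⟩
    have h0 := submodule_subset_tangentConeAt hP
      (Φ.open_target.mem_nhds (Φ.map_source hy)) hu
    have h1 := (h.hasFDerivAt_symm (Φ.map_source hy)).hasFDerivWithinAt.mapsTo_tangent_cone h0
    rw [Φ.left_inv hy] at h1
    refine tangentConeAt_mono ?_ h1
    rintro _ ⟨z, ⟨hzP, hzt⟩, rfl⟩
    exact (h.mem_iff _ (Φ.map_target hzt)).2 (by rwa [Φ.right_inv hzt])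

theorem Straightens.tangentSpace_eq (h : Straightens Φ P M) {y : E L} (hy : y ∈ Φ.source)
    (hyM : y ∈ M) :
    tangentSpace M y = P.map (fderiv ℝ Φ.symm (Φ y) : E L →ₗ[ℝ] E L) := by
  rw [tangentSpace, h.tangentConeAt_eq hy hyM, Submodule.span_eq]

end Chart

theorem IsEmbeddedSubmanifold.tangentConeAt_eq {M : Set (E L)} (hM : IsEmbeddedSubmanifold m M)
    {p : E L} (hp : p ∈ M) : tangentConeAt ℝ M p = tangentSpace M p := by
  obtain ⟨Φ, P, h1, h⟩ := hM.exists_straightens hp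
  rw [h.tangentSpace_eq h1 hp, h.tangentConeAt_eq h1 hp]

/-- The orthogonal projection onto the range of an injective operator `C` is `C (C^* C)⁻¹ C^*`. -/
theorem starProjection_range_eq {F : Type*} [NormedAddCommGroup F] [InnerProductSpace ℝ F]
    [FiniteDimensional ℝ F] {C : F →L[ℝ] E L} (hC : Function.Injective C) :
    IsUnit (ContinuousLinearMap.adjoint C ∘L C : F →L[ℝ] F) ∧
    C ∘L Ring.inverse (ContinuousLinearMap.adjoint C ∘L C : F →L[ℝ] F) ∘L
      ContinuousLinearMap.adjoint C = C.range.starProjection := by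
  obtain ⟨Q, hQ⟩ : ∃ Q : F →L[ℝ] F, Q = ContinuousLinearMap.adjoint C ∘L C := ⟨_, rfl⟩
  have hinj : Function.Injective Q := by
    rw [injective_iff_map_eq_zero]
    intro u hu
    have : inner ℝ (C u) (C u) = 0 := by
      rw [← ContinuousLinearMap.adjoint_inner_left]
      change inner ℝ ((ContinuousLinearMap.adjoint C ∘L C) u) u = 0
      rw [← hQ, hu, inner_zero_left]
    exact hC ((inner_self_eq_zero.1 this).trans (map_zero C).symm)
  have hunit : IsUnit Q := by
    let e := (LinearEquiv.ofInjectiveEndo (Q : F →ₗ[ℝ] F) hinj).toContinuousLinearEquiv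
    refine ⟨ContinuousLinearEquiv.toUnit e, ?_⟩
    ext u
    rfl
  rw [← hQ]
  refine ⟨hunit, ?_⟩
  ext1 x
  symm
  refine Submodule.eq_starProjection_of_mem_of_inner_eq_zero
    (v := C (Ring.inverse Q (ContinuousLinearMap.adjoint C x))) ⟨_, rfl⟩ ?_
  rintro _ ⟨u, rfl⟩
  change inner ℝ (x - C (Ring.inverse Q (ContinuousLinearMap.adjoint C x))) (C u) = 0
  rw [← ContinuousLinearMap.adjoint_inner_left, map_sub]
  have : ContinuousLinearMap.adjoint C (C (Ring.inverse Q (ContinuousLinearMap.adjoint C x))) =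
      ContinuousLinearMap.adjoint C x := by
    change (ContinuousLinearMap.adjoint C ∘L C) _ = _
    rw [← hQ]
    exact DFunLike.congr_fun (Ring.mul_inverse_cancel Q hunit) _
  rw [this, sub_self, inner_zero_left]

theorem isBoundedLinearMap_adjoint {F : Type*} [NormedAddCommGroup F] [InnerProductSpace ℝ F]
    [CompleteSpace F] :
    IsBoundedLinearMap ℝ fun C : F →L[ℝ] E L => ContinuousLinearMap.adjoint C where
  map_add := map_add _
  map_smul c x := by simp
  bound := ⟨1, one_pos, fun C => by rw [one_mul, LinearIsometryEquiv.norm_map]⟩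

/-- Locally, the tangential projection of a submanifold extends smoothly, by orthogonal projections,
to a neighbourhood in `ℝ^L` in which the submanifold is relatively closed. -/
theorem IsEmbeddedSubmanifold.exists_local_tangentProj {M : Set (E L)}
    (hM : IsEmbeddedSubmanifold m M) {p : E L} (hp : p ∈ M) :
    ∃ (U : Set (E L)) (T : E L → E L →L[ℝ] E L), IsOpen U ∧ p ∈ U ∧ ContDiffOn ℝ ∞ T U ∧
      (∀ y ∈ U, IsStarProjection (T y)) ∧ (∀ y ∈ U ∩ M, T y = tangentProj M y) ∧
      closure M ∩ U ⊆ M := by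
  obtain ⟨Φ, P, hpΦ, h⟩ := hM.exists_straightens hp
  let C : E L → P →L[ℝ] E L := fun y => fderiv ℝ Φ.symm (Φ y) ∘L P.subtypeL
  have hC : ∀ y ∈ Φ.source, Function.Injective (C y) := by
    intro y hy u v huv
    have : fderiv ℝ Φ y (C y u) = fderiv ℝ Φ y (C y v) := by rw [huv]
    have h1 : ∀ u, fderiv ℝ Φ y (C y u) = u := fun u =>
      DFunLike.congr_fun (h.fderiv_comp_symm hy) (u : E L)
    rw [h1, h1] at this
    exact Subtype.ext this
  have hCs : ∀ y ∈ Φ.source, ContDiffAt ℝ ∞ C y := by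
    intro y hy
    have h1 : ContDiffAt ℝ ∞ (fderiv ℝ Φ.symm) (Φ y) :=
      (h.contDiffOn_symm.contDiffAt (Φ.open_target.mem_nhds (Φ.map_source hy))).fderiv_right
        (by simp)
    have h2 := h1.comp y (h.contDiffOn.contDiffAt (Φ.open_source.mem_nhds hy))
    exact h2.clm_comp contDiffAt_const
  let T : E L → E L →L[ℝ] E L := fun y =>
    C y ∘L Ring.inverse (ContinuousLinearMap.adjoint (C y) ∘L C y : P →L[ℝ] P) ∘L
      ContinuousLinearMap.adjoint (C y)
  have hT : ∀ y ∈ Φ.source, T y = (C y).range.starProjection := fun y hy =>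
    (starProjection_range_eq (hC y hy)).2
  refine ⟨Φ.source, T, Φ.open_source, hpΦ, ?_, ?_, ?_, ?_⟩
  · intro y hy
    have hA : ContDiffAt ℝ ∞ (fun y => ContinuousLinearMap.adjoint (C y)) y :=
      isBoundedLinearMap_adjoint.contDiff.contDiffAt.comp y (hCs y hy)
    have hQ := hA.clm_comp (hCs y hy)
    have hI : ContDiffAt ℝ ∞ (fun y =>
        Ring.inverse (ContinuousLinearMap.adjoint (C y) ∘L C y : P →L[ℝ] P)) y := by
      obtain ⟨u, hu⟩ := (starProjection_range_eq (hC y hy)).1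
      have h3 := contDiffAt_ringInverse ℝ (R := P →L[ℝ] P) u (n := ∞)
      rw [hu] at h3
      exact h3.comp y hQ
    exact ((hCs y hy).clm_comp (hI.clm_comp hA)).contDiffWithinAt
  · intro y hy
    rw [hT y hy]
    exact isStarProjection_starProjection
  · rintro y ⟨hy, hyM⟩
    rw [hT y hy, tangentProj]
    have : (C y).range = tangentSpace M y := by
      rw [h.tangentSpace_eq hy hyM]
      ext v
      constructor
      · rintro ⟨u, rfl⟩
        exact ⟨u, u.2, rfl⟩
      · rintro ⟨u, hu, rfl⟩
        exact ⟨⟨u, hu⟩, rfl⟩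
    simp only [this]
  · rintro z ⟨hzM, hz⟩
    rw [h.mem_iff z hz]
    have hne : (𝓝[M] z).NeBot := mem_closure_iff_nhdsWithin_neBot.1 hzM
    have h1 : Tendsto Φ (𝓝[M] z) (𝓝 (Φ z)) := (Φ.continuousAt hz).continuousWithinAt
    refine P.closed_of_finiteDimensional.mem_of_tendsto h1 ?_
    filter_upwards [self_mem_nhdsWithin, mem_nhdsWithin_of_mem_nhds (Φ.open_source.mem_nhds hz)]
      with y hyM hy using (h.mem_iff y hy).1 hyM

/-- The second fundamental form is computed by any local smooth extension of the tangential
projection. -/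
theorem secondFundamentalForm_eq {M U : Set (E L)} {T : E L → E L →L[ℝ] E L} (hU : IsOpen U)
    (hT : ContDiffOn ℝ ∞ T U) (hTM : ∀ y ∈ U ∩ M, T y = tangentProj M y) {x : E L} (hx : x ∈ U)
    (hxM : x ∈ M) {v : E L} (hv : v ∈ tangentSpace M x) (w : E L) :
    secondFundamentalForm M x v w = fderiv ℝ T x v w := by
  have hTx : HasFDerivWithinAt T (fderiv ℝ T x) M x :=
    ((hT.contDiffAt (hU.mem_nhds hx)).differentiableAt (by simp)).hasFDerivAt.hasFDerivWithinAt
  have h1 : HasFDerivWithinAt (tangentProj M) (fderiv ℝ T x) M x := by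
    refine hTx.congr_of_eventuallyEq ?_ (hTM x ⟨hx, hxM⟩).symm
    filter_upwards [self_mem_nhdsWithin, mem_nhdsWithin_of_mem_nhds (hU.mem_nhds hx)]
      with y hyM hy using (hTM y ⟨hy, hyM⟩).symm
  have h2 := h1.differentiableWithinAt.hasFDerivWithinAt
  have h3 : EqOn (fderivWithin ℝ (tangentProj M) M x) (fderiv ℝ T x)
      (Submodule.span ℝ (tangentConeAt ℝ M x)) := LinearMap.eqOn_span (h2.unique_on h1)
  rw [secondFundamentalForm, h3 hv]

end

/-! ### Projecting test fields to the tangent spaces -/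

section

variable {L k m n : ℕ}

theorem tangentProj_eq_self_iff {M : Set (E L)} {x v : E L} :
    tangentProj M x v = v ↔ v ∈ tangentSpace M x :=
  Submodule.starProjection_eq_self_iff

theorem tangentProj_mem (M : Set (E L)) (x v : E L) : tangentProj M x v ∈ tangentSpace M x :=
  Submodule.starProjection_apply_mem _ _

/-- A smooth compactly supported cutoff function for a compact subset of an open set. -/
theorem exists_smooth_cutoff {K U : Set (E L)} (hK : IsCompact K) (hU : IsOpen U) (hKU : K ⊆ U) :
    ∃ χ : E L → ℝ, ContDiff ℝ ∞ χ ∧ HasCompactSupport χ ∧ tsupport χ ⊆ U ∧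
      ∀ x ∈ K, χ =ᶠ[𝓝 x] 1 := by
  obtain ⟨K', hK', hKK', hK'U⟩ := exists_compact_between hK hU hKU
  obtain ⟨f, hf1, hf0, -⟩ := exists_contMDiffMap_one_nhds_of_subset_interior
    (modelWithCornersSelf ℝ (E L)) (n := ⊤) hK.isClosed hKK'
  have hsupp : tsupport f ⊆ K' := closure_minimal (fun x hx => by
    by_contra h
    exact hx (hf0 x h)) hK'.isClosed
  refine ⟨f, f.contMDiff.contDiff, hK'.of_isClosed_subset (isClosed_tsupport _) hsupp,
    hsupp.trans hK'U, fun x hx => ?_⟩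
  exact hf1.filter_mono (nhds_le_nhdsSet hx)

/-- A smooth compactly supported field `Z` whose support avoids the frontier points of `M` can be
projected to the tangent spaces of `M` and extended to a smooth field on `ℝ^L`. -/
theorem IsEmbeddedSubmanifold.exists_tangential_field {M : Set (E L)}
    (hM : IsEmbeddedSubmanifold m M) {Z : E L → E L} (hZ : ContDiff ℝ ∞ Z)
    (hZc : HasCompactSupport Z) (hZM : tsupport Z ∩ closure M ⊆ M) :
    ∃ X : E L → E L, ContDiff ℝ ∞ X ∧ HasCompactSupport X ∧
      ∀ x ∈ M, X x = tangentProj M x (Z x) := by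
  obtain ⟨g, hg⟩ := exists_contMDiffMap_forall_mem_convex_of_local (n := ⊤)
    (modelWithCornersSelf ℝ (E L)) (t := fun x => {v : E L | x ∈ M → v = tangentProj M x (Z x)})
    (fun x => by
      intro v hv w hw a b _ _ hab hx
      rw [hv hx, hw hx, ← add_smul, hab, one_smul])
    (fun x => by
      by_cases hx : x ∈ tsupport Z
      · by_cases hxM : x ∈ M
        · obtain ⟨U, T, hU, hxU, hT, -, hTM, -⟩ := hM.exists_local_tangentProj hxM
          refine ⟨U, hU.mem_nhds hxU, fun y => T y (Z y), ?_, fun y hy hyM => ?_⟩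
          · exact (hT.clm_apply hZ.contDiffOn).contMDiffOn
          · exact DFunLike.congr_fun (hTM y ⟨hy, hyM⟩) _
        · refine ⟨(closure M)ᶜ, isClosed_closure.isOpen_compl.mem_nhds fun h => hxM (hZM ⟨hx, h⟩),
            fun _ => 0, contMDiffOn_const, fun y hy hyM => absurd (subset_closure hyM) hy⟩
      · refine ⟨(tsupport Z)ᶜ, (isClosed_tsupport Z).isOpen_compl.mem_nhds hx, fun _ => 0,
          contMDiffOn_const, fun y hy _ => ?_⟩
        rw [image_eq_zero_of_notMem_tsupport hy, map_zero])
  obtain ⟨χ, hχ, hχc, -, hχ1⟩ := exists_smooth_cutoff hZc isOpen_univ (subset_univ _)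
  refine ⟨fun x => χ x • g x, hχ.smul g.contMDiff.contDiff, hχc.smul_right, fun x hx => ?_⟩
  have h1 : g x = tangentProj M x (Z x) := hg x hx
  by_cases hxZ : x ∈ tsupport Z
  · have h2 : χ x = 1 := (hχ1 x hxZ).eq_of_nhds
    simp [h1, h2]
  · simp [h1, image_eq_zero_of_notMem_tsupport hxZ]

/-- The trace on a `k`-plane as a sum over an orthonormal basis of the plane. -/
theorem Grassmannian.exists_orthonormal (S : Grassmannian L k) :
    ∃ e : Fin k → E L, (∀ i, ‖e i‖ = 1) ∧ (∀ i, S.1 (e i) = e i) ∧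
      ∀ D : E L →L[ℝ] E L, traceOn D S = ∑ i, inner ℝ (e i) (D (e i)) := by
  let b := (stdOrthonormalBasis ℝ S.1.range).reindex (finCongr S.2.2)
  have hfix : ∀ u : S.1.range, S.1 u = u := by
    rintro ⟨_, v, rfl⟩
    exact S.apply_apply v
  refine ⟨fun i => b i, fun i => b.orthonormal.1 i, fun i => hfix _, fun D => ?_⟩
  let π : E L →ₗ[ℝ] S.1.range := (S.1 : E L →ₗ[ℝ] E L).rangeRestrict
  have h1 : ((S.1 ∘L D ∘L S.1 : E L →L[ℝ] E L) : E L →ₗ[ℝ] E L) =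
      (S.1.range.subtype) ∘ₗ (π ∘ₗ (D : E L →ₗ[ℝ] E L) ∘ₗ S.1.range.subtype ∘ₗ π) := by
    ext x : 1
    rfl
  have h2 : (π ∘ₗ (D : E L →ₗ[ℝ] E L) ∘ₗ S.1.range.subtype ∘ₗ π) ∘ₗ S.1.range.subtype =
      π ∘ₗ (D : E L →ₗ[ℝ] E L) ∘ₗ S.1.range.subtype := by
    refine LinearMap.ext fun u => Subtype.ext ?_
    change S.1 (D (S.1 u)) = S.1 (D u)
    rw [hfix]
  rw [traceOn, traceL_apply, h1, LinearMap.trace_comp_comm', h2, LinearMap.trace_eq_sum_inner _ b]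
  refine Finset.sum_congr rfl fun i _ => ?_
  rw [Submodule.coe_inner]
  change inner ℝ (b i : E L) (S.1 (D (b i))) = _
  rw [← ContinuousLinearMap.adjoint_inner_left, S.adjoint_eq, hfix]

/-- For a field `X` with `X = τ_M Z` on `M` and a plane `S ⊆ T_x M`, the divergences of `X` and `Z`
along `S` differ by the pairing of `Z` with the trace of the second fundamental form on `S`. -/
theorem IsEmbeddedSubmanifold.traceOn_fderiv_sub_le {M : Set (E L)}
    (hM : IsEmbeddedSubmanifold m M) {Λ : ℝ} (hA : SecondFundamentalFormBound M Λ)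
    {X Z : E L → E L} {x : E L} (hX : DifferentiableAt ℝ X x) (hZ : DifferentiableAt ℝ Z x)
    (hXZ : ∀ y ∈ M, X y = tangentProj M y (Z y)) (hx : x ∈ M) (S : Grassmannian L k)
    (hS : ∀ v, S.1 v ∈ tangentSpace M x) :
    traceOn (fderiv ℝ Z x) S - k * Λ * ‖Z x‖ ≤ traceOn (fderiv ℝ X x) S := by
  obtain ⟨U, T, hU, hxU, hT, hTs, hTM, -⟩ := hM.exists_local_tangentProj hx
  obtain ⟨e, he1, heS, hetr⟩ := S.exists_orthonormal
  have hTd : HasFDerivAt T (fderiv ℝ T x) x :=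
    ((hT.contDiffAt (hU.mem_nhds hxU)).differentiableAt (by simp)).hasFDerivAt
  have hTZ := hTd.clm_apply hZ.hasFDerivAt
  have hX' : HasFDerivWithinAt X
      ((T x).comp (fderiv ℝ Z x) + (fderiv ℝ T x).flip (Z x)) M x := by
    refine hTZ.hasFDerivWithinAt.congr_of_eventuallyEq ?_ (by rw [hXZ x hx, hTM x ⟨hxU, hx⟩])
    filter_upwards [self_mem_nhdsWithin, mem_nhdsWithin_of_mem_nhds (hU.mem_nhds hxU)]
      with y hyM hy
    rw [hXZ y hyM, hTM y ⟨hy, hyM⟩]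
  have heM : ∀ i, e i ∈ tangentSpace M x := fun i => heS i ▸ hS (e i)
  have heq : ∀ i, fderiv ℝ X x (e i) = T x (fderiv ℝ Z x (e i)) + fderiv ℝ T x (e i) (Z x) := by
    intro i
    have h1 := hX.hasFDerivAt.hasFDerivWithinAt.unique_on hX'
    have h2 := heM i
    rw [← SetLike.mem_coe, ← hM.tangentConeAt_eq hx] at h2
    exact h1 h2
  have hadj : ∀ y ∈ U, ∀ a b : E L, inner ℝ a (T y b) = inner ℝ (T y a) b := fun y hy a b => by
    rw [← ContinuousLinearMap.adjoint_inner_left, (hTs y hy).isSelfAdjoint.adjoint_eq]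
  have hDT : ∀ v a b : E L, inner ℝ a (fderiv ℝ T x v b) = inner ℝ (fderiv ℝ T x v a) b := by
    intro v a b
    have h1 := (hasFDerivAt_const a x).inner ℝ (hTd.clm_apply (hasFDerivAt_const b x))
    have h2 := (hTd.clm_apply (hasFDerivAt_const a x)).inner ℝ (hasFDerivAt_const b x)
    have h3 : (fun y => inner ℝ a (T y b)) =ᶠ[𝓝 x] fun y => inner ℝ (T y a) b := by
      filter_upwards [hU.mem_nhds hxU] with y hy using hadj y hy a b
    have h4 := DFunLike.congr_fun ((h2.congr_of_eventuallyEq h3).unique h1) v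
    simpa using h4.symm
  have hTe : ∀ i, T x (e i) = e i := fun i => by
    rw [hTM x ⟨hxU, hx⟩]
    exact tangentProj_eq_self_iff.2 (heM i)
  have hterm : ∀ i, inner ℝ (e i) (fderiv ℝ X x (e i)) =
      inner ℝ (e i) (fderiv ℝ Z x (e i)) + inner ℝ (fderiv ℝ T x (e i) (e i)) (Z x) := by
    intro i
    rw [heq, inner_add_right, hadj x hxU, hTe, hDT]
  have hb : ∀ i, -(Λ * ‖Z x‖) ≤ inner ℝ (fderiv ℝ T x (e i) (e i)) (Z x) := by
    intro i
    have h1 := hA x hx (e i) (heM i) (e i) (heM i)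
    rw [secondFundamentalForm_eq hU hT hTM hxU hx (heM i), he1, mul_one, mul_one] at h1
    have h2 := abs_real_inner_le_norm (fderiv ℝ T x (e i) (e i)) (Z x)
    have h3 : ‖fderiv ℝ T x (e i) (e i)‖ * ‖Z x‖ ≤ Λ * ‖Z x‖ := by gcongr
    linarith [(abs_le.1 h2).1]
  rw [hetr, hetr, Finset.sum_congr rfl fun i _ => hterm i, Finset.sum_add_distrib]
  have : ∑ i : Fin k, -(Λ * ‖Z x‖) ≤ ∑ i, inner ℝ (fderiv ℝ T x (e i) (e i)) (Z x) :=
    Finset.sum_le_sum fun i _ => hb i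
  simp only [Finset.sum_const, Finset.card_univ, Fintype.card_fin, nsmul_eq_mul] at this
  linarith

/-- The first variation inequality: a free boundary stationary varifold may be tested with ambient
fields which are tangent to `N` along `N`, up to the curvature of `M`. -/
theorem Varifold.IsStationaryFreeBoundary.integral_le_zero {V : Varifold L k}
    {M N : Set (E L)} (h : V.IsStationaryFreeBoundary M N) (hM : IsEmbeddedSubmanifold m M)
    (hNM : N ⊆ M) {Λ : ℝ} (hA : SecondFundamentalFormBound M Λ)
    (hV : ∀ᵐ z ∂V.toMeasure, z.1 ∈ M ∧ ∀ v, z.2.1 v ∈ tangentSpace M z.1)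
    {Z : E L → E L} (hZ : ContDiff ℝ ∞ Z)
    (hZc : HasCompactSupport Z) (hZM : tsupport Z ∩ closure M ⊆ M)
    (hZN : ∀ q ∈ N, Z q ∈ tangentSpace N q) :
    Integrable (fun z => traceOn (fderiv ℝ Z z.1) z.2 - k * Λ * ‖Z z.1‖) V.toMeasure ∧
      ∫ z, (traceOn (fderiv ℝ Z z.1) z.2 - k * Λ * ‖Z z.1‖) ∂V.toMeasure ≤ 0 := by
  obtain ⟨X, hX, hXc, hXZ⟩ := hM.exists_tangential_field hZ hZc hZM
  have hadm : X ∈ admissibleFields M N := by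
    refine ⟨hX, hXc, fun x hx => ?_, fun q hq => ?_⟩
    · rw [hXZ x hx]; exact tangentProj_mem _ _ _
    · have h1 : Z q ∈ tangentSpace M q := Submodule.span_mono (tangentConeAt_mono hNM) (hZN q hq)
      rw [hXZ q (hNM hq), tangentProj_eq_self_iff.2 h1]
      exact hZN q hq
  have hcont : ∀ {Y : E L → E L}, ContDiff ℝ ∞ Y → Continuous (fderiv ℝ Y) := fun hY =>
    hY.continuous_fderiv (by simp)
  have hiX : Integrable (fun z => traceOn (fderiv ℝ X z.1) z.2) V.toMeasure :=
    V.integrable_of_continuous (continuous_traceOn (hcont hX)) hXc fun z hz =>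
      traceOn_fderiv_eq_zero fun h => hz h.1
  have hiZ : Integrable (fun z => traceOn (fderiv ℝ Z z.1) z.2 - k * Λ * ‖Z z.1‖) V.toMeasure := by
    refine V.integrable_of_continuous ((continuous_traceOn (hcont hZ)).sub
      (continuous_const.mul (hZ.continuous.comp continuous_fst).norm)) hZc fun z hz => ?_
    rw [traceOn_fderiv_eq_zero fun h => hz h.1, image_eq_zero_of_notMem_tsupport hz]
    simp
  refine ⟨hiZ, ?_⟩
  rw [← h.integral_traceOn_eq_zero hadm]
  refine integral_mono_ae hiZ hiX ?_
  filter_upwards [hV] with z hz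
  exact hM.traceOn_fderiv_sub_le hA (hX.differentiable (by simp) _) (hZ.differentiable (by simp) _)
    hXZ hz.1 z.2 hz.2

end

/-! ### Planes of varifolds in the weak closure -/

section

variable {L k m n : ℕ}

/-- `ℋ^k` gives positive integral on a `k`-plane to a nonnegative bump around a point of the
plane. -/
theorem setIntegral_plane_pos (S : Grassmannian L k) (f : C_c(E L, ℝ)) (hf : ∀ y, 0 ≤ f y)
    {u : E L} (hu : S.1 u = u) (hfu : f u ≠ 0) :
    0 < ∫ y in {y | S.1 y = y}, f y ∂μH[(k : ℝ)] := by
  have hset : {y | S.1 y = y} = range ((↑) : S.1.range → E L) := by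
    ext y
    constructor
    · intro hy
      exact ⟨⟨y, y, hy⟩, rfl⟩
    · rintro ⟨⟨_, v, rfl⟩, rfl⟩
      exact S.apply_apply v
  have hiso : Isometry ((↑) : S.1.range → E L) := isometry_subtype_coe
  have hemb : IsClosedEmbedding ((↑) : S.1.range → E L) :=
    S.1.range.closed_of_finiteDimensional.isClosedEmbedding_subtypeVal
  rw [hset, ← hiso.map_hausdorffMeasure (Or.inl k.cast_nonneg),
    hemb.measurableEmbedding.integral_map]
  have hk : (k : ℝ) = Module.finrank ℝ S.1.range := by rw [S.2.2]
  rw [hk]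
  have hcs : HasCompactSupport fun y : S.1.range => f y :=
    f.hasCompactSupport.comp_isClosedEmbedding hemb
  have hc : Continuous fun y : S.1.range => f y := f.continuous.comp continuous_subtype_val
  exact hc.integral_pos_of_hasCompactSupport_nonneg_nonzero hcs (fun y => hf y)
    (x := ⟨u, u, hu⟩) hfu

/-- An approximate tangent plane, with positive multiplicity, of a measure carried by a submanifold
lies in the tangent space: the blow-ups of the submanifold leave every compact set off the tangent
cone. -/
theorem IsEmbeddedSubmanifold.approxTangentPlane_le {M : Set (E L)}
    (hM : IsEmbeddedSubmanifold m M) {ν : Measure (E L)} (hν : ∀ᵐ y ∂ν, y ∈ M) {x : E L}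
    (hx : x ∈ M) {θ : ℝ} (hθ : 0 < θ) {S : Grassmannian L k}
    (h : IsApproxTangentPlane ν x θ S) (v : E L) : S.1 v ∈ tangentSpace M x := by
  by_contra hv
  set u := S.1 v with hu
  obtain ⟨ε, hε, hball⟩ := Metric.isOpen_iff.1
    (tangentSpace M x).closed_of_finiteDimensional.isOpen_compl u hv
  let f : C_c(E L, ℝ) :=
    { toFun := fun y => max 0 (ε / 2 - dist y u)
      continuous_toFun := by fun_prop
      hasCompactSupport' := HasCompactSupport.intro (isCompact_closedBall u (ε / 2)) fun y hy => by
        rw [Metric.mem_closedBall, not_le] at hy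
        exact max_eq_left (by linarith) }
  have hf : ∀ y, f y = max 0 (ε / 2 - dist y u) := fun y => rfl
  have hf0 : ∀ y, f y ≠ 0 → y ∈ Metric.closedBall u (ε / 2) := by
    intro y hy
    by_contra hn
    rw [Metric.mem_closedBall, not_le] at hn
    exact hy (max_eq_left (by linarith))
  have hev : ∀ᶠ l : ℝ in 𝓝[>] 0, ∀ y ∈ M, f (l⁻¹ • (y - x)) = 0 := by
    by_contra hne
    obtain ⟨l, hl, hl'⟩ := Filter.exists_seq_forall_of_frequently (Filter.not_eventually.1 hne)
    push Not at hl'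
    choose y hyM hy using hl'
    obtain ⟨w, hw, φ, hφ, hlim⟩ := (isCompact_closedBall u (ε / 2)).tendsto_subseq
      fun i => hf0 _ (hy i)
    have hl0 : Tendsto l atTop (𝓝 0) := hl.mono_right nhdsWithin_le_nhds
    have hlpos : ∀ᶠ i in atTop, 0 < l i := hl.eventually self_mem_nhdsWithin
    have hwT : w ∈ tangentConeAt ℝ M x := by
      refine mem_tangentConeAt_of_seq atTop (fun i => (l (φ i))⁻¹) (fun i => y (φ i) - x) ?_
        (Eventually.of_forall fun i => by simpa using hyM (φ i)) hlim
      have h1 := (hl0.comp hφ.tendsto_atTop).smul hlim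
      rw [zero_smul] at h1
      refine h1.congr' ?_
      filter_upwards [hφ.tendsto_atTop.eventually hlpos] with i hi
      exact smul_inv_smul₀ hi.ne' _
    rw [hM.tangentConeAt_eq hx] at hwT
    refine hball ?_ hwT
    rw [Metric.mem_ball]
    rw [Metric.mem_closedBall] at hw
    linarith
  have hlim := h f
  have hzero : Tendsto (fun l : ℝ => (l ^ k)⁻¹ * ∫ y, f (l⁻¹ • (y - x)) ∂ν) (𝓝[>] 0) (𝓝 0) := by
    refine tendsto_const_nhds.congr' ?_
    filter_upwards [hev] with l hl
    rw [integral_eq_zero_of_ae (by filter_upwards [hν] with y hy using hl y hy), mul_zero]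
  have h0 := tendsto_nhds_unique hlim hzero
  have hpos := setIntegral_plane_pos S f (fun y => le_max_left _ _) (u := u) (S.apply_apply v)
    (by rw [hf, dist_self, sub_zero]; exact (lt_max_of_lt_right (by linarith)).ne')
  exact (mul_pos hθ hpos).ne' h0

theorem Varifold.ae_mem_of_support_subset {V : Varifold L k} {M : Set (E L)}
    (h : V.weight.support ⊆ M) : ∀ᵐ z ∂V.toMeasure, z.1 ∈ M := by
  have h1 : ∀ᵐ x ∂V.weight, x ∈ M := mem_of_superset Measure.support_mem_ae h
  exact ae_of_ae_map measurable_fst.aemeasurable h1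

/-- A varifold in `𝒱_k(M)` is carried by pairs `(x, S)` with `x ∈ M` and `S ⊆ T_x M`. For
rectifiable varifolds these are the approximate tangent planes; the condition `S ⊆ T_x M` is given locally by
the vanishing of a continuous nonnegative function, so it passes to weak limits. -/
theorem IsEmbeddedSubmanifold.ae_tangent_of_mem_varifoldsIn {M : Set (E L)}
    (hM : IsEmbeddedSubmanifold m M) {V : Varifold L k} (hV : V ∈ varifoldsIn k M) :
    ∀ᵐ z ∂V.toMeasure, z.1 ∈ M ∧ ∀ v, z.2.1 v ∈ tangentSpace M z.1 := by
  have hVM := Varifold.ae_mem_of_support_subset hV.2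
  have hnull : V.toMeasure {z | z.1 ∈ M ∧ ¬ ∀ v, z.2.1 v ∈ tangentSpace M z.1} = 0 := by
    refine measure_null_of_locally_null _ fun z₀ hz₀ => ?_
    obtain ⟨U, T, hU, hxU, hT, -, hTM, -⟩ := hM.exists_local_tangentProj hz₀.1
    obtain ⟨χ, hχ, hχc, hχU, hχ1⟩ := exists_smooth_cutoff (isCompact_singleton (x := z₀.1)) hU
      (singleton_subset_iff.2 hxU)
    have hcs : HasCompactSupport fun z : E L × Grassmannian L k =>
        |χ z.1| * ‖(1 - T z.1) ∘L z.2.1‖ := by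
      refine HasCompactSupport.intro ((hχc : IsCompact (tsupport χ)).prod
        (isCompact_univ (X := Grassmannian L k))) fun z hz => ?_
      rw [image_eq_zero_of_notMem_tsupport fun h => hz ⟨h, trivial⟩, abs_zero, zero_mul]
    have hcont : Continuous fun z : E L × Grassmannian L k =>
        |χ z.1| * ‖(1 - T z.1) ∘L z.2.1‖ := by
      rw [continuous_iff_continuousAt]
      intro z
      by_cases hz : z.1 ∈ U
      · have h1 : ContinuousAt T z.1 := (hT.continuousOn.continuousAt (hU.mem_nhds hz))
        have h2 : ContinuousAt (fun z : E L × Grassmannian L k => T z.1) z :=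
          ContinuousAt.comp (g := T) h1 continuousAt_fst
        have h3 : ContinuousAt (fun z : E L × Grassmannian L k => z.2.1) z :=
          (continuous_subtype_val.comp continuous_snd).continuousAt
        have h4 : ContinuousAt (fun z : E L × Grassmannian L k => χ z.1) z :=
          (hχ.continuous.comp continuous_fst).continuousAt
        exact h4.abs.mul ((continuousAt_const.sub h2).clm_comp h3).norm
      · have hz' : z.1 ∉ tsupport χ := fun h => hz (hχU h)
        refine (continuousAt_const (y := (0 : ℝ))).congr ?_
        filter_upwards [((isClosed_tsupport χ).isOpen_compl.preimage continuous_fst).mem_nhds hz']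
          with y hy
        rw [image_eq_zero_of_notMem_tsupport hy, abs_zero, zero_mul]
    let f : C_c(E L × Grassmannian L k, ℝ) := ⟨⟨_, hcont⟩, hcs⟩
    have hf : ∀ z, f z = |χ z.1| * ‖(1 - T z.1) ∘L z.2.1‖ := fun z => rfl
    -- `f` vanishes exactly at the pairs with `χ(x) = 0` or `S ⊆ T_x M`
    have hf0 : ∀ z : E L × Grassmannian L k, z.1 ∈ M → (∀ v, z.2.1 v ∈ tangentSpace M z.1) →
        f z = 0 := by
      intro z hzM hz
      rw [hf]
      by_cases hzU : z.1 ∈ tsupport χ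
      · have : (1 - T z.1) ∘L z.2.1 = 0 := by
          ext1 v
          have h1 := tangentProj_eq_self_iff.2 (hz v)
          rw [← hTM _ ⟨hχU hzU, hzM⟩] at h1
          simp [h1]
        rw [this, norm_zero, mul_zero]
      · rw [image_eq_zero_of_notMem_tsupport hzU, abs_zero, zero_mul]
    have hrect : ∀ W : Varifold L k, W.IsRectifiable → W.weight.support ⊆ M →
        ∫ z, f z ∂W.toMeasure = 0 := by
      rintro W ⟨R, θ, τ, hR, hθ, hτ, hpos, -, htan, hW⟩ hWM
      set ν := ((μH[(k : ℝ)] : Measure (E L)).restrict R).withDensity (fun y => (θ y : ℝ≥0∞))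
        with hν
      have hmeas : Measurable fun x => (x, τ x) := measurable_id.prodMk hτ
      have hνM : ∀ᵐ x ∂ν, x ∈ M := by
        have h1 := Varifold.ae_mem_of_support_subset hWM
        rw [hW] at h1
        exact ae_of_ae_map hmeas.aemeasurable h1
      have hac : ν ≪ (μH[(k : ℝ)] : Measure (E L)).restrict R :=
        withDensity_absolutelyContinuous _ _
      rw [hW, integral_map hmeas.aemeasurable (f := fun z => f z)
        f.continuous.aestronglyMeasurable]
      refine integral_eq_zero_of_ae ?_
      filter_upwards [hνM, hac.ae_le htan, hac.ae_le (ae_restrict_mem hR)] with x hxM hxt hxR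
      exact hf0 (x, τ x) hxM fun v =>
        hM.approxTangentPlane_le hνM hxM (θ := θ x) (by exact_mod_cast hpos x hxR) hxt v
    have hVf : ∫ z, f z ∂V.toMeasure = 0 := by
      have hc : Continuous fun W : Varifold L k => ∫ z, f z ∂W.toMeasure :=
        (continuous_apply (A := fun _ : C_c(E L × Grassmannian L k, ℝ) => ℝ) f).comp
          (continuous_induced_dom (f := fun (W : Varifold L k)
            (f : C_c(E L × Grassmannian L k, ℝ)) => ∫ z, f z ∂W.toMeasure))
      exact closure_minimal (fun W hW => hrect W hW.1 hW.2)
        (isClosed_eq hc continuous_const) hV.1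
    have := V.finiteOnCompacts
    have hfi : Integrable f V.toMeasure := f.continuous.integrable_of_hasCompactSupport
      f.hasCompactSupport
    have hae := (integral_eq_zero_iff_of_nonneg
      (fun z => mul_nonneg (abs_nonneg _) (norm_nonneg _)) hfi).1 hVf
    obtain ⟨O, hO, hOo, hxO⟩ := eventually_nhds_iff.1
      ((hχ1 z₀.1 rfl).and (hU.mem_nhds hxU))
    refine ⟨{z | z.1 ∈ M ∧ ¬ ∀ v, z.2.1 v ∈ tangentSpace M z.1} ∩ Prod.fst ⁻¹' O,
      inter_mem_nhdsWithin _ ((hOo.preimage continuous_fst).mem_nhds hxO), ?_⟩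
    refine measure_mono_null (fun z hz => ?_) hae
    obtain ⟨⟨hzM, hz⟩, hzO⟩ := hz
    intro h0
    apply hz
    intro v
    have h1 : χ z.1 = 1 := (hO _ hzO).1
    have h2 : |χ z.1| * ‖(1 - T z.1) ∘L z.2.1‖ = 0 := h0
    rw [h1, abs_one, one_mul, norm_eq_zero] at h2
    have h3 : z.2.1 v - T z.1 (z.2.1 v) = 0 := DFunLike.congr_fun h2 v
    rw [hTM _ ⟨(hO _ hzO).2, hzM⟩, sub_eq_zero] at h3
    exact tangentProj_eq_self_iff.1 h3.symm
  have hn : ∀ᵐ z ∂V.toMeasure, ¬ (z.1 ∈ M ∧ ¬ ∀ v, z.2.1 v ∈ tangentSpace M z.1) :=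
    measure_eq_zero_iff_ae_notMem.1 hnull
  filter_upwards [hVM, hn] with z h1 h2
  exact ⟨h1, by_contra fun h3 => h2 ⟨h1, h3⟩⟩

end

/-! ### The chord estimate and nearest points -/

section

variable {L k m n : ℕ}

theorem normalProj_apply (N : Set (E L)) (x v : E L) :
    normalProj N x v = v - tangentProj N x v := by
  rw [normalProj, tangentProj, Submodule.starProjection_orthogonal']
  rfl

theorem norm_normalProj_le (N : Set (E L)) (x v : E L) : ‖normalProj N x v‖ ≤ ‖v‖ :=
  Submodule.norm_starProjection_apply_le _ _

theorem normalProj_eq_zero {N : Set (E L)} {x v : E L} (hv : v ∈ tangentSpace N x) :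
    normalProj N x v = 0 := by
  rw [normalProj_apply, tangentProj_eq_self_iff.2 hv, sub_self]

/-- Nearby chords of a submanifold are tangential up to second order, by Taylor's formula in a
chart. -/
theorem IsEmbeddedSubmanifold.exists_local_chord_bound {N : Set (E L)}
    (hN : IsEmbeddedSubmanifold n N) {p : E L} (hp : p ∈ N) :
    ∃ C : ℝ, 0 ≤ C ∧ ∃ O ∈ 𝓝 p, ∀ x ∈ O ∩ N, ∀ y ∈ O ∩ N,
      ‖normalProj N x (y - x)‖ ≤ C * ‖y - x‖ ^ 2 := by
  obtain ⟨Φ, P, hpΦ, h⟩ := hN.exists_straightens hp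
  have hps := Φ.map_source hpΦ
  have hsymm : ContDiffAt ℝ ∞ Φ.symm (Φ p) :=
    h.contDiffOn_symm.contDiffAt (Φ.open_target.mem_nhds hps)
  have hΦ : ContDiffAt ℝ ∞ Φ p := h.contDiffOn.contDiffAt (Φ.open_source.mem_nhds hpΦ)
  obtain ⟨K₁, s₁, hs₁, hK₁⟩ :=
    ((hsymm.fderiv_right (m := ∞) (by simp)).of_le (by simp)).exists_lipschitzOnWith
  obtain ⟨K₂, s₂, hs₂, hK₂⟩ := (hΦ.of_le (by simp)).exists_lipschitzOnWith
  obtain ⟨ε, hε, hball⟩ := Metric.mem_nhds_iff.1 (inter_mem hs₁ (Φ.open_target.mem_nhds hps))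
  refine ⟨K₁ * K₂ ^ 2, by positivity, Φ.source ∩ s₂ ∩ Φ ⁻¹' Metric.ball (Φ p) ε,
    inter_mem (inter_mem (Φ.open_source.mem_nhds hpΦ) hs₂)
      ((Φ.continuousAt hpΦ).preimage_mem_nhds (Metric.ball_mem_nhds _ hε)), ?_⟩
  rintro x ⟨⟨⟨hx, hx2⟩, hxb⟩, hxN⟩ y ⟨⟨⟨hy, hy2⟩, hyb⟩, hyN⟩
  have hseg : segment ℝ (Φ x) (Φ y) ⊆ Metric.ball (Φ p) ε :=
    (convex_ball _ _).segment_subset hxb hyb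
  have htaylor : ‖Φ.symm (Φ y) - Φ.symm (Φ x) - fderiv ℝ Φ.symm (Φ x) (Φ y - Φ x)‖ ≤
      K₁ * ‖Φ y - Φ x‖ * ‖Φ y - Φ x‖ := by
    refine (convex_segment (Φ x) (Φ y)).norm_image_sub_le_of_norm_hasFDerivWithin_le'
      (f' := fderiv ℝ Φ.symm) (fun w hw =>
        (h.hasFDerivAt_symm (hball (hseg hw)).2).hasFDerivWithinAt) (fun w hw => ?_)
      (left_mem_segment ℝ _ _) (right_mem_segment ℝ _ _)
    rw [← dist_eq_norm]
    refine (hK₁.dist_le_mul _ (hball (hseg hw)).1 _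
      (hball (hseg (left_mem_segment ℝ _ _))).1).trans ?_
    gcongr
    rw [dist_eq_norm]
    simpa [norm_sub_rev] using norm_sub_le_of_mem_segment hw
  rw [Φ.left_inv hx, Φ.left_inv hy] at htaylor
  have htan : fderiv ℝ Φ.symm (Φ x) (Φ y - Φ x) ∈ tangentSpace N x := by
    rw [h.tangentSpace_eq hx hxN]
    exact ⟨_, P.sub_mem ((h.mem_iff y hy).1 hyN) ((h.mem_iff x hx).1 hxN), rfl⟩
  have hlip : ‖Φ y - Φ x‖ ≤ K₂ * ‖y - x‖ := by
    simpa [dist_eq_norm] using hK₂.dist_le_mul _ hy2 _ hx2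
  calc ‖normalProj N x (y - x)‖
      = ‖normalProj N x (y - x - fderiv ℝ Φ.symm (Φ x) (Φ y - Φ x))‖ := by
        rw [map_sub (normalProj N x) (y - x), normalProj_eq_zero htan, sub_zero]
    _ ≤ K₁ * ‖Φ y - Φ x‖ * ‖Φ y - Φ x‖ := (norm_normalProj_le _ _ _).trans htaylor
    _ ≤ K₁ * (K₂ * ‖y - x‖) * (K₂ * ‖y - x‖) := by gcongr
    _ = _ := by ring

/-- A compact submanifold satisfies a global quadratic chord estimate. -/
theorem IsEmbeddedSubmanifold.exists_chord_bound {N : Set (E L)}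
    (hN : IsEmbeddedSubmanifold n N) (hc : IsCompact N) :
    ∃ C : ℝ, 0 ≤ C ∧ ∀ x ∈ N, ∀ y ∈ N, ‖normalProj N x (y - x)‖ ≤ C * ‖y - x‖ ^ 2 := by
  have := (hc.prod hc).induction_on
    (p := fun s => ∃ C : ℝ, 0 ≤ C ∧ ∀ z ∈ s, z.1 ∈ N → z.2 ∈ N →
      ‖normalProj N z.1 (z.2 - z.1)‖ ≤ C * ‖z.2 - z.1‖ ^ 2) ⟨0, le_rfl, by simp⟩
    (fun s t hst ⟨C, hC, h⟩ => ⟨C, hC, fun z hz => h z (hst hz)⟩) ?_ ?_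
  · obtain ⟨C, hC, h⟩ := this
    exact ⟨C, hC, fun x hx y hy => h (x, y) ⟨hx, hy⟩ hx hy⟩
  · rintro s t ⟨C, hC, h⟩ ⟨C', hC', h'⟩
    refine ⟨max C C', le_max_of_le_left hC, fun z hz h1 h2 => ?_⟩
    rcases hz with hz | hz
    · exact (h z hz h1 h2).trans (by gcongr; exact le_max_left _ _)
    · exact (h' z hz h1 h2).trans (by gcongr; exact le_max_right _ _)
  · rintro ⟨x, y⟩ ⟨hx, hy⟩
    by_cases hxy : x = y
    · subst hxy
      obtain ⟨C, hC, O, hO, h⟩ := hN.exists_local_chord_bound hx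
      exact ⟨O ×ˢ O, mem_nhdsWithin_of_mem_nhds (prod_mem_nhds hO hO), C, hC,
        fun z hz h1 h2 => h z.1 ⟨hz.1, h1⟩ z.2 ⟨hz.2, h2⟩⟩
    · have hd : 0 < ‖y - x‖ := norm_pos_iff.2 (sub_ne_zero.2 (Ne.symm hxy))
      have hcont : Continuous fun z : E L × E L => ‖z.2 - z.1‖ := by fun_prop
      refine ⟨{z | ‖y - x‖ / 2 < ‖z.2 - z.1‖}, mem_nhdsWithin_of_mem_nhds
        ((isOpen_lt continuous_const hcont).mem_nhds (by
          change ‖y - x‖ / 2 < ‖y - x‖; linarith)), 2 / ‖y - x‖, by positivity,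
        fun z hz _ _ => (norm_normalProj_le _ _ _).trans ?_⟩
      have hz' : ‖y - x‖ / 2 < ‖z.2 - z.1‖ := hz
      rw [div_mul_eq_mul_div, le_div_iff₀ hd]
      nlinarith

/-- The infimum defining `κ` is attained. -/
theorem IsEmbeddedSubmanifold.norm_normalProj_sub_le {N : Set (E L)}
    (hN : IsEmbeddedSubmanifold n N) (hc : IsCompact N) :
    0 ≤ kappa N ∧ ∀ x ∈ N, ∀ y ∈ N,
      ‖normalProj N x (y - x)‖ ≤ kappa N / 2 * ‖y - x‖ ^ 2 := by
  obtain ⟨C, hC, h⟩ := hN.exists_chord_bound hc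
  set A := {t : ℝ | 0 ≤ t ∧ ∀ x ∈ N, ∀ y ∈ N,
    ‖normalProj N x (y - x)‖ ≤ t / 2 * ‖y - x‖ ^ 2} with hA
  have hne : A.Nonempty := ⟨2 * C, by positivity, fun x hx y hy => by
    simpa using h x hx y hy⟩
  have hcl : IsClosed A := by
    have : A = Ici 0 ∩ ⋂ x ∈ N, ⋂ y ∈ N,
        {t : ℝ | ‖normalProj N x (y - x)‖ ≤ t / 2 * ‖y - x‖ ^ 2} := by
      ext t; simp [hA]
    rw [this]
    refine isClosed_Ici.inter (isClosed_biInter fun x _ => isClosed_biInter fun y _ => ?_)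
    exact isClosed_le continuous_const (by fun_prop)
  exact hcl.csInf_mem hne ⟨0, fun t ht => ht.1⟩

open Classical in
/-- The nearest point projection `ξ` onto `N`. It is determined by `N` at points at distance less
than `1/κ`; elsewhere some nearest point is chosen. -/
noncomputable def nearestPoint (N : Set (E L)) (x : E L) : E L :=
  Classical.epsilon fun y => y ∈ N ∧ Metric.infDist x N = dist x y

section Nearest

variable {N : Set (E L)}

theorem nearestPoint_spec (hc : IsCompact N) (hne : N.Nonempty) (x : E L) :
    nearestPoint N x ∈ N ∧ Metric.infDist x N = dist x (nearestPoint N x) :=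
  Classical.epsilon_spec (p := fun y => y ∈ N ∧ Metric.infDist x N = dist x y)
    (hc.exists_infDist_eq_dist hne x)

theorem nearestPoint_eq_self (hc : IsCompact N) {x : E L} (hx : x ∈ N) : nearestPoint N x = x := by
  have := (nearestPoint_spec hc ⟨x, hx⟩ x).2
  rw [Metric.infDist_zero_of_mem hx] at this
  exact (dist_eq_zero.1 this.symm).symm

theorem norm_sub_nearestPoint_le (hc : IsCompact N) {y : E L} (hy : y ∈ N) (x : E L) :
    ‖x - nearestPoint N x‖ ≤ ‖x - y‖ := by
  have := (nearestPoint_spec hc ⟨y, hy⟩ x).2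
  rw [← dist_eq_norm, ← dist_eq_norm, ← this]
  exact Metric.infDist_le_dist_of_mem hy

/-- A point of `N` at minimal distance from `x` is the foot of a normal through `x`. -/
theorem IsEmbeddedSubmanifold.inner_sub_nearestPoint_eq_zero (hN : IsEmbeddedSubmanifold n N)
    (hc : IsCompact N) (hne : N.Nonempty) (x : E L) {v : E L}
    (hv : v ∈ tangentSpace N (nearestPoint N x)) : inner ℝ (x - nearestPoint N x) v = 0 := by
  set y := nearestPoint N x with hy
  have hyN : y ∈ N := (nearestPoint_spec hc hne x).1
  obtain ⟨Φ, P, hyΦ, h⟩ := hN.exists_straightens hyN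
  rw [h.tangentSpace_eq hyΦ hyN] at hv
  obtain ⟨u, hu, rfl⟩ := hv
  have hPy : Φ y ∈ P := (h.mem_iff y hyΦ).1 hyN
  have hline : HasDerivAt (fun t : ℝ => Φ y + t • u) u 0 := by
    simpa using ((hasDerivAt_id (0 : ℝ)).smul_const u).const_add (Φ y)
  have hcurve : HasDerivAt (fun t : ℝ => Φ.symm (Φ y + t • u)) (fderiv ℝ Φ.symm (Φ y) u) 0 :=
    HasFDerivAt.comp_hasDerivAt_of_eq (x := (0 : ℝ)) (h.hasFDerivAt_symm (Φ.map_source hyΦ)) hline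
      (by simp)
  have hg := (hcurve.const_sub x).norm_sq
  have hmin : IsLocalMin (fun t : ℝ => ‖x - Φ.symm (Φ y + t • u)‖ ^ 2) 0 := by
    have hev : ∀ᶠ t : ℝ in 𝓝 0, Φ y + t • u ∈ Φ.target := by
      refine hline.continuousAt.eventually_mem (Φ.open_target.mem_nhds ?_)
      simpa using Φ.map_source hyΦ
    filter_upwards [hev] with t ht
    simp only [zero_smul, add_zero, Φ.left_inv hyΦ]
    gcongr
    refine norm_sub_nearestPoint_le hc ?_ x
    refine (h.mem_iff _ (Φ.map_target ht)).2 ?_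
    rw [Φ.right_inv ht]
    exact P.add_mem hPy (P.smul_mem _ hu)
  have := hmin.hasDerivAt_eq_zero hg
  simp only [zero_smul, add_zero, Φ.left_inv hyΦ, inner_neg_right] at this
  have h2 : inner ℝ (x - y) (fderiv ℝ Φ.symm (Φ y) u) = 0 := by linarith
  exact h2

theorem IsEmbeddedSubmanifold.inner_normal_chord_le (hN : IsEmbeddedSubmanifold n N)
    (hc : IsCompact N) {x y : E L} (hx : x ∈ N) (hy : y ∈ N) {w : E L}
    (hw : ∀ v ∈ tangentSpace N x, inner ℝ w v = 0) :
    inner ℝ w (y - x) ≤ ‖w‖ * (kappa N / 2 * ‖y - x‖ ^ 2) := by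
  have h1 : inner ℝ w (y - x) = inner ℝ w (normalProj N x (y - x)) := by
    rw [normalProj_apply, inner_sub_right w (y - x), hw _ (tangentProj_mem _ _ _), sub_zero]
  rw [h1]
  exact (real_inner_le_norm _ _).trans (by
    gcongr; exact (hN.norm_normalProj_sub_le hc).2 x hx y hy)

/-- Below the radius of curvature the nearest point is unique, quantitatively. -/
theorem IsEmbeddedSubmanifold.norm_sub_sq_ge (hN : IsEmbeddedSubmanifold n N)
    (hc : IsCompact N) {y : E L} (hy : y ∈ N) (x : E L) :
    ‖x - nearestPoint N x‖ ^ 2 + (1 - kappa N * Metric.infDist x N) * ‖y - nearestPoint N x‖ ^ 2 ≤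
      ‖x - y‖ ^ 2 := by
  obtain ⟨h1, h2⟩ := nearestPoint_spec hc ⟨y, hy⟩ x
  rw [dist_eq_norm] at h2
  have h3 := hN.inner_normal_chord_le hc h1 hy
    (fun v hv => hN.inner_sub_nearestPoint_eq_zero hc ⟨y, hy⟩ x hv)
  have h4 : ‖x - y‖ ^ 2 = ‖x - nearestPoint N x‖ ^ 2 -
      2 * inner ℝ (x - nearestPoint N x) (y - nearestPoint N x) + ‖y - nearestPoint N x‖ ^ 2 := by
    rw [← norm_sub_sq_real]
    congr 2
    abel
  rw [h2]
  nlinarith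

/-- The nearest point projection is monotone and Lipschitz below the radius of curvature. -/
theorem IsEmbeddedSubmanifold.nearestPoint_monotone (hN : IsEmbeddedSubmanifold n N)
    (hc : IsCompact N) (hne : N.Nonempty) (x₁ x₂ : E L) :
    (1 - kappa N * (Metric.infDist x₁ N + Metric.infDist x₂ N) / 2) *
      ‖nearestPoint N x₁ - nearestPoint N x₂‖ ^ 2 ≤
      inner ℝ (x₁ - x₂) (nearestPoint N x₁ - nearestPoint N x₂) := by
  obtain ⟨h1, h1'⟩ := nearestPoint_spec hc hne x₁
  obtain ⟨h2, h2'⟩ := nearestPoint_spec hc hne x₂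
  rw [dist_eq_norm] at h1' h2'
  have h3 := hN.inner_normal_chord_le hc h1 h2
    (fun v hv => hN.inner_sub_nearestPoint_eq_zero hc hne x₁ hv)
  have h4 := hN.inner_normal_chord_le hc h2 h1
    (fun v hv => hN.inner_sub_nearestPoint_eq_zero hc hne x₂ hv)
  rw [← h1'] at h3
  rw [← h2'] at h4
  set a := nearestPoint N x₁
  set b := nearestPoint N x₂
  have h5 : inner ℝ (x₁ - x₂) (a - b) =
      ‖a - b‖ ^ 2 - inner ℝ (x₁ - a) (b - a) - inner ℝ (x₂ - b) (a - b) := by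
    rw [← real_inner_self_eq_norm_sq, ← neg_sub a b, inner_neg_right, sub_neg_eq_add,
      ← inner_add_left, ← inner_sub_left]
    congr 1
    abel
  rw [norm_sub_rev b a] at h3
  rw [h5]
  nlinarith

end Nearest

end

/-! ### Smoothness of the nearest point projection -/

section

variable {L k m n : ℕ} {N : Set (E L)}

theorem continuousAt_nearestPoint (hN : IsEmbeddedSubmanifold n N)
    (hc : IsCompact N) (hne : N.Nonempty) {x : E L} (hx : kappa N * Metric.infDist x N < 1) :
    ContinuousAt (nearestPoint N) x := by
  have hcont : Continuous fun y => kappa N * Metric.infDist y N :=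
    continuous_const.mul (Metric.continuous_infDist_pt N)
  set θ := (1 + kappa N * Metric.infDist x N) / 2 with hθ
  have hev : ∀ᶠ y in 𝓝 x, kappa N * Metric.infDist y N < θ :=
    (hcont.tendsto x).eventually_lt_const (by rw [hθ]; linarith)
  rw [ContinuousAt, tendsto_iff_norm_sub_tendsto_zero]
  have h0 : Tendsto (fun y : E L => (1 - θ)⁻¹ * ‖y - x‖) (𝓝 x) (𝓝 0) := by
    have : Continuous fun y : E L => (1 - θ)⁻¹ * ‖y - x‖ := by fun_prop
    simpa using this.tendsto x
  refine squeeze_zero' (Eventually.of_forall fun _ => norm_nonneg _) ?_ h0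
  filter_upwards [hev] with y hy
  have h1 := hN.nearestPoint_monotone hc hne y x
  have h2 := real_inner_le_norm (y - x) (nearestPoint N y - nearestPoint N x)
  have hθ1 : 0 < 1 - θ := by rw [hθ]; linarith
  rw [inv_mul_eq_div, le_div_iff₀ hθ1]
  set a := ‖nearestPoint N y - nearestPoint N x‖
  have ha : 0 ≤ a := norm_nonneg _
  have h3 : (1 - θ) * a ^ 2 ≤ ‖y - x‖ * a := by
    refine le_trans ?_ (h1.trans h2)
    gcongr
    linarith
  rcases ha.eq_or_lt with h | h
  · rw [← h, zero_mul]; exact norm_nonneg _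
  · nlinarith

/-- If `g` has a local quadratic lower bound at `0` along a curve `c` with velocity `v`, and the
first two derivatives of `g` vanish there, then `v = 0`. -/
theorem eq_zero_of_sq_growth {g g' : ℝ → ℝ} {c : ℝ → E L} {v : E L} {a : ℝ} (ha : 0 < a)
    (hg : ∀ᶠ t in 𝓝 0, HasDerivAt g (g' t) t) (hg0 : g' 0 = 0) (hg' : HasDerivAt g' 0 0)
    (hc : HasDerivAt c v 0) (hgrow : ∀ᶠ t in 𝓝 0, g 0 + a * ‖c t - c 0‖ ^ 2 ≤ g t) : v = 0 := by
  have hdiv : Tendsto (fun t => g' t / (2 * t)) (𝓝[≠] 0) (𝓝 0) := by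
    have h1 := hg'.tendsto_slope
    have h2 : Tendsto (fun t => 2⁻¹ * slope g' 0 t) (𝓝[≠] 0) (𝓝 (2⁻¹ * 0)) := h1.const_mul _
    rw [mul_zero] at h2
    refine h2.congr fun t => ?_
    rw [slope_def_field, hg0]
    rcases eq_or_ne t 0 with rfl | ht
    · simp
    · field_simp
      ring
  have hlim : Tendsto (fun t => (g t - g 0) / t ^ 2) (𝓝[≠] 0) (𝓝 0) := by
    refine HasDerivAt.lhopital_zero_nhdsNE (f' := g') (g' := fun t => 2 * t) ?_ ?_ ?_ ?_ ?_ hdiv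
    · filter_upwards [hg.filter_mono nhdsWithin_le_nhds] with t ht using ht.sub_const _
    · exact Eventually.of_forall fun t => by simpa using hasDerivAt_pow 2 t
    · filter_upwards [self_mem_nhdsWithin] with t ht
      exact mul_ne_zero two_ne_zero ht
    · have : Tendsto g (𝓝 0) (𝓝 (g 0)) := hg.self_of_nhds.continuousAt
      simpa using (this.mono_left nhdsWithin_le_nhds).sub_const (g 0)
    · have : Tendsto (fun t : ℝ => t ^ 2) (𝓝 0) (𝓝 (0 ^ 2)) := (continuous_pow 2).tendsto 0
      simpa using this.mono_left nhdsWithin_le_nhds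
  have hsl := hc.tendsto_slope
  have hsl2 : Tendsto (fun t => a * ‖slope c 0 t‖ ^ 2) (𝓝[≠] 0) (𝓝 (a * ‖v‖ ^ 2)) :=
    (hsl.norm.pow 2).const_mul a
  have hle : a * ‖v‖ ^ 2 ≤ 0 := by
    refine le_of_tendsto_of_tendsto hsl2 hlim ?_
    filter_upwards [hgrow.filter_mono nhdsWithin_le_nhds, self_mem_nhdsWithin] with t ht ht0
    have ht0' : t ≠ 0 := ht0
    have htp : 0 < t ^ 2 := by positivity
    rw [le_div_iff₀ htp, slope_def_module, sub_zero, norm_smul, mul_pow, norm_inv, inv_pow,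
      Real.norm_eq_abs, sq_abs, mul_assoc, mul_comm _ (t ^ 2), mul_inv_cancel_left₀ htp.ne']
    linarith
  have : ‖v‖ ^ 2 ≤ 0 := by nlinarith [sq_nonneg ‖v‖]
  exact norm_eq_zero.1 (pow_eq_zero_iff two_ne_zero |>.1 (le_antisymm this (sq_nonneg _)))

/-- The nearest point projection is smooth at distance less than `1/κ` from `N`: in a chart `ψ` of
`N` the nearest point is the solution of `∂_w |x - ψ(w)|² = 0`, and the implicit function theorem
applies because `|x - ψ(w)|²` grows quadratically at its minimum. -/
theorem contDiffAt_nearestPoint (hN : IsEmbeddedSubmanifold n N)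
    (hc : IsCompact N) (hne : N.Nonempty) {x₀ : E L} (hx : kappa N * Metric.infDist x₀ N < 1) :
    ContDiffAt ℝ ∞ (nearestPoint N) x₀ := by
  set y₀ := nearestPoint N x₀ with hy₀
  have hyN : y₀ ∈ N := (nearestPoint_spec hc hne x₀).1
  obtain ⟨Φ, P, hyΦ, h⟩ := hN.exists_straightens hyN
  have hPy : Φ y₀ ∈ P := (h.mem_iff y₀ hyΦ).1 hyN
  have hts := Φ.map_source hyΦ
  set w₀ := Φ y₀ with hw₀
  have hψw : Φ.symm w₀ = y₀ := Φ.left_inv hyΦ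
  have hψ : ContDiffAt ℝ ∞ Φ.symm w₀ := h.contDiffOn_symm.contDiffAt (Φ.open_target.mem_nhds hts)
  have hψ' : ContDiffAt ℝ ∞ (fderiv ℝ Φ.symm) w₀ := hψ.fderiv_right (by simp)
  obtain ⟨π, hπ⟩ : ∃ π, π = P.starProjection := ⟨_, rfl⟩
  have hπP : ∀ u, π u ∈ P := fun u => by rw [hπ]; exact Submodule.starProjection_apply_mem _ _
  have hπ1 : ∀ u ∈ P, π u = u := fun u hu => by
    rw [hπ]; exact Submodule.starProjection_eq_self_iff.2 hu
  have hπi : ∀ u v, v ∈ P → inner ℝ (u - π u) v = 0 := fun u v hv => by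
    rw [hπ]; exact Submodule.starProjection_inner_eq_zero _ _ hv
  -- the equation for the nearest point in the chart, made nondegenerate transversally to `P`
  obtain ⟨F, hF⟩ : ∃ F : E L × E L → E L, F = fun z =>
      π (ContinuousLinearMap.adjoint (fderiv ℝ Φ.symm z.2) (Φ.symm z.2 - z.1)) +
        (z.2 - π z.2) := ⟨_, rfl⟩
  have hFs : ContDiffAt ℝ ∞ F (x₀, w₀) := by
    have h1 : ContDiffAt ℝ ∞ (fun z : E L × E L => Φ.symm z.2) (x₀, w₀) :=
      ContDiffAt.comp (x₀, w₀) (g := Φ.symm) hψ contDiffAt_snd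
    have h2 : ContDiffAt ℝ ∞ (fun z : E L × E L =>
        ContinuousLinearMap.adjoint (fderiv ℝ Φ.symm z.2)) (x₀, w₀) :=
      isBoundedLinearMap_adjoint.contDiff.contDiffAt.comp (x₀, w₀)
        (ContDiffAt.comp (x₀, w₀) (g := fderiv ℝ Φ.symm) hψ' contDiffAt_snd)
    rw [hF]
    exact (π.contDiff.contDiffAt.comp (x₀, w₀) (h2.clm_apply (h1.sub contDiffAt_fst))).add
      (contDiffAt_snd.sub (π.contDiff.contDiffAt.comp (x₀, w₀) contDiffAt_snd))
  have hFi : ∀ x w v, v ∈ P → inner ℝ (F (x, w)) v =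
      inner ℝ (Φ.symm w - x) (fderiv ℝ Φ.symm w v) := by
    intro x w v hv
    have h1 := hπi (ContinuousLinearMap.adjoint (fderiv ℝ Φ.symm w) (Φ.symm w - x)) v hv
    rw [inner_sub_left, sub_eq_zero, ContinuousLinearMap.adjoint_inner_left] at h1
    rw [hF, inner_add_left, hπi w v hv, add_zero, h1]
  have hFzero : ∀ x, nearestPoint N x ∈ Φ.source → F (x, Φ (nearestPoint N x)) = 0 := by
    intro x hxs
    have hxN := (nearestPoint_spec hc hne x).1
    have hxP := (h.mem_iff _ hxs).1 hxN
    have h1 : ∀ v ∈ P, inner ℝ (F (x, Φ (nearestPoint N x))) v = 0 := by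
      intro v hv
      rw [hFi _ _ _ hv, Φ.left_inv hxs, ← neg_sub, inner_neg_left,
        hN.inner_sub_nearestPoint_eq_zero hc hne x, neg_zero]
      rw [h.tangentSpace_eq hxs hxN]
      exact ⟨v, hv, rfl⟩
    have h2 : F (x, Φ (nearestPoint N x)) ∈ P := by
      rw [hF]
      simp only [hπ1 _ hxP, sub_self, add_zero]
      exact hπP _
    exact inner_self_eq_zero.1 (h1 _ h2)
  have hF0 : F (x₀, w₀) = 0 := hFzero x₀ hyΦ
  set A := fderiv ℝ F (x₀, w₀) ∘L ContinuousLinearMap.inr ℝ (E L) (E L) with hA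
  have hFw : HasFDerivAt (fun w => F (x₀, w)) A w₀ :=
    HasFDerivAt.comp (g := F) w₀ (hFs.differentiableAt (by simp)).hasFDerivAt
      (hasFDerivAt_prodMk_right x₀ w₀)
  have hinj : ∀ v, A v = 0 → v = 0 := by
    intro v hv
    -- the transversal part of the kernel vanishes
    have hvP : v ∈ P := by
      have h1 : HasFDerivAt (fun w => F (x₀, w) - π (F (x₀, w))) (A - π ∘L A) w₀ :=
        hFw.sub (π.hasFDerivAt.comp w₀ hFw)
      have h2 : (fun w => F (x₀, w) - π (F (x₀, w))) = fun w => w - π w := by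
        ext1 w
        rw [hF]
        simp only [map_add, map_sub, hπ1 _ (hπP _)]
        abel
      rw [h2] at h1
      have h3 := h1.unique ((hasFDerivAt_id w₀).sub π.hasFDerivAt)
      have h4 := DFunLike.congr_fun h3 v
      simp only [sub_apply, ContinuousLinearMap.comp_apply, hv, map_zero,
        sub_self] at h4
      have h5 : v = π v := sub_eq_zero.1 h4.symm
      rw [h5]; exact hπP _
    -- along `P` it vanishes by the quadratic growth of the squared distance
    have hline : ∀ t : ℝ, HasDerivAt (fun t : ℝ => w₀ + t • v) v t := fun t => by
      simpa using ((hasDerivAt_id t).smul_const v).const_add w₀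
    have hlt : ∀ᶠ t : ℝ in 𝓝 0, w₀ + t • v ∈ Φ.target :=
      (hline 0).continuousAt.eventually_mem (Φ.open_target.mem_nhds (by simpa using hts))
    have hcurve : ∀ t : ℝ, w₀ + t • v ∈ Φ.target →
        HasDerivAt (fun t : ℝ => Φ.symm (w₀ + t • v)) (fderiv ℝ Φ.symm (w₀ + t • v) v) t :=
      fun t ht => (h.hasFDerivAt_symm ht).comp_hasDerivAt t (hline t)
    have hc0 := hcurve 0 (by simpa using hts)
    have hgd : HasDerivAt (fun t : ℝ => inner ℝ (F (x₀, w₀ + t • v)) v) 0 0 := by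
      have h1 : HasDerivAt (fun t : ℝ => F (x₀, w₀ + t • v)) (A v) 0 :=
        HasFDerivAt.comp_hasDerivAt_of_eq (x := (0 : ℝ)) (l := fun w => F (x₀, w)) hFw (hline 0)
          (by simp)
      rw [hv] at h1
      simpa using h1.inner ℝ (hasDerivAt_const (0 : ℝ) v)
    have hz := eq_zero_of_sq_growth
      (a := (1 - kappa N * Metric.infDist x₀ N) / 2) (by linarith)
      (g := fun t => 2⁻¹ * ‖Φ.symm (w₀ + t • v) - x₀‖ ^ 2)
      (g' := fun t => inner ℝ (F (x₀, w₀ + t • v)) v) (c := fun t => Φ.symm (w₀ + t • v))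
      ?_ (by simp [hF0]) hgd hc0 ?_
    · rw [zero_smul, add_zero] at hz
      have h1 := DFunLike.congr_fun (h.fderiv_comp_symm hyΦ) v
      rw [ContinuousLinearMap.comp_apply, hz, map_zero] at h1
      exact h1.symm
    · filter_upwards [hlt] with t ht
      have := (((hcurve t ht).sub_const x₀).norm_sq).const_mul (2⁻¹ : ℝ)
      refine this.congr_deriv ?_
      rw [hFi _ _ _ hvP]
      ring
    · filter_upwards [hlt] with t ht
      have hmem : Φ.symm (w₀ + t • v) ∈ N := by
        refine (h.mem_iff _ (Φ.map_target ht)).2 ?_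
        rw [Φ.right_inv ht]
        exact P.add_mem hPy (P.smul_mem _ hvP)
      have := hN.norm_sub_sq_ge hc hmem x₀
      simp only [zero_smul, add_zero, hψw]
      rw [norm_sub_rev (Φ.symm (w₀ + t • v)) x₀, norm_sub_rev y₀ x₀]
      linarith
  have hinv : A.IsInvertible := by
    have hi : Function.Injective A := (injective_iff_map_eq_zero A).2 hinj
    exact ⟨(LinearEquiv.ofInjectiveEndo (A : E L →ₗ[ℝ] E L) hi).toContinuousLinearEquiv, by
      ext u; rfl⟩
  have himp := hFs.eventually_apply_eq_iff_implicitFunction (by simp) hinv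
  have hsmooth := hFs.contDiffAt_implicitFunction (by simp) hinv
  set η := hFs.implicitFunction (by simp) hinv with hη
  have hη0 : η x₀ = w₀ := hFs.implicitFunction_apply_self (by simp) hinv
  have hξc := continuousAt_nearestPoint hN hc hne hx
  have hΦξ : ContinuousAt (fun x => Φ (nearestPoint N x)) x₀ :=
    ContinuousAt.comp (g := Φ) (Φ.continuousAt hyΦ) hξc
  have hpair : Tendsto (fun x => (x, Φ (nearestPoint N x))) (𝓝 x₀) (𝓝 (x₀, w₀)) :=
    continuousAt_id.prodMk hΦξ
  have hsrc : ∀ᶠ x in 𝓝 x₀, nearestPoint N x ∈ Φ.source :=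
    hξc.eventually_mem (Φ.open_source.mem_nhds hyΦ)
  have heq : nearestPoint N =ᶠ[𝓝 x₀] fun x => Φ.symm (η x) := by
    filter_upwards [hsrc, hpair.eventually himp] with x hxs hxi
    rw [hF0] at hxi
    rw [hxi.1 (hFzero x hxs), Φ.left_inv hxs]
  refine ContDiffAt.congr_of_eventuallyEq ?_ heq
  have h1 : ContDiffAt ℝ ∞ Φ.symm (η x₀) := by rw [hη0]; exact hψ
  exact h1.comp x₀ hsmooth

end

/-! ### Derivatives of the nearest point projection -/

section

variable {L k m n : ℕ} {N : Set (E L)}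

theorem hasDerivAt_nearestPoint_line (hN : IsEmbeddedSubmanifold n N) (hc : IsCompact N)
    (hne : N.Nonempty) {x : E L} (hx : kappa N * Metric.infDist x N < 1) (v : E L) :
    HasDerivAt (fun t : ℝ => nearestPoint N (x + t • v)) (fderiv ℝ (nearestPoint N) x v) 0 := by
  have hline : HasDerivAt (fun t : ℝ => x + t • v) v 0 := by
    simpa using ((hasDerivAt_id (0 : ℝ)).smul_const v).const_add x
  exact HasFDerivAt.comp_hasDerivAt_of_eq (x := (0 : ℝ)) (l := nearestPoint N)
    ((contDiffAt_nearestPoint hN hc hne hx).differentiableAt (by simp)).hasFDerivAt hline (by simp)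

/-- The infinitesimal form of `IsEmbeddedSubmanifold.nearestPoint_monotone`. -/
theorem fderiv_nearestPoint_monotone (hN : IsEmbeddedSubmanifold n N) (hc : IsCompact N)
    (hne : N.Nonempty) {x : E L} (hx : kappa N * Metric.infDist x N < 1) (v : E L) :
    (1 - kappa N * Metric.infDist x N) * ‖fderiv ℝ (nearestPoint N) x v‖ ^ 2 ≤
      inner ℝ v (fderiv ℝ (nearestPoint N) x v) := by
  have hs := (hasDerivAt_nearestPoint_line hN hc hne hx v).tendsto_slope_zero
  simp only [zero_add, zero_smul, add_zero] at hs
  have hd : Tendsto (fun t : ℝ => 1 - kappa N * (Metric.infDist (x + t • v) N +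
      Metric.infDist x N) / 2) (𝓝[≠] 0) (𝓝 (1 - kappa N * Metric.infDist x N)) := by
    have h1 : Continuous fun t : ℝ => 1 - kappa N * (Metric.infDist (x + t • v) N +
        Metric.infDist x N) / 2 := by
      have := (Metric.continuous_infDist_pt N).comp
        (show Continuous fun t : ℝ => x + t • v by fun_prop)
      simp only [Function.comp_def] at this
      fun_prop
    have h2 := (h1.tendsto 0).mono_left (nhdsWithin_le_nhds (s := {0}ᶜ))
    simp only [zero_smul, add_zero] at h2
    convert h2 using 2
    ring
  refine le_of_tendsto_of_tendsto (hd.mul (hs.norm.pow 2)) (tendsto_const_nhds.inner hs) ?_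
  filter_upwards [self_mem_nhdsWithin] with t ht
  have ht0 : t ≠ 0 := ht
  have h1 := hN.nearestPoint_monotone hc hne (x + t • v) x
  rw [add_sub_cancel_left, real_inner_smul_left] at h1
  rw [norm_smul, mul_pow, real_inner_smul_right, norm_inv, inv_pow, Real.norm_eq_abs, sq_abs]
  have htp : 0 < t ^ 2 := by positivity
  have h2 := mul_le_mul_of_nonneg_left h1 (inv_nonneg.2 htp.le)
  calc _ = (t ^ 2)⁻¹ * ((1 - kappa N * (Metric.infDist (x + t • v) N + Metric.infDist x N) / 2) *
        ‖nearestPoint N (x + t • v) - nearestPoint N x‖ ^ 2) := by ring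
    _ ≤ _ := h2
    _ = _ := by field_simp

/-- The derivative of the nearest point projection takes values in the tangent space of `N` at the
image point, since its difference quotients come from chords of `N`. -/
theorem fderiv_nearestPoint_mem (hN : IsEmbeddedSubmanifold n N) (hc : IsCompact N)
    (hne : N.Nonempty) {x : E L} (hx : kappa N * Metric.infDist x N < 1) (v : E L) :
    fderiv ℝ (nearestPoint N) x v ∈ tangentSpace N (nearestPoint N x) := by
  have hl := hasDerivAt_nearestPoint_line hN hc hne hx v
  have hs := hl.tendsto_slope_zero
  simp only [zero_add, zero_smul, add_zero] at hs
  refine Submodule.subset_span (mem_tangentConeAt_of_seq (𝓝[≠] (0 : ℝ)) (fun t => t⁻¹)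
    (fun t => nearestPoint N (x + t • v) - nearestPoint N x) ?_ ?_ hs)
  · have h1 := hl.continuousAt.tendsto.sub_const (nearestPoint N x)
    simp only [zero_smul, add_zero, sub_self] at h1
    exact h1.mono_left nhdsWithin_le_nhds
  · refine Eventually.of_forall fun t => ?_
    rw [add_sub_cancel]
    exact (nearestPoint_spec hc hne _).1

theorem kappa_mul_infDist_lt {y : E L} (hy : y ∈ N) : kappa N * Metric.infDist y N < 1 := by
  rw [Metric.infDist_zero_of_mem hy]; simp

/-- Two fields that agree along `N` have the same derivatives in directions tangent to `N`. -/
theorem IsEmbeddedSubmanifold.fderiv_eq_of_eqOn {F : Type*} [NormedAddCommGroup F]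
    [NormedSpace ℝ F] (hN : IsEmbeddedSubmanifold n N) {y : E L} (hy : y ∈ N) {f g : E L → F}
    {f' g' : E L →L[ℝ] F} (hf : HasFDerivAt f f' y) (hg : HasFDerivAt g g' y) (hfg : EqOn f g N)
    {w : E L} (hw : w ∈ tangentSpace N y) : f' w = g' w := by
  have h1 : HasFDerivWithinAt f g' N y := hg.hasFDerivWithinAt.congr hfg (hfg hy)
  exact hf.hasFDerivWithinAt.unique_on h1 (by rw [hN.tangentConeAt_eq hy]; exact hw)

theorem fderiv_nearestPoint_apply_self (hN : IsEmbeddedSubmanifold n N) (hc : IsCompact N)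
    {y : E L} (hy : y ∈ N) {w : E L} (hw : w ∈ tangentSpace N y) :
    fderiv ℝ (nearestPoint N) y w = w :=
  hN.fderiv_eq_of_eqOn hy
    ((contDiffAt_nearestPoint hN hc ⟨y, hy⟩ (kappa_mul_infDist_lt hy)).differentiableAt
      (by simp)).hasFDerivAt (hasFDerivAt_id y) (fun _ hz => nearestPoint_eq_self hc hz) hw

/-- Along `N` the derivative of the nearest point projection is the tangential projection. -/
theorem fderiv_nearestPoint_eq (hN : IsEmbeddedSubmanifold n N) (hc : IsCompact N)
    {y : E L} (hy : y ∈ N) : fderiv ℝ (nearestPoint N) y = tangentProj N y := by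
  have hne : N.Nonempty := ⟨y, hy⟩
  have hself := fun {w : E L} (hw : w ∈ tangentSpace N y) =>
    fderiv_nearestPoint_apply_self hN hc hy hw
  have hmem : ∀ v, fderiv ℝ (nearestPoint N) y v ∈ tangentSpace N y := fun v => by
    have := fderiv_nearestPoint_mem hN hc hne (kappa_mul_infDist_lt hy) v
    rwa [nearestPoint_eq_self hc hy] at this
  ext1 v
  refine (Submodule.eq_starProjection_of_mem_of_inner_eq_zero (hmem v) fun w hw => ?_).symm
  set u := v - fderiv ℝ (nearestPoint N) y v with hu
  have hu0 : fderiv ℝ (nearestPoint N) y u = 0 := by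
    rw [hu, map_sub, hself (hmem v), sub_self]
  -- monotonicity at `u + s w` forces `⟨u, w⟩ = 0`
  have hmono : ∀ s : ℝ, 0 ≤ s * inner ℝ u w := by
    intro s
    have h1 := fderiv_nearestPoint_monotone hN hc hne (kappa_mul_infDist_lt hy) (u + s • w)
    rw [Metric.infDist_zero_of_mem hy, mul_zero, sub_zero, one_mul, map_add, hu0, zero_add,
      map_smul, hself hw, inner_add_left, real_inner_smul_right, real_inner_self_eq_norm_sq] at h1
    linarith
  have h1 := hmono 1
  have h2 := hmono (-1)
  linarith

/-- The second derivative of the nearest point projection in a tangential direction is bounded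
by `κ`. Differentiating `τ² = τ = τ*` along `N` shows that it exchanges tangential and normal
vectors; the chord estimate enters through the monotonicity of the projection. -/
theorem norm_fderiv_fderiv_nearestPoint_le (hN : IsEmbeddedSubmanifold n N) (hc : IsCompact N)
    {y : E L} (hy : y ∈ N) {w : E L} (hw : w ∈ tangentSpace N y) (z : E L) :
    ‖fderiv ℝ (fderiv ℝ (nearestPoint N)) y w z‖ ≤ kappa N * ‖w‖ * ‖z‖ := by
  have hne : N.Nonempty := ⟨y, hy⟩
  have hκ := (hN.norm_normalProj_sub_le hc).1
  have hξ : ContDiffAt ℝ ∞ (nearestPoint N) y :=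
    contDiffAt_nearestPoint hN hc hne (kappa_mul_infDist_lt hy)
  set G := fderiv ℝ (nearestPoint N) with hG
  have hGd : HasFDerivAt G (fderiv ℝ G y) y :=
    ((hξ.fderiv_right (m := ∞) (by simp)).differentiableAt (by simp)).hasFDerivAt
  set H := fderiv ℝ G y with hH
  have hGN : ∀ x ∈ N, G x = tangentProj N x := fun x hx => fderiv_nearestPoint_eq hN hc hx
  have hGT : ∀ v, G y v ∈ tangentSpace N y := fun v => by rw [hGN y hy]; exact tangentProj_mem _ _ _
  have hGs : ∀ v ∈ tangentSpace N y, G y v = v := fun v hv =>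
    fderiv_nearestPoint_apply_self hN hc hy hv
  have hGi : ∀ x ∈ N, ∀ a b, inner ℝ (G x a) b = inner ℝ a (G x b) := fun x hx a b => by
    rw [hGN x hx]; exact Submodule.inner_starProjection_left_eq_right _ _ _
  have hsymm : ∀ v v', H v v' = H v' v := fun v v' =>
    ((hξ.of_le (m := minSmoothness ℝ 2) (by
      rw [minSmoothness_of_isRCLikeNormedField]
      exact WithTop.coe_le_coe.2 (le_top (a := (2 : ℕ∞))))).isSymmSndFDerivAt le_rfl).eq v v'
  have hadj : ∀ v ∈ tangentSpace N y, ∀ a b, inner ℝ (H v a) b = inner ℝ a (H v b) := by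
    intro v hv a b
    have h1 := hN.fderiv_eq_of_eqOn hy
      (((hGd.clm_apply (hasFDerivAt_const a y))).inner ℝ (hasFDerivAt_const b y))
      ((hasFDerivAt_const a y).inner ℝ ((hGd.clm_apply (hasFDerivAt_const b y))))
      (fun x hx => hGi x hx a b) hv
    simpa [fderivInnerCLM_apply] using h1
  have hidem : ∀ v ∈ tangentSpace N y, ∀ a, H v (G y a) + G y (H v a) = H v a := by
    intro v hv a
    have h1 := hN.fderiv_eq_of_eqOn hy
      (hGd.clm_apply (hGd.clm_apply (hasFDerivAt_const a y)))
      (hGd.clm_apply (hasFDerivAt_const a y))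
      (fun x hx => by
        change G x (G x a) = G x a
        rw [hGN x hx]
        exact tangentProj_eq_self_iff.2 (tangentProj_mem _ _ _)) hv
    have h2 : G y (H v a) + H v (G y a) = H v a := by simpa using h1
    rw [add_comm]; exact h2
  -- the monotonicity inequality at `y + t u` is an equality at `t = 0`; differentiate it in `t`
  have hquad : ∀ u, G y u = 0 → ∀ v ∈ tangentSpace N y,
      inner ℝ v (H u v) ≤ kappa N * ‖u‖ * ‖v‖ ^ 2 := by
    intro u hu v hv
    have hline : HasDerivAt (fun t : ℝ => y + t • u) u 0 := by
      simpa using ((hasDerivAt_id (0 : ℝ)).smul_const u).const_add y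
    have hGl : HasDerivAt (fun t : ℝ => G (y + t • u)) (H u) 0 :=
      HasFDerivAt.comp_hasDerivAt_of_eq (x := (0 : ℝ)) (l := G) hGd hline (by simp)
    have hGv : HasDerivAt (fun t : ℝ => G (y + t • u) v) (H u v) 0 := by
      simpa using hGl.clm_apply (hasDerivAt_const (0 : ℝ) v)
    have hf1 : HasDerivAt (fun t : ℝ => inner ℝ v (G (y + t • u) v)) (inner ℝ v (H u v)) 0 := by
      simpa using (hasDerivAt_const (0 : ℝ) v).inner ℝ hGv
    have hf2 : HasDerivAt (fun t : ℝ => 1 - kappa N * (t * ‖u‖)) (-(kappa N * ‖u‖)) 0 := by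
      simpa using (((hasDerivAt_id (0 : ℝ)).mul_const ‖u‖).const_mul (kappa N)).const_sub 1
    have hf := hf1.sub (hf2.mul hGv.norm_sq)
    have hlim := hf.tendsto_slope_zero_right
    have hnonneg := ge_of_tendsto (b := 0) hlim ?_
    · simp only [zero_smul, add_zero, hGs v hv, zero_mul, mul_zero, sub_zero, one_mul] at hnonneg
      linarith
    · have hev : ∀ᶠ t : ℝ in 𝓝 0, kappa N * Metric.infDist (y + t • u) N < 1 := by
        have h1 : Continuous fun x => kappa N * Metric.infDist x N :=
          continuous_const.mul (Metric.continuous_infDist_pt N)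
        have h2 := h1.continuousAt.comp (x := (0 : ℝ)) hline.continuousAt
        exact h2.eventually_lt_const (by simpa using kappa_mul_infDist_lt hy)
      filter_upwards [hev.filter_mono nhdsWithin_le_nhds, self_mem_nhdsWithin] with t ht ht0
      have ht0' : 0 < t := ht0
      refine smul_nonneg (inv_nonneg.2 ht0'.le) ?_
      have h1 := fderiv_nearestPoint_monotone hN hc hne ht v
      have h2 : Metric.infDist (y + t • u) N ≤ t * ‖u‖ := by
        refine (Metric.infDist_le_dist_of_mem hy).trans_eq ?_
        rw [dist_eq_norm, add_sub_cancel_left, norm_smul, Real.norm_eq_abs, abs_of_pos ht0']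
      have h3 : (1 - kappa N * (t * ‖u‖)) * ‖G (y + t • u) v‖ ^ 2 ≤
          (1 - kappa N * Metric.infDist (y + t • u) N) * ‖G (y + t • u) v‖ ^ 2 := by gcongr
      simp only [Pi.sub_apply, Pi.mul_apply, zero_add, zero_smul, add_zero, hGs v hv, zero_mul,
        mul_zero, sub_zero, one_mul, real_inner_self_eq_norm_sq, sub_self]
      linarith
  -- polarization
  have hbil : ∀ u, G y u = 0 → ∀ v ∈ tangentSpace N y, ∀ v' ∈ tangentSpace N y,
      inner ℝ (H v v') u ≤ kappa N * ‖u‖ * (‖v‖ * ‖v'‖) := by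
    intro u hu
    have hflip : ∀ v ∈ tangentSpace N y, ∀ v', inner ℝ (H v v') u = inner ℝ v' (H u v) := by
      intro v hv v'
      rw [hadj v hv, hsymm v u]
    have hq' : ∀ v ∈ tangentSpace N y, -(kappa N * ‖u‖ * ‖v‖ ^ 2) ≤ inner ℝ v (H u v) := by
      intro v hv
      have := hquad (-u) (by rw [map_neg, hu, neg_zero]) v hv
      rw [norm_neg, map_neg, neg_apply, inner_neg_right] at this
      linarith
    have hunit : ∀ v ∈ tangentSpace N y, ∀ v' ∈ tangentSpace N y,
        inner ℝ (H v v') u ≤ kappa N * ‖u‖ * ((‖v‖ ^ 2 + ‖v'‖ ^ 2) / 2) := by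
      intro v hv v' hv'
      have h1 := hquad u hu (v + v') (add_mem hv hv')
      have h2 := hq' (v - v') (sub_mem hv hv')
      have h3 := parallelogram_law_with_norm ℝ v v'
      have h4 : inner ℝ v' (H u v) = inner ℝ v (H u v') := by
        rw [← hflip v hv, ← hflip v' hv', hsymm]
      rw [map_add, inner_add_left, inner_add_right, inner_add_right] at h1
      rw [map_sub, inner_sub_left, inner_sub_right, inner_sub_right] at h2
      rw [hflip v hv]
      have h5 : kappa N * ‖u‖ * (‖v + v'‖ ^ 2 + ‖v - v'‖ ^ 2) =
          kappa N * ‖u‖ * (2 * (‖v‖ ^ 2 + ‖v'‖ ^ 2)) := by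
        rw [← h3]
      linarith
    intro v hv v' hv'
    rcases eq_or_ne v 0 with rfl | hv0
    · simp
    rcases eq_or_ne v' 0 with rfl | hv0'
    · simp
    have hp : 0 < ‖v‖ := norm_pos_iff.2 hv0
    have hp' : 0 < ‖v'‖ := norm_pos_iff.2 hv0'
    have h1 := hunit (‖v‖⁻¹ • v) (Submodule.smul_mem _ _ hv) (‖v'‖⁻¹ • v')
      (Submodule.smul_mem _ _ hv')
    rw [norm_smul, norm_smul, norm_inv, norm_inv, norm_norm, norm_norm, inv_mul_cancel₀ hp.ne',
      inv_mul_cancel₀ hp'.ne', map_smul, map_smul, smul_apply, smul_smul,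
      real_inner_smul_left] at h1
    have h2 : (‖v'‖⁻¹ * ‖v‖⁻¹) * inner ℝ (H v v') u ≤ kappa N * ‖u‖ := by linarith
    rw [← mul_inv, inv_mul_le_iff₀ (by positivity)] at h2
    linarith
  have hTperp : ∀ v ∈ tangentSpace N y, G y (H w v) = 0 := by
    intro v hv
    have := hidem w hw v
    rwa [hGs v hv, add_eq_left] at this
  have hT : ∀ v ∈ tangentSpace N y, ‖H w v‖ ≤ kappa N * ‖w‖ * ‖v‖ := by
    intro v hv
    have h1 := hbil (H w v) (hTperp v hv) w hw v hv
    rw [real_inner_self_eq_norm_sq] at h1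
    rcases (norm_nonneg (H w v)).eq_or_lt with h | h
    · rw [← h]; positivity
    · nlinarith
  have hP : ∀ u, G y u = 0 → ‖H w u‖ ≤ kappa N * ‖w‖ * ‖u‖ := by
    intro u hu
    have hmem : H w u ∈ tangentSpace N y := by
      have := hidem w hw u
      rw [hu, map_zero, zero_add] at this
      rw [← this]; exact hGT _
    have h1 := hbil u hu w hw (H w u) hmem
    rw [hadj w hw, real_inner_self_eq_norm_sq] at h1
    rcases (norm_nonneg (H w u)).eq_or_lt with h | h
    · rw [← h]; positivity
    · nlinarith
  set a := G y z with ha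
  have haT : a ∈ tangentSpace N y := hGT z
  have hb : G y (z - a) = 0 := by rw [map_sub, hGs a haT, ← ha, sub_self]
  have hpyth : ∀ u v, u ∈ tangentSpace N y → G y v = 0 → ‖u + v‖ ^ 2 = ‖u‖ ^ 2 + ‖v‖ ^ 2 := by
    intro u v hu hv
    have : inner ℝ u v = 0 := by rw [← hGs u hu, hGi y hy, hv, inner_zero_right]
    rw [norm_add_sq_real, this]; ring
  have hz : ‖z‖ ^ 2 = ‖a‖ ^ 2 + ‖z - a‖ ^ 2 := by
    rw [← hpyth a (z - a) haT hb, add_sub_cancel]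
  have hbT : H w (z - a) ∈ tangentSpace N y := by
    have := hidem w hw (z - a)
    rw [hb, map_zero, zero_add] at this
    rw [← this]; exact hGT _
  have hHz : ‖H w z‖ ^ 2 = ‖H w (z - a)‖ ^ 2 + ‖H w a‖ ^ 2 := by
    rw [← hpyth _ _ hbT (hTperp a haT), ← map_add, sub_add_cancel]
  refine abs_le_of_sq_le_sq' ?_ (by positivity) |>.2
  rw [hHz, mul_pow, hz, mul_add, add_comm, ← mul_pow, ← mul_pow]
  gcongr
  · exact hT a haT
  · exact hP _ hb

/-- The correction `ζ` of the radial field `x - p`: minus the normal part, at the nearest point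
`ξ(x)` of `N`, of `ξ(x) - p`. The field `x - p + ζ(x)` is tangent to `N` along `N`, while `ζ` is
quadratically small at `p`. -/
noncomputable def radialCorrection (N : Set (E L)) (p x : E L) : E L :=
  fderiv ℝ (nearestPoint N) (nearestPoint N x) (nearestPoint N x - p) - (nearestPoint N x - p)

section Correction

variable {p x : E L}

theorem kappa_mul_infDist_lt_half (hN : IsEmbeddedSubmanifold n N) (hc : IsCompact N)
    (hp : p ∈ N) (hx : 2 * kappa N * ‖x - p‖ < 1) : kappa N * Metric.infDist x N < 1 / 2 := by
  have h1 := Metric.infDist_le_dist_of_mem (x := x) hp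
  rw [dist_eq_norm] at h1
  have h2 := mul_le_mul_of_nonneg_left h1 (hN.norm_normalProj_sub_le hc).1
  linarith

theorem norm_nearestPoint_sub_le (hc : IsCompact N) (hp : p ∈ N) :
    ‖nearestPoint N x - p‖ ≤ 2 * ‖x - p‖ := by
  have h1 := norm_sub_nearestPoint_le hc hp x
  have h2 : nearestPoint N x - p = (x - p) - (x - nearestPoint N x) := by abel
  rw [h2]
  exact (norm_sub_le _ _).trans (by linarith)

theorem contDiffAt_radialCorrection (hN : IsEmbeddedSubmanifold n N) (hc : IsCompact N)
    (hp : p ∈ N) (hx : 2 * kappa N * ‖x - p‖ < 1) :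
    ContDiffAt ℝ ∞ (radialCorrection N p) x := by
  have hne : N.Nonempty := ⟨p, hp⟩
  have hξ := contDiffAt_nearestPoint hN hc hne
    ((kappa_mul_infDist_lt_half hN hc hp hx).trans (by norm_num))
  have hG := (contDiffAt_nearestPoint hN hc hne
    (kappa_mul_infDist_lt (nearestPoint_spec hc hne x).1)).fderiv_right (m := ∞) (by simp)
  have hξp := hξ.sub (contDiffAt_const (c := p))
  exact ((ContDiffAt.comp x (g := fderiv ℝ (nearestPoint N)) hG hξ).clm_apply hξp).sub hξp

theorem norm_radialCorrection_le (hN : IsEmbeddedSubmanifold n N) (hc : IsCompact N)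
    (hp : p ∈ N) (x : E L) : ‖radialCorrection N p x‖ ≤ 2 * kappa N * ‖x - p‖ ^ 2 := by
  have hne : N.Nonempty := ⟨p, hp⟩
  have hξN := (nearestPoint_spec hc hne x).1
  have h1 := (hN.norm_normalProj_sub_le hc).2 _ hξN _ hp
  have h2 : radialCorrection N p x = normalProj N (nearestPoint N x) (p - nearestPoint N x) := by
    rw [radialCorrection, fderiv_nearestPoint_eq hN hc hξN, normalProj_apply,
      ← neg_sub (nearestPoint N x) p, map_neg]
    abel
  rw [h2]
  refine h1.trans ?_
  rw [norm_sub_rev]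
  have h3 := norm_nearestPoint_sub_le (x := x) hc hp
  have h4 := (hN.norm_normalProj_sub_le hc).1
  calc kappa N / 2 * ‖nearestPoint N x - p‖ ^ 2 ≤ kappa N / 2 * (2 * ‖x - p‖) ^ 2 := by gcongr
    _ = _ := by ring

theorem norm_fderiv_radialCorrection_le (hN : IsEmbeddedSubmanifold n N) (hc : IsCompact N)
    (hp : p ∈ N) (hx : 2 * kappa N * ‖x - p‖ < 1) :
    ‖fderiv ℝ (radialCorrection N p) x‖ ≤ 4 * kappa N * ‖x - p‖ := by
  have hne : N.Nonempty := ⟨p, hp⟩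
  have hκ := (hN.norm_normalProj_sub_le hc).1
  have hξN := (nearestPoint_spec hc hne x).1
  have hd := kappa_mul_infDist_lt_half hN hc hp hx
  have hd1 : kappa N * Metric.infDist x N < 1 := hd.trans (by norm_num)
  have hξ := ((contDiffAt_nearestPoint hN hc hne hd1).differentiableAt (by simp)).hasFDerivAt
  have hG := (((contDiffAt_nearestPoint hN hc hne
    (kappa_mul_infDist_lt hξN)).fderiv_right (m := ∞) (by simp)).differentiableAt
      (by simp)).hasFDerivAt
  have hξp := hξ.sub_const p
  have hζ : HasFDerivAt (radialCorrection N p) _ x :=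
    (HasFDerivAt.clm_apply (HasFDerivAt.comp x (g := fderiv ℝ (nearestPoint N)) hG hξ) hξp).sub hξp
  refine ContinuousLinearMap.opNorm_le_bound _ (by positivity) fun v => ?_
  rw [hζ.fderiv]
  set u := fderiv ℝ (nearestPoint N) x v with hu
  have huT : u ∈ tangentSpace N (nearestPoint N x) := fderiv_nearestPoint_mem hN hc hne hd1 v
  have hun : ‖u‖ ≤ 2 * ‖v‖ := by
    have h1 := fderiv_nearestPoint_monotone hN hc hne hd1 v
    have h2 := real_inner_le_norm v u
    rw [← hu] at h1
    rcases (norm_nonneg u).eq_or_lt with h | h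
    · rw [← h]; positivity
    · have h3 : (1 - kappa N * Metric.infDist x N) * ‖u‖ ≤ ‖v‖ := by nlinarith
      nlinarith
  have h1 := norm_fderiv_fderiv_nearestPoint_le hN hc hξN huT (nearestPoint N x - p)
  have h2 := fderiv_nearestPoint_apply_self hN hc hξN huT
  have h3 := norm_nearestPoint_sub_le (x := x) hc hp
  simp only [sub_apply, add_apply, ContinuousLinearMap.comp_apply,
    ContinuousLinearMap.flip_apply, Function.comp_apply, ← hu, h2]
  rw [add_sub_cancel_left]
  calc _ ≤ kappa N * ‖u‖ * ‖nearestPoint N x - p‖ := h1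
    _ ≤ kappa N * (2 * ‖v‖) * (2 * ‖x - p‖) := by gcongr
    _ = _ := by ring

theorem add_radialCorrection_mem (hN : IsEmbeddedSubmanifold n N) (hc : IsCompact N)
    {q : E L} (hq : q ∈ N) : q - p + radialCorrection N p q ∈ tangentSpace N q := by
  rw [radialCorrection, nearestPoint_eq_self hc hq, add_sub_cancel,
    fderiv_nearestPoint_eq hN hc hq]
  exact tangentProj_mem _ _ _

end Correction

end

/-! ### Radial test fields -/

section

variable {L k m n : ℕ}

theorem hasFDerivAt_norm_sub {p x : E L} (hx : x ≠ p) :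
    HasFDerivAt (fun y => ‖y - p‖) (innerSL ℝ (‖x - p‖⁻¹ • (x - p))) x := by
  have h0 : 0 < ‖x - p‖ := norm_pos_iff.2 (sub_ne_zero.2 hx)
  have h1 := ((hasFDerivAt_id x).sub_const p).norm_sq.sqrt (by positivity)
  have h2 : (fun y : E L => √(‖id y - p‖ ^ 2)) = fun y => ‖y - p‖ := by
    ext1 y; simp [Real.sqrt_sq]
  simp only [h2] at h1
  refine h1.congr_fderiv ?_
  ext1 v
  simp only [id, Real.sqrt_sq h0.le, smul_apply, ContinuousLinearMap.comp_apply,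
    innerSL_apply_apply, real_inner_smul_left, ContinuousLinearMap.id_apply, smul_eq_mul,
    nsmul_eq_mul, Nat.cast_ofNat]
  field_simp

/-- The gradient of the distance to `p`; at `p` itself both sides are zero by convention. -/
theorem gradient_norm_sub (p x : E L) :
    gradient (fun y => ‖y - p‖) x = ‖x - p‖⁻¹ • (x - p) := by
  rcases eq_or_ne x p with rfl | hx
  · have h : IsLocalMin (fun y => ‖y - x‖) x := Eventually.of_forall fun y => by simp
    rw [gradient, h.fderiv_eq_zero]
    simp
  · rw [gradient, (hasFDerivAt_norm_sub hx).fderiv]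
    exact (InnerProductSpace.toDual ℝ (E L)).symm_apply_apply _

theorem norm_unit_radial_le (p x : E L) : ‖‖x - p‖⁻¹ • (x - p)‖ ≤ 1 := by
  rw [norm_smul, norm_inv, norm_norm]
  exact inv_mul_le_one

theorem norm_smul_unit_radial (p x : E L) : ‖x - p‖ • (‖x - p‖⁻¹ • (x - p)) = x - p := by
  rcases eq_or_ne x p with rfl | hx
  · simp
  · rw [smul_smul, mul_inv_cancel₀ (norm_ne_zero_iff.2 (sub_ne_zero.2 hx)), one_smul]

theorem Grassmannian.inner_left_eq_right (S : Grassmannian L k) (a b : E L) :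
    inner ℝ (S.1 a) b = inner ℝ a (S.1 b) := by
  rw [← ContinuousLinearMap.adjoint_inner_right, S.adjoint_eq]

theorem Grassmannian.norm_sq_add (S : Grassmannian L k) (u : E L) :
    ‖S.1 u‖ ^ 2 + ‖(1 - S.1) u‖ ^ 2 = ‖u‖ ^ 2 := by
  have h1 : inner ℝ (S.1 u) ((1 - S.1) u) = 0 := by
    rw [S.inner_left_eq_right]
    simp [S.apply_apply]
  have h2 : S.1 u + (1 - S.1) u = u := by simp
  nth_rewrite 3 [← h2]
  rw [norm_add_sq_real, h1]
  ring

theorem sqNormPerpGradDist_nonneg (p x : E L) (S : Grassmannian L k) :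
    0 ≤ sqNormPerpGradDist p x S := sq_nonneg _

theorem sqNormPerpGradDist_add (p x : E L) (S : Grassmannian L k) :
    ‖S.1 (‖x - p‖⁻¹ • (x - p))‖ ^ 2 + sqNormPerpGradDist p x S ≤ 1 := by
  rw [sqNormPerpGradDist, gradient_norm_sub, S.norm_sq_add]
  exact pow_le_one₀ (norm_nonneg _) (norm_unit_radial_le p x)

theorem sqNormPerpGradDist_le_one (p x : E L) (S : Grassmannian L k) :
    sqNormPerpGradDist p x S ≤ 1 := by
  have := sqNormPerpGradDist_add p x S
  nlinarith [sq_nonneg ‖S.1 (‖x - p‖⁻¹ • (x - p))‖]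

theorem measurable_sqNormPerpGradDist (p : E L) :
    Measurable fun z : E L × Grassmannian L k => sqNormPerpGradDist p z.1 z.2 := by
  have h : (fun z : E L × Grassmannian L k => sqNormPerpGradDist p z.1 z.2) =
      fun z => (‖z.1 - p‖⁻¹ * ‖(1 - z.2.1) (z.1 - p)‖) ^ 2 := by
    ext1 z
    rw [sqNormPerpGradDist, gradient_norm_sub, map_smul, norm_smul, norm_inv, norm_norm]
  rw [h]
  have h1 : Continuous fun z : E L × Grassmannian L k => ‖(1 - z.2.1) (z.1 - p)‖ := by
    have : Continuous fun z : E L × Grassmannian L k => z.2.1 :=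
      continuous_subtype_val.comp continuous_snd
    fun_prop
  have h2 : Continuous fun z : E L × Grassmannian L k => ‖z.1 - p‖ := by fun_prop
  exact (h2.measurable.inv.mul h1.measurable).pow_const 2

theorem traceOn_smulRight (u y : E L) (S : Grassmannian L k) :
    traceOn ((innerSL ℝ u).smulRight y) S = inner ℝ (S.1 u) y := by
  rw [traceOn, traceL_eq_sum _ (stdOrthonormalBasis ℝ (E L))]
  have h1 : inner ℝ (S.1 u) y = inner ℝ (S.1 u) (S.1 y) := by
    rw [← S.inner_left_eq_right, S.apply_apply]
  rw [h1, ← (stdOrthonormalBasis ℝ (E L)).sum_inner_mul_inner]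
  refine Finset.sum_congr rfl fun i _ => ?_
  simp only [ContinuousLinearMap.comp_apply, ContinuousLinearMap.smulRight_apply,
    innerSL_apply_apply, map_smul, real_inner_smul_right]
  rw [S.inner_left_eq_right]

theorem traceOn_add (A B : E L →L[ℝ] E L) (S : Grassmannian L k) :
    traceOn (A + B) S = traceOn A S + traceOn B S := by
  simp [traceOn, ContinuousLinearMap.comp_add, ContinuousLinearMap.add_comp]

theorem traceOn_smul (c : ℝ) (A : E L →L[ℝ] E L) (S : Grassmannian L k) :
    traceOn (c • A) S = c * traceOn A S := by
  simp [traceOn]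

theorem hasDerivAt_integral_tail {g : ℝ → ℝ} (hg : Continuous g) (ρ r : ℝ) :
    HasDerivAt (fun r => ∫ s in r..ρ, g s) (-g r) r :=
  intervalIntegral.integral_hasDerivAt_left (hg.intervalIntegrable _ _)
    hg.stronglyMeasurable.stronglyMeasurableAtFilter hg.continuousAt

theorem contDiff_integral_tail {g : ℝ → ℝ} (hg : ContDiff ℝ ∞ g) (ρ : ℝ) :
    ContDiff ℝ ∞ fun r => ∫ s in r..ρ, g s := by
  have h := hasDerivAt_integral_tail hg.continuous ρ
  rw [contDiff_infty_iff_deriv]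
  refine ⟨fun r => (h r).differentiableAt, ?_⟩
  rw [show deriv (fun r => ∫ s in r..ρ, g s) = fun r => -g r from funext fun r => (h r).deriv]
  exact hg.neg

section Radial

variable {g : ℝ → ℝ} {σ₀ ρ : ℝ}

theorem radial_eventuallyEq_const (hg : Continuous g) (hσ₀ : 0 < σ₀) (hg0 : ∀ s ≤ σ₀, g s = 0)
    (p : E L) : (fun x => ∫ s in ‖x - p‖..ρ, g s) =ᶠ[𝓝 p] fun _ => ∫ s in (0 : ℝ)..ρ, g s := by
  filter_upwards [Metric.ball_mem_nhds p hσ₀] with y hy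
  rw [mem_ball_iff_norm] at hy
  rw [← intervalIntegral.integral_add_adjacent_intervals (a := 0) (b := ‖y - p‖) (c := ρ)
    (hg.intervalIntegrable _ _) (hg.intervalIntegrable _ _), right_eq_add]
  refine intervalIntegral.integral_zero_ae (Eventually.of_forall fun s hs => hg0 s ?_)
  rw [uIoc_of_le (norm_nonneg _)] at hs
  exact hs.2.trans hy.le

/-- A radial function whose profile is constant near `0` is smooth. -/
theorem contDiff_radial (hg : ContDiff ℝ ∞ g) (hσ₀ : 0 < σ₀) (hg0 : ∀ s ≤ σ₀, g s = 0)
    (p : E L) : ContDiff ℝ ∞ fun x => ∫ s in ‖x - p‖..ρ, g s := by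
  rw [contDiff_iff_contDiffAt]
  intro x
  rcases eq_or_ne x p with rfl | hx
  · exact contDiffAt_const.congr_of_eventuallyEq
      (radial_eventuallyEq_const hg.continuous hσ₀ hg0 x)
  · exact (contDiff_integral_tail hg ρ).contDiffAt.comp x
      ((contDiffAt_norm ℝ (sub_ne_zero.2 hx)).comp x (contDiffAt_id.sub contDiffAt_const))

/-- At `p` the formula holds because `g 0 = 0`, whatever the (junk) unit radial vector is there. -/
theorem hasFDerivAt_radial (hg : ContDiff ℝ ∞ g) (hσ₀ : 0 < σ₀) (hg0 : ∀ s ≤ σ₀, g s = 0)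
    (p x : E L) : HasFDerivAt (fun x => ∫ s in ‖x - p‖..ρ, g s)
      (-g ‖x - p‖ • innerSL ℝ (‖x - p‖⁻¹ • (x - p))) x := by
  rcases eq_or_ne x p with rfl | hx
  · refine ((hasFDerivAt_const _ x).congr_of_eventuallyEq
      (radial_eventuallyEq_const hg.continuous hσ₀ hg0 x)).congr_fderiv ?_
    simp
  · exact (hasDerivAt_integral_tail hg.continuous ρ ‖x - p‖).comp_hasFDerivAt x
      (hasFDerivAt_norm_sub hx)

end Radial

/-- A lower bound for the divergence along `S` of `η(r) Y` with `Y = x - p + ζ`, where `η' = -g` and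
`ζ` is quadratically small. -/
theorem traceOn_fderiv_radial_ge {a b Λ e g : ℝ} {p x y : E L} (hx : ‖y‖ ≤ a * ‖x - p‖ ^ 2)
    {D : E L →L[ℝ] E L} (hD : ‖D‖ ≤ b * ‖x - p‖) (he : 0 ≤ e) (hg : 0 ≤ g) (hΛ : 0 ≤ Λ)
    (S : Grassmannian L k) :
    e * (k * (1 - b * ‖x - p‖ - Λ * ‖x - p‖ * (1 + a * ‖x - p‖))) -
        g * (‖x - p‖ * (1 + a * ‖x - p‖)) + g * ‖x - p‖ * sqNormPerpGradDist p x S ≤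
      traceOn (e • (1 + D) +
        (-g • innerSL ℝ (‖x - p‖⁻¹ • (x - p))).smulRight (x - p + y)) S -
        k * Λ * ‖e • (x - p + y)‖ := by
  have h1 : (-g • innerSL ℝ (‖x - p‖⁻¹ • (x - p))).smulRight (x - p + y) =
      -g • (innerSL ℝ (‖x - p‖⁻¹ • (x - p))).smulRight (x - p + y) := by
    ext1 v
    simp only [ContinuousLinearMap.smulRight_apply, smul_apply, smul_smul, smul_eq_mul]
  set u := ‖x - p‖⁻¹ • (x - p) with hu
  set r := ‖x - p‖ with hr
  have hr0 : 0 ≤ r := norm_nonneg _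
  have hk : (0 : ℝ) ≤ k := k.cast_nonneg
  rw [h1, traceOn_add, traceOn_smul, traceOn_smul, traceOn_smulRight]
  have h2 : (k : ℝ) * (1 - b * r) ≤ traceOn (1 + D) S := by
    obtain ⟨f, hf1, -, hf⟩ := S.exists_orthonormal
    rw [hf]
    have : ∀ i ∈ Finset.univ, 1 - b * r ≤ inner ℝ (f i) ((1 + D) (f i)) := by
      intro i _
      rw [add_apply, one_apply_eq_self, inner_add_right, real_inner_self_eq_norm_sq,
        hf1]
      have h3 := abs_real_inner_le_norm (f i) (D (f i))
      have h4 := D.le_opNorm (f i)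
      rw [hf1, mul_one] at h4
      rw [hf1, one_mul] at h3
      linarith [(abs_le.1 h3).1]
    have h5 := Finset.card_nsmul_le_sum _ _ _ this
    simpa using h5
  have h3 : inner ℝ (S.1 u) (x - p + y) ≤ r * (1 - sqNormPerpGradDist p x S) + a * r ^ 2 := by
    have hxp : x - p = r • u := (norm_smul_unit_radial p x).symm
    have h4 : inner ℝ (S.1 u) u = ‖S.1 u‖ ^ 2 := by
      rw [← real_inner_self_eq_norm_sq, S.inner_left_eq_right u (S.1 u), S.apply_apply,
        S.inner_left_eq_right]
    have h5 := sqNormPerpGradDist_add p x S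
    rw [← hr, ← hu] at h5
    rw [inner_add_right, hxp, real_inner_smul_right, h4]
    have h6 : ‖S.1 u‖ ≤ 1 := by
      have := sqNormPerpGradDist_nonneg p x S
      exact (sq_le_one_iff₀ (norm_nonneg _)).1 (by linarith)
    have h7 : inner ℝ (S.1 u) y ≤ a * r ^ 2 :=
      (real_inner_le_norm _ _).trans ((mul_le_of_le_one_left (norm_nonneg _) h6).trans hx)
    have h8 : r * ‖S.1 u‖ ^ 2 ≤ r * (1 - sqNormPerpGradDist p x S) := by gcongr; linarith
    linarith
  have h4 : ‖e • (x - p + y)‖ ≤ e * (r + a * r ^ 2) := by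
    rw [norm_smul, Real.norm_eq_abs, abs_of_nonneg he]
    gcongr
    exact (norm_add_le _ _).trans (by linarith)
  have h5 := mul_le_mul_of_nonneg_left h2 he
  have h6 := mul_le_mul_of_nonneg_left h3 hg
  have h7 := mul_le_mul_of_nonneg_left h4 (mul_nonneg hk hΛ)
  linarith

/-- A submanifold is closed in some open neighbourhood of itself. -/
theorem IsEmbeddedSubmanifold.exists_isOpen_closure_inter {M : Set (E L)}
    (hM : IsEmbeddedSubmanifold m M) : ∃ U, IsOpen U ∧ M ⊆ U ∧ U ∩ closure M ⊆ M := by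
  choose! U T hU hxU _ _ _ hcl using fun p (hp : p ∈ M) => hM.exists_local_tangentProj hp
  refine ⟨⋃ p ∈ M, U p, isOpen_biUnion hU, fun p hp => mem_biUnion hp (hxU p hp), ?_⟩
  rintro x ⟨hx, hxM⟩
  obtain ⟨p, hp, hxp⟩ := mem_iUnion₂.1 hx
  exact hcl p hp ⟨hxM, hxp⟩

/-- The first variation inequality for the radial field `η(r) (x - p + ζ)` with `η' = -g`. -/
theorem Varifold.IsStationaryFreeBoundary.integral_radial_le {V : Varifold L k}
    {M N : Set (E L)} (h : V.IsStationaryFreeBoundary M N) (hM : IsEmbeddedSubmanifold m M)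
    (hN : IsEmbeddedSubmanifold n N) (hc : IsCompact N) (hNM : N ⊆ M) {Λ : ℝ} (hΛ : 0 ≤ Λ)
    (hA : SecondFundamentalFormBound M Λ) (hV : V ∈ varifoldsIn k M) {p : E L} (hp : p ∈ N)
    {ρ : ℝ} (hρ : 2 * kappa N * ρ < 1) {g : ℝ → ℝ} {σ₀ : ℝ} (hg : ContDiff ℝ ∞ g)
    (hg' : ∀ s, 0 ≤ g s) (hσ₀ : 0 < σ₀) (hg0 : ∀ s ≤ σ₀, g s = 0) (hgρ : ∀ s, ρ ≤ s → g s = 0) :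
    ∫ z in Metric.ball p ρ ×ˢ univ,
      ((∫ s in ‖z.1 - p‖..ρ, g s) * (k * (1 - 4 * kappa N * ‖z.1 - p‖ -
          Λ * ‖z.1 - p‖ * (1 + 2 * kappa N * ‖z.1 - p‖))) -
        g ‖z.1 - p‖ * (‖z.1 - p‖ * (1 + 2 * kappa N * ‖z.1 - p‖)) +
        g ‖z.1 - p‖ * ‖z.1 - p‖ * sqNormPerpGradDist p z.1 z.2) ∂V.toMeasure ≤ 0 := by
  set a := 2 * kappa N with ha
  obtain ⟨U, hU, hMU, hUM⟩ := hM.exists_isOpen_closure_inter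
  -- the part of the support of `‖V‖` in the closed ball is a compact subset of `M`, so the test
  -- field can be cut off near it before the frontier points of `M` are reached
  obtain ⟨χ, hχ, hχc, hχU, hχ1⟩ := exists_smooth_cutoff
    ((isCompact_closedBall p ρ).inter_right V.weight.isClosed_support) hU
    ((inter_subset_right.trans hV.2).trans hMU)
  set η : E L → ℝ := fun x => ∫ s in ‖x - p‖..ρ, g s with hη
  have hηs : ContDiff ℝ ∞ η := contDiff_radial hg hσ₀ hg0 p
  have hη0 : ∀ x, ρ ≤ ‖x - p‖ → η x = 0 := by
    intro x hx
    refine intervalIntegral.integral_zero_ae (Eventually.of_forall fun s hs => hgρ s ?_)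
    rw [uIoc_of_ge hx] at hs
    exact hs.1.le
  have hηnn : ∀ x, 0 ≤ η x := by
    intro x
    rcases le_total ‖x - p‖ ρ with hx | hx
    · exact intervalIntegral.integral_nonneg hx fun s _ => hg' s
    · exact (hη0 x hx).ge
  set Y : E L → E L := fun x => x - p + radialCorrection N p x with hY
  have hsm : ∀ x, ‖x - p‖ ≤ ρ → a * ‖x - p‖ < 1 := fun x hx => by
    have := mul_le_mul_of_nonneg_left hx (hN.norm_normalProj_sub_le hc).1
    rw [ha]
    linarith
  have hfar : ∀ x, ρ < ‖x - p‖ → η =ᶠ[𝓝 x] 0 := by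
    intro x hx
    have hcont : Continuous fun y : E L => ‖y - p‖ := by fun_prop
    filter_upwards [(isOpen_lt continuous_const hcont).mem_nhds hx] with y hy
    exact hη0 y (le_of_lt hy)
  set Z : E L → E L := fun x => χ x • η x • Y x with hZ
  have hZfar : ∀ x, ρ < ‖x - p‖ → Z =ᶠ[𝓝 x] fun _ => 0 := fun x hx => by
    filter_upwards [hfar x hx] with y hy
    simp [hZ, hy]
  have hZs : ContDiff ℝ ∞ Z := by
    rw [contDiff_iff_contDiffAt]
    intro x
    rcases le_or_gt ‖x - p‖ ρ with hx | hx
    · exact hχ.contDiffAt.smul (hηs.contDiffAt.smul ((contDiffAt_id.sub contDiffAt_const).add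
        (contDiffAt_radialCorrection hN hc hp (hsm x hx))))
    · exact contDiffAt_const.congr_of_eventuallyEq (hZfar x hx)
  have hZc : HasCompactSupport Z := hχc.smul_right
  have hZM : tsupport Z ∩ closure M ⊆ M := fun x hx =>
    hUM ⟨hχU (tsupport_smul_subset_left χ (fun x => η x • Y x) hx.1), hx.2⟩
  have hZN : ∀ q ∈ N, Z q ∈ tangentSpace N q := fun q hq =>
    Submodule.smul_mem _ _ (Submodule.smul_mem _ _ (add_radialCorrection_mem hN hc hq))
  have hVt := hM.ae_tangent_of_mem_varifoldsIn hV
  obtain ⟨hint, hle⟩ := h.integral_le_zero hM hNM hA hVt hZs hZc hZM hZN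
  have hfint : Integrable (fun z : E L × Grassmannian L k =>
      η z.1 * (k * (1 - 4 * kappa N * ‖z.1 - p‖ - Λ * ‖z.1 - p‖ * (1 + a * ‖z.1 - p‖))) -
        g ‖z.1 - p‖ * (‖z.1 - p‖ * (1 + a * ‖z.1 - p‖)) +
        g ‖z.1 - p‖ * ‖z.1 - p‖ * sqNormPerpGradDist p z.1 z.2) V.toMeasure := by
    have hgc := hg.continuous
    have hηc := hηs.continuous
    have hzero : ∀ z : E L × Grassmannian L k, z.1 ∉ Metric.closedBall p ρ →
        η z.1 = 0 ∧ g ‖z.1 - p‖ = 0 := by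
      intro z hz
      rw [mem_closedBall_iff_norm, not_le] at hz
      exact ⟨hη0 _ hz.le, hgρ _ hz.le⟩
    refine (V.integrable_of_continuous (by fun_prop) (isCompact_closedBall p ρ)
      fun z hz => by rw [(hzero z hz).1, (hzero z hz).2]; ring).add ?_
    refine (V.integrable_of_continuous (f := fun z => g ‖z.1 - p‖ * ‖z.1 - p‖) (by fun_prop)
      (isCompact_closedBall p ρ) fun z hz => by rw [(hzero z hz).2]; ring).mul_bdd (c := 1)
      (measurable_sqNormPerpGradDist p).aestronglyMeasurable (Eventually.of_forall fun z => ?_)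
    rw [Real.norm_eq_abs, abs_of_nonneg (sqNormPerpGradDist_nonneg _ _ _)]
    exact sqNormPerpGradDist_le_one _ _ _
  rw [setIntegral_eq_integral_of_forall_compl_eq_zero]
  · refine (integral_mono_ae hfint hint ?_).trans hle
    filter_upwards [Varifold.ae_mem_of_support_subset (V := V) subset_rfl] with z hz
    obtain ⟨x, S⟩ := z
    change x ∈ V.weight.support at hz
    rcases le_or_gt ‖x - p‖ ρ with hx | hx
    · have hZη : Z =ᶠ[𝓝 x] fun x => η x • Y x := by
        filter_upwards [hχ1 x ⟨mem_closedBall_iff_norm.2 hx, hz⟩] with y hy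
        simp [hZ, hy]
      have hYd : HasFDerivAt Y (1 + fderiv ℝ (radialCorrection N p) x) x :=
        ((hasFDerivAt_id x).sub_const p).add ((contDiffAt_radialCorrection hN hc hp
          (hsm x hx)).differentiableAt (by simp)).hasFDerivAt
      have hd : HasFDerivAt (fun x => η x • Y x) _ x :=
        (hasFDerivAt_radial (ρ := ρ) hg hσ₀ hg0 p x).smul hYd
      rw [hZη.fderiv_eq, hZη.eq_of_nhds, hd.fderiv]
      exact traceOn_fderiv_radial_ge (norm_radialCorrection_le hN hc hp x)
        (norm_fderiv_radialCorrection_le hN hc hp (hsm x hx)) (hηnn x) (hg' _) hΛ S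
    · change η x * _ - g ‖x - p‖ * _ + g ‖x - p‖ * _ * _ ≤ _
      rw [(hZfar x hx).fderiv_eq, (hZfar x hx).eq_of_nhds, hη0 x hx.le, hgρ _ hx.le]
      simp [traceOn]
  · intro z hz
    have hx : ρ ≤ ‖z.1 - p‖ := by
      by_contra hlt
      exact hz ⟨mem_ball_iff_norm.2 (not_le.1 hlt), trivial⟩
    change η z.1 * _ - g ‖z.1 - p‖ * _ + g ‖z.1 - p‖ * _ * _ = 0
    rw [hη0 _ hx, hgρ _ hx]
    ring

end

/-! ### The sharp radial profile and the monotonicity formula -/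

section

variable {L k m n : ℕ}

/-- Approximation of `G` on `[σ, ρ)` by smooth functions supported in `[σ / 2, ρ]`. -/
theorem exists_smooth_approx {G : ℝ → ℝ} {σ ρ : ℝ} (hσ : 0 < σ)
    (hG : ContDiffOn ℝ ∞ G (Ioi 0)) (hG0 : ∀ s, 0 < s → 0 ≤ G s) :
    ∃ (g : ℕ → ℝ → ℝ) (C : ℝ), (∀ j, ContDiff ℝ ∞ (g j)) ∧ (∀ j s, 0 ≤ g j s) ∧
      (∀ j s, g j s ≤ C) ∧ (∀ j, ∀ s ≤ σ / 2, g j s = 0) ∧ (∀ j s, ρ ≤ s → g j s = 0) ∧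
      ∀ s, Tendsto (fun j => g j s) atTop (𝓝 ((Ico σ ρ).indicator G s)) := by
  obtain ⟨C, hC⟩ := (isCompact_Icc (a := σ / 2) (b := ρ)).exists_bound_of_continuousOn
    (hG.continuousOn.mono fun s hs => lt_of_lt_of_le (by positivity) hs.1)
  -- the slopes are at least `2 / σ`, so that the lower cutoff vanishes below `σ / 2`
  set c : ℕ → ℝ := fun j => (j + 1) * (2 / σ) with hc
  have hc0 : ∀ j, 0 < c j := fun j => by positivity
  have hc1 : ∀ j, 1 ≤ c j * (σ / 2) := fun j => by
    have : c j * (σ / 2) = j + 1 := by rw [hc]; field_simp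
    rw [this]; linarith [(j.cast_nonneg : (0 : ℝ) ≤ j)]
  have hct : Tendsto c atTop atTop :=
    (tendsto_natCast_atTop_atTop.atTop_add tendsto_const_nhds).atTop_mul_const (by positivity)
  set g : ℕ → ℝ → ℝ := fun j s => Real.smoothTransition (c j * (s - σ) + 1) *
    Real.smoothTransition (c j * (ρ - s)) * G s with hg
  have hlow : ∀ j, ∀ s ≤ σ / 2, g j s = 0 := fun j s hs => by
    rw [hg]
    have h1 : c j * (s - σ) + 1 ≤ 0 := by nlinarith [hc1 j, hc0 j]
    simp [Real.smoothTransition.zero_of_nonpos h1]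
  have hhigh : ∀ j s, ρ ≤ s → g j s = 0 := fun j s hs => by
    rw [hg]
    have h1 : c j * (ρ - s) ≤ 0 := mul_nonpos_of_nonneg_of_nonpos (hc0 j).le (by linarith)
    simp [Real.smoothTransition.zero_of_nonpos h1]
  refine ⟨g, max C 0, fun j => ?_, fun j s => ?_, fun j s => ?_, hlow, hhigh, fun s => ?_⟩
  · rw [contDiff_iff_contDiffAt]
    intro s
    rcases lt_or_ge s (σ / 2) with hs | hs
    · refine (contDiffAt_const (c := (0 : ℝ))).congr_of_eventuallyEq ?_
      filter_upwards [Iio_mem_nhds hs] with t ht using hlow j t (le_of_lt ht)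
    · have hs0 : 0 < s := lt_of_lt_of_le (by positivity) hs
      have h1 : ContDiff ℝ ∞ fun s : ℝ => Real.smoothTransition (c j * (s - σ) + 1) :=
        Real.smoothTransition.contDiff.comp (by fun_prop)
      have h2 : ContDiff ℝ ∞ fun s : ℝ => Real.smoothTransition (c j * (ρ - s)) :=
        Real.smoothTransition.contDiff.comp (by fun_prop)
      exact (h1.contDiffAt.mul h2.contDiffAt).mul (hG.contDiffAt (Ioi_mem_nhds hs0))
  · rcases le_or_gt s (σ / 2) with hs | hs
    · exact (hlow j s hs).ge
    · exact mul_nonneg (mul_nonneg (Real.smoothTransition.nonneg _)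
        (Real.smoothTransition.nonneg _)) (hG0 s (lt_trans (by positivity) hs))
  · rcases le_or_gt s (σ / 2) with hs | hs
    · rw [hlow j s hs]; exact le_max_right _ _
    rcases le_or_gt ρ s with hs' | hs'
    · rw [hhigh j s hs']; exact le_max_right _ _
    have h0 := hG0 s (lt_trans (by positivity) hs)
    refine (mul_le_of_le_one_left h0 ?_).trans
      ((le_abs_self _).trans ((hC s ⟨hs.le, hs'.le⟩).trans (le_max_left _ _)))
    exact mul_le_one₀ (Real.smoothTransition.le_one _) (Real.smoothTransition.nonneg _)
      (Real.smoothTransition.le_one _)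
  · refine tendsto_const_nhds.congr' ?_
    rcases lt_or_ge s σ with hs | hs
    · have h1 : Tendsto (fun j => c j * (s - σ)) atTop atBot :=
        hct.atTop_mul_const_of_neg (by linarith)
      filter_upwards [h1.eventually_le_atBot (-1)] with j hj
      rw [indicator_of_notMem fun h => absurd h.1 (not_le.2 hs), hg]
      simp [Real.smoothTransition.zero_of_nonpos (show c j * (s - σ) + 1 ≤ 0 by linarith)]
    rcases le_or_gt ρ s with hs' | hs'
    · rw [indicator_of_notMem fun h => absurd h.2 (not_lt.2 hs')]
      exact Eventually.of_forall fun j => (hhigh j s hs').symm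
    have h1 : Tendsto (fun j => c j * (ρ - s)) atTop atTop :=
      hct.atTop_mul_const (by linarith)
    filter_upwards [h1.eventually_ge_atTop 1] with j hj
    have h2 : 1 ≤ c j * (s - σ) + 1 := by
      have := mul_nonneg (hc0 j).le (sub_nonneg.2 hs)
      linarith
    rw [indicator_of_mem (show s ∈ Ico σ ρ from ⟨hs, hs'⟩), hg]
    simp [Real.smoothTransition.one_of_one_le h2, Real.smoothTransition.one_of_one_le hj]

theorem integral_indicator_Ico_tail (G : ℝ → ℝ) {r σ ρ : ℝ} (hr : r ≤ ρ) (hσ : σ ≤ ρ) :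
    ∫ s in r..ρ, (Ico σ ρ).indicator G s = ∫ s in (max r σ)..ρ, G s := by
  rw [intervalIntegral.integral_of_le hr, intervalIntegral.integral_of_le (max_le hr hσ),
    setIntegral_indicator measurableSet_Ico]
  refine setIntegral_congr_set ((ae_eq_set_inter EventuallyEq.rfl Ico_ae_eq_Ioc).trans ?_)
  rw [Ioc_inter_Ioc, min_self]
  exact EventuallyEq.rfl

section Profile

variable {a b Λ Λ₁ : ℝ}

theorem hasDerivAt_exp_div_pow (Λ₁ : ℝ) (k : ℕ) {s : ℝ} (hs : 0 < s) :
    HasDerivAt (fun s => Real.exp (Λ₁ * s) / s ^ k)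
      (-(Real.exp (Λ₁ * s) / s ^ k / s * (k - Λ₁ * s))) s := by
  have h1 : HasDerivAt (fun s => Real.exp (Λ₁ * s)) (Real.exp (Λ₁ * s) * Λ₁) s := by
    simpa using ((hasDerivAt_id s).const_mul Λ₁).exp
  refine (h1.div (hasDerivAt_pow k s) (by positivity)).congr_deriv ?_
  rcases k with _ | k
  · field_simp
    simpa using mul_comm s Λ₁
  · rw [Nat.add_sub_cancel]
    field_simp
    push_cast
    ring

/-- The differential inequality behind the choice of the weight `e^{Λ₁ s} / s^k`, integrated. -/
theorem exp_div_pow_sub_le (ha : 0 ≤ a) (hb : 0 ≤ b) (hΛ : 0 ≤ Λ) (hΛ₁ : Λ₁ = k * (Λ + a + b))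
    {r t ρ : ℝ} (hr : 0 ≤ r) (hrt : r ≤ t) (ht : 0 < t) (htρ : t ≤ ρ) :
    Real.exp (Λ₁ * t) / t ^ k - Real.exp (Λ₁ * ρ) / ρ ^ k ≤
      (∫ s in t..ρ, Real.exp (Λ₁ * s) / s ^ k / (s * (1 + a * s))) *
        (k * (1 - b * r - Λ * r * (1 + a * r))) := by
  have hpos : ∀ s ∈ uIcc t ρ, 0 < s := fun s hs => by
    rw [uIcc_of_le htρ] at hs
    exact ht.trans_le hs.1
  have hne : ∀ s ∈ uIcc t ρ, s * (1 + a * s) ≠ 0 := fun s hs => by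
    have := hpos s hs
    positivity
  have hcont : ContinuousOn (fun s => Real.exp (Λ₁ * s) / s ^ k) (uIcc t ρ) := fun s hs =>
    (hasDerivAt_exp_div_pow Λ₁ k (hpos s hs)).continuousAt.continuousWithinAt
  have hcont' : ContinuousOn (fun s => -(Real.exp (Λ₁ * s) / s ^ k / s * (k - Λ₁ * s)))
      (uIcc t ρ) :=
    ((hcont.div continuousOn_id fun s hs => (hpos s hs).ne').mul (by fun_prop)).neg
  have h1 := intervalIntegral.integral_eq_sub_of_hasDerivAt
    (fun s hs => hasDerivAt_exp_div_pow Λ₁ k (hpos s hs)) hcont'.intervalIntegrable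
  rw [← neg_sub, ← h1, ← intervalIntegral.integral_neg, ← intervalIntegral.integral_mul_const]
  refine intervalIntegral.integral_mono_on htρ hcont'.neg.intervalIntegrable
    (((hcont.div (by fun_prop) hne).mul continuousOn_const).intervalIntegrable) fun s hs => ?_
  have hs0 : 0 < s := ht.trans_le hs.1
  have hrs : r ≤ s := hrt.trans hs.1
  have has : 0 < 1 + a * s := by positivity
  rw [neg_neg, div_mul_eq_mul_div _ s, div_mul_eq_mul_div _ (s * (1 + a * s)), mul_comm s,
    ← div_div, div_le_div_iff_of_pos_right hs0, le_div_iff₀ has, mul_assoc]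
  refine mul_le_mul_of_nonneg_left ?_ (by positivity)
  rw [hΛ₁]
  have hk : (0 : ℝ) ≤ k := k.cast_nonneg
  have h2 : (1 - (Λ + a + b) * s) * (1 + a * s) ≤ 1 - b * r - Λ * r * (1 + a * r) := by
    have h3 : b * r ≤ b * s := by gcongr
    have h4 : Λ * r * (1 + a * r) ≤ Λ * s * (1 + a * s) := by gcongr
    have h5 : 0 ≤ a * (a + b) * s ^ 2 := by positivity
    nlinarith
  calc ((k : ℝ) - k * (Λ + a + b) * s) * (1 + a * s)
      = k * ((1 - (Λ + a + b) * s) * (1 + a * s)) := by ring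
    _ ≤ _ := by gcongr

end Profile

theorem Varifold.weight_real_eq (V : Varifold L k) {s : Set (E L)} (hs : MeasurableSet s) :
    V.weight.real s = V.toMeasure.real (s ×ˢ univ) := by
  rw [Varifold.weight, map_measureReal_apply measurable_fst hs, prod_univ]

theorem sqNormPerpGradDist_weighted_integrableOn (V : Varifold L k) (p : E L) {a Λ₁ σ ρ : ℝ}
    (ha : 0 ≤ a) (hΛ₁ : 0 ≤ Λ₁) (hσ : 0 < σ) :
    IntegrableOn (fun z : E L × Grassmannian L k =>
      Real.exp (Λ₁ * ‖z.1 - p‖) * sqNormPerpGradDist p z.1 z.2 /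
        ((1 + a * ‖z.1 - p‖) * ‖z.1 - p‖ ^ k))
      ((Metric.ball p ρ \ Metric.ball p σ) ×ˢ univ) V.toMeasure := by
  have hr : Measurable fun z : E L × Grassmannian L k => ‖z.1 - p‖ :=
    (show Continuous fun z : E L × Grassmannian L k => ‖z.1 - p‖ by fun_prop).measurable
  have hmeas : Measurable fun z : E L × Grassmannian L k =>
      Real.exp (Λ₁ * ‖z.1 - p‖) * sqNormPerpGradDist p z.1 z.2 /
        ((1 + a * ‖z.1 - p‖) * ‖z.1 - p‖ ^ k) :=
    ((hr.const_mul _).exp.mul (measurable_sqNormPerpGradDist p)).div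
      (((hr.const_mul a).const_add 1).mul (hr.pow_const k))
  refine IntegrableOn.of_bound ?_ hmeas.aestronglyMeasurable
    (Real.exp (Λ₁ * ρ) * 1 / (1 * σ ^ k)) ?_
  · exact (measure_mono
      (prod_mono_left (sdiff_subset.trans Metric.ball_subset_closedBall))).trans_lt
      (V.measure_compact_prod_lt_top (isCompact_closedBall p ρ))
  · filter_upwards [ae_restrict_mem
      ((measurableSet_ball.diff measurableSet_ball).prod MeasurableSet.univ)] with z hz
    have h1 := mem_ball_iff_norm.1 hz.1.1
    have h2 : σ ≤ ‖z.1 - p‖ := not_lt.1 fun h => hz.1.2 (mem_ball_iff_norm.2 h)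
    have h3 := sqNormPerpGradDist_nonneg p z.1 z.2
    have h4 := sqNormPerpGradDist_le_one p z.1 z.2
    rw [Real.norm_eq_abs, abs_of_nonneg (by positivity)]
    have h5 : 0 ≤ a * ‖z.1 - p‖ := by positivity
    gcongr
    linarith

/-- The first variation inequality for the radial field whose profile is the sharp cutoff of
`e^{Λ₁ s} / (s^{k+1} (1 + a s))` to `[σ, ρ)`, obtained by approximation with smooth profiles. -/
theorem Varifold.IsStationaryFreeBoundary.integral_sharp_radial_le {V : Varifold L k}
    {M N : Set (E L)} (h : V.IsStationaryFreeBoundary M N) (hM : IsEmbeddedSubmanifold m M)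
    (hN : IsEmbeddedSubmanifold n N) (hc : IsCompact N) (hNM : N ⊆ M) {Λ : ℝ} (hΛ : 0 ≤ Λ)
    (hA : SecondFundamentalFormBound M Λ) (hV : V ∈ varifoldsIn k M) {p : E L} (hp : p ∈ N)
    {σ ρ : ℝ} (hσ : 0 < σ) (hσρ : σ < ρ) (hρ : 2 * kappa N * ρ < 1) {G : ℝ → ℝ}
    (hG : ContDiffOn ℝ ∞ G (Ioi 0)) (hG0 : ∀ s, 0 < s → 0 ≤ G s) :
    Integrable (fun z : E L × Grassmannian L k =>
      (∫ s in (max ‖z.1 - p‖ σ)..ρ, G s) * (k * (1 - 4 * kappa N * ‖z.1 - p‖ -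
          Λ * ‖z.1 - p‖ * (1 + 2 * kappa N * ‖z.1 - p‖))) -
        (Ico σ ρ).indicator G ‖z.1 - p‖ * (‖z.1 - p‖ * (1 + 2 * kappa N * ‖z.1 - p‖)) +
        (Ico σ ρ).indicator G ‖z.1 - p‖ * ‖z.1 - p‖ * sqNormPerpGradDist p z.1 z.2)
      (V.toMeasure.restrict (Metric.ball p ρ ×ˢ univ)) ∧
    ∫ z in Metric.ball p ρ ×ˢ univ,
      ((∫ s in (max ‖z.1 - p‖ σ)..ρ, G s) * (k * (1 - 4 * kappa N * ‖z.1 - p‖ -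
          Λ * ‖z.1 - p‖ * (1 + 2 * kappa N * ‖z.1 - p‖))) -
        (Ico σ ρ).indicator G ‖z.1 - p‖ * (‖z.1 - p‖ * (1 + 2 * kappa N * ‖z.1 - p‖)) +
        (Ico σ ρ).indicator G ‖z.1 - p‖ * ‖z.1 - p‖ * sqNormPerpGradDist p z.1 z.2)
      ∂V.toMeasure ≤ 0 := by
  have hκ := (hN.norm_normalProj_sub_le hc).1
  obtain ⟨g, C, hgs, hg0, hgC, hgl, hgh, hgt⟩ := exists_smooth_approx (ρ := ρ) hσ hG hG0
  have hC0 : 0 ≤ C := (hg0 0 0).trans (hgC 0 0)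
  have hρ0 : 0 < ρ := hσ.trans hσρ
  set μ := V.toMeasure.restrict (Metric.ball p ρ ×ˢ univ) with hμ
  have hfin : IsFiniteMeasure μ := ⟨by
    rw [hμ, Measure.restrict_apply_univ]
    exact (measure_mono (prod_mono_left Metric.ball_subset_closedBall)).trans_lt
      (V.measure_compact_prod_lt_top (isCompact_closedBall p ρ))⟩
  set a := 2 * kappa N with ha
  set b := 4 * kappa N with hb
  have ha0 : 0 ≤ a := by positivity
  have hb0 : 0 ≤ b := by positivity
  set f : ℕ → E L × Grassmannian L k → ℝ := fun j z =>
    (∫ s in ‖z.1 - p‖..ρ, g j s) * (k * (1 - b * ‖z.1 - p‖ -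
        Λ * ‖z.1 - p‖ * (1 + a * ‖z.1 - p‖))) -
      g j ‖z.1 - p‖ * (‖z.1 - p‖ * (1 + a * ‖z.1 - p‖)) +
      g j ‖z.1 - p‖ * ‖z.1 - p‖ * sqNormPerpGradDist p z.1 z.2 with hf
  have hball : ∀ᵐ z ∂μ, ‖z.1 - p‖ < ρ := by
    filter_upwards [ae_restrict_mem (measurableSet_ball.prod MeasurableSet.univ)] with z hz
    exact mem_ball_iff_norm.1 hz.1
  have hmeas : ∀ j, AEStronglyMeasurable (f j) μ := by
    intro j
    have h1 : Continuous fun z : E L × Grassmannian L k => ∫ s in ‖z.1 - p‖..ρ, g j s :=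
      (contDiff_integral_tail (hgs j) ρ).continuous.comp
        (show Continuous fun z : E L × Grassmannian L k => ‖z.1 - p‖ by fun_prop)
    have h2 := (hgs j).continuous
    have h3 : Measurable fun z : E L × Grassmannian L k => (∫ s in ‖z.1 - p‖..ρ, g j s) *
        (k * (1 - b * ‖z.1 - p‖ - Λ * ‖z.1 - p‖ * (1 + a * ‖z.1 - p‖))) -
        g j ‖z.1 - p‖ * (‖z.1 - p‖ * (1 + a * ‖z.1 - p‖)) := by
      refine Continuous.measurable ?_
      fun_prop
    have h4 : Measurable fun z : E L × Grassmannian L k => g j ‖z.1 - p‖ * ‖z.1 - p‖ := by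
      refine Continuous.measurable ?_
      fun_prop
    exact (h3.add (h4.mul (measurable_sqNormPerpGradDist p))).aestronglyMeasurable
  set B := C * ρ * (k * (1 + b * ρ + Λ * ρ * (1 + a * ρ))) + C * (ρ * (1 + a * ρ)) + C * ρ * 1
    with hB
  have hbound : ∀ j, ∀ᵐ z ∂μ, ‖f j z‖ ≤ B := by
    intro j
    filter_upwards [hball] with z hz
    set r := ‖z.1 - p‖ with hr
    have hr0 : 0 ≤ r := norm_nonneg _
    have h1 : |∫ s in r..ρ, g j s| ≤ C * ρ := by
      have h2 := intervalIntegral.norm_integral_le_of_norm_le_const (a := r) (b := ρ) (f := g j)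
        (C := C) fun s _ => by
          rw [Real.norm_eq_abs, abs_of_nonneg (hg0 j s)]; exact hgC j s
      rw [Real.norm_eq_abs, abs_of_pos (sub_pos.2 hz)] at h2
      exact h2.trans (by gcongr; linarith)
    have h2 : |1 - b * r - Λ * r * (1 + a * r)| ≤ 1 + b * ρ + Λ * ρ * (1 + a * ρ) := by
      have h3 : b * r ≤ b * ρ := by gcongr
      have h4 : Λ * r * (1 + a * r) ≤ Λ * ρ * (1 + a * ρ) := by gcongr
      have h5 : 0 ≤ b * r := by positivity
      have h6 : 0 ≤ Λ * r * (1 + a * r) := by positivity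
      rw [abs_le]
      constructor <;> linarith
    have h3 := sqNormPerpGradDist_nonneg p z.1 z.2
    have h4 := sqNormPerpGradDist_le_one p z.1 z.2
    have h5 := hg0 j r
    refine (norm_add_le _ _).trans (add_le_add ((norm_sub_le _ _).trans (add_le_add ?_ ?_)) ?_)
    · rw [norm_mul, norm_mul, Real.norm_natCast, Real.norm_eq_abs, Real.norm_eq_abs]
      gcongr
    · rw [Real.norm_eq_abs, abs_of_nonneg (by positivity)]
      gcongr
      exact hgC j r
    · rw [Real.norm_eq_abs, abs_of_nonneg (by positivity)]
      gcongr
      exact hgC j r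
  have hlim : ∀ᵐ z ∂μ, Tendsto (fun j => f j z) atTop (𝓝
      ((∫ s in (max ‖z.1 - p‖ σ)..ρ, G s) * (k * (1 - b * ‖z.1 - p‖ -
          Λ * ‖z.1 - p‖ * (1 + a * ‖z.1 - p‖))) -
        (Ico σ ρ).indicator G ‖z.1 - p‖ * (‖z.1 - p‖ * (1 + a * ‖z.1 - p‖)) +
        (Ico σ ρ).indicator G ‖z.1 - p‖ * ‖z.1 - p‖ * sqNormPerpGradDist p z.1 z.2)) := by
    filter_upwards [hball] with z hz
    have h1 : Tendsto (fun j => ∫ s in ‖z.1 - p‖..ρ, g j s) atTop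
        (𝓝 (∫ s in (max ‖z.1 - p‖ σ)..ρ, G s)) := by
      rw [← integral_indicator_Ico_tail G hz.le hσρ.le]
      refine intervalIntegral.tendsto_integral_filter_of_dominated_convergence (fun _ => C)
        (Eventually.of_forall fun j => (hgs j).continuous.aestronglyMeasurable)
        (Eventually.of_forall fun j => Eventually.of_forall fun s _ => ?_)
        intervalIntegrable_const (Eventually.of_forall fun s _ => hgt s)
      rw [Real.norm_eq_abs, abs_of_nonneg (hg0 j s)]
      exact hgC j s
    exact ((h1.mul_const _).sub ((hgt _).mul_const _)).add
      (((hgt _).mul_const _).mul_const _)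
  refine ⟨?_, ?_⟩
  · refine Integrable.of_bound (aestronglyMeasurable_of_tendsto_ae atTop hmeas hlim) B ?_
    filter_upwards [hlim, ae_all_iff.2 hbound] with z hz hz'
    exact le_of_tendsto hz.norm (Eventually.of_forall hz')
  · refine le_of_tendsto (tendsto_integral_of_dominated_convergence (fun _ => B) hmeas
      (integrable_const _) hbound hlim) (Eventually.of_forall fun j => ?_)
    exact h.integral_radial_le hM hN hc hNM hΛ hA hV hp hρ (hgs j) (hg0 j) (half_pos hσ) (hgl j)
      (hgh j)

/-- The monotonicity formula in terms of `κ`. -/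
theorem Varifold.IsStationaryFreeBoundary.monotonicity {V : Varifold L k}
    {M N : Set (E L)} (h : V.IsStationaryFreeBoundary M N) (hM : IsEmbeddedSubmanifold m M)
    (hN : IsEmbeddedSubmanifold n N) (hc : IsCompact N) (hNM : N ⊆ M) {Λ : ℝ} (hΛ : 0 ≤ Λ)
    (hA : SecondFundamentalFormBound M Λ) (hV : V ∈ varifoldsIn k M) {p : E L} (hp : p ∈ N)
    {σ ρ a Λ₁ : ℝ} (hσ : 0 < σ) (hσρ : σ < ρ) (ha : a = 2 * kappa N) (hρ : a * ρ < 1)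
    (hΛ₁ : Λ₁ = k * (Λ + 3 * a)) :
    IntegrableOn (fun z : E L × Grassmannian L k =>
        Real.exp (Λ₁ * ‖z.1 - p‖) * sqNormPerpGradDist p z.1 z.2 /
          ((1 + a * ‖z.1 - p‖) * ‖z.1 - p‖ ^ k))
      ((Metric.ball p ρ \ Metric.ball p σ) ×ˢ univ) V.toMeasure ∧
    Real.exp (Λ₁ * σ) * (V.weight.real (Metric.ball p σ) / σ ^ k) ≤
      Real.exp (Λ₁ * ρ) * (V.weight.real (Metric.ball p ρ) / ρ ^ k) -
        ∫ z in (Metric.ball p ρ \ Metric.ball p σ) ×ˢ univ,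
          Real.exp (Λ₁ * ‖z.1 - p‖) * sqNormPerpGradDist p z.1 z.2 /
            ((1 + a * ‖z.1 - p‖) * ‖z.1 - p‖ ^ k) ∂V.toMeasure := by
  have hκ := (hN.norm_normalProj_sub_le hc).1
  have ha0 : 0 ≤ a := by rw [ha]; positivity
  have hΛ₁0 : 0 ≤ Λ₁ := by rw [hΛ₁]; positivity
  have hint := sqNormPerpGradDist_weighted_integrableOn V p (ρ := ρ) ha0 hΛ₁0 hσ
  refine ⟨hint, ?_⟩
  set G : ℝ → ℝ := fun s => Real.exp (Λ₁ * s) / s ^ k / (s * (1 + a * s)) with hG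
  have hGs : ContDiffOn ℝ ∞ G (Ioi 0) := by
    have h1 : ContDiff ℝ ∞ fun s : ℝ => Real.exp (Λ₁ * s) := by fun_prop
    have h2 : ContDiff ℝ ∞ fun s : ℝ => s ^ k := by fun_prop
    have h3 : ContDiff ℝ ∞ fun s : ℝ => s * (1 + a * s) := by fun_prop
    refine (h1.contDiffOn.div h2.contDiffOn fun s hs => ?_).div h3.contDiffOn fun s hs => ?_
    · have hs' : 0 < s := hs
      positivity
    · have hs' : 0 < s := hs
      positivity
  have hG0 : ∀ s, 0 < s → 0 ≤ G s := fun s hs => by positivity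
  obtain ⟨hfint, hfle⟩ := h.integral_sharp_radial_le hM hN hc hNM hΛ hA hV hp hσ hσρ
    (by rw [← ha]; exact hρ) hGs hG0
  rw [← ha] at hfint hfle
  set ψ : E L × Grassmannian L k → ℝ := fun z =>
    Real.exp (Λ₁ * ‖z.1 - p‖) * sqNormPerpGradDist p z.1 z.2 /
      ((1 + a * ‖z.1 - p‖) * ‖z.1 - p‖ ^ k) with hψ
  set Bρ : Set (E L × Grassmannian L k) := Metric.ball p ρ ×ˢ univ with hBρ
  set Bσ : Set (E L × Grassmannian L k) := Metric.ball p σ ×ˢ univ with hBσ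
  set A : Set (E L × Grassmannian L k) := (Metric.ball p ρ \ Metric.ball p σ) ×ˢ univ with hAd
  have hBρm : MeasurableSet Bρ := measurableSet_ball.prod MeasurableSet.univ
  have hBσm : MeasurableSet Bσ := measurableSet_ball.prod MeasurableSet.univ
  have hAm : MeasurableSet A :=
    (measurableSet_ball.diff measurableSet_ball).prod MeasurableSet.univ
  have hsub : Bσ ⊆ Bρ := prod_mono_left (Metric.ball_subset_ball hσρ.le)
  have hAsub : A ⊆ Bρ := prod_mono_left sdiff_subset
  have hlt : ∀ s, V.toMeasure (Metric.ball p s ×ˢ univ) < ⊤ := fun s =>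
    (measure_mono (prod_mono_left Metric.ball_subset_closedBall)).trans_lt
      (V.measure_compact_prod_lt_top (isCompact_closedBall p s))
  set hh : ℝ → ℝ := fun s => Real.exp (Λ₁ * s) / s ^ k with hhd
  have hi1 : Integrable (Bσ.indicator fun _ => hh σ) (V.toMeasure.restrict Bρ) :=
    (integrableOn_const (hs := (hlt σ).ne) (μ := V.toMeasure)).integrable_indicator hBσm
      |>.restrict
  have hi2 : Integrable (fun _ => hh ρ) (V.toMeasure.restrict Bρ) :=
    integrableOn_const (hs := (hlt ρ).ne)
  have hi3 : Integrable (A.indicator ψ) (V.toMeasure.restrict Bρ) :=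
    (hint.integrable_indicator hAm).restrict
  have hkey : ∫ z in Bρ, (Bσ.indicator (fun _ => hh σ) z - hh ρ + A.indicator ψ z)
      ∂V.toMeasure ≤ 0 := by
    refine (setIntegral_mono_on ((hi1.sub hi2).add hi3) hfint hBρm fun z hz => ?_).trans hfle
    set r := ‖z.1 - p‖ with hr
    have hr0 : 0 ≤ r := norm_nonneg _
    have hrρ : r < ρ := mem_ball_iff_norm.1 hz.1
    change Bσ.indicator (fun _ => hh σ) z - hh ρ + A.indicator ψ z ≤ _
    have hprof := exp_div_pow_sub_le (k := k) (a := a) (b := 4 * kappa N) (Λ := Λ) (Λ₁ := Λ₁)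
      ha0 (by positivity) hΛ (by rw [hΛ₁, ha]; ring) hr0 (le_max_left r σ)
      (lt_max_of_lt_right hσ) (max_le hrρ.le hσρ.le)
    rcases lt_or_ge r σ with hrσ | hrσ
    · have h1 : z ∈ Bσ := ⟨mem_ball_iff_norm.2 hrσ, trivial⟩
      have h2 : z ∉ A := fun hzA => hzA.1.2 h1.1
      rw [indicator_of_mem h1, indicator_of_notMem h2,
        indicator_of_notMem fun hI => absurd hI.1 (not_le.2 hrσ)]
      rw [max_eq_right hrσ.le] at hprof ⊢
      linarith
    · have h1 : z ∉ Bσ := fun hzB => absurd (mem_ball_iff_norm.1 hzB.1) (not_lt.2 hrσ)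
      have h2 : z ∈ A := ⟨⟨hz.1, fun hzB => h1 ⟨hzB, trivial⟩⟩, trivial⟩
      have hr1 : 0 < r := hσ.trans_le hrσ
      rw [indicator_of_notMem h1, indicator_of_mem h2,
        indicator_of_mem (show r ∈ Ico σ ρ from ⟨hrσ, hrρ⟩)]
      rw [max_eq_left hrσ] at hprof ⊢
      have h3 : G r * (r * (1 + a * r)) = hh r := by
        simp only [hG, hhd]
        field_simp
      have h4 : G r * r * sqNormPerpGradDist p z.1 z.2 = ψ z := by
        simp only [hG, hψ, ← hr]
        field_simp
      rw [h3, h4]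
      linarith
  have hsplit : ∫ z in Bρ, (Bσ.indicator (fun _ => hh σ) z - hh ρ + A.indicator ψ z)
      ∂V.toMeasure = (∫ z in Bρ, Bσ.indicator (fun _ => hh σ) z ∂V.toMeasure) -
        (∫ _ in Bρ, hh ρ ∂V.toMeasure) + ∫ z in Bρ, A.indicator ψ z ∂V.toMeasure := by
    rw [← integral_sub hi1 hi2]
    exact integral_add (hi1.sub hi2) hi3
  rw [hsplit, setIntegral_indicator hBσm,
    setIntegral_indicator hAm, inter_eq_right.2 hsub, inter_eq_right.2 hAsub, setIntegral_const,
    setIntegral_const, smul_eq_mul, smul_eq_mul, ← V.weight_real_eq measurableSet_ball,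
    ← V.weight_real_eq measurableSet_ball] at hkey
  have e1 : ∀ s w : ℝ, Real.exp (Λ₁ * s) * (w / s ^ k) = w * hh s := fun s w => by
    simp only [hhd]; ring
  rw [e1, e1]
  linarith

/-- The radius of curvature enters the monotonicity formula through `γ = 2κ`. -/
theorem two_div_radiusOfCurvature_toReal {N : Set (E L)} (hκ : 0 ≤ kappa N) :
    (2 / radiusOfCurvature N).toReal = 2 * kappa N := by
  rw [radiusOfCurvature, div_eq_mul_inv, inv_inv, ENNReal.toReal_mul, ENNReal.toReal_ofReal hκ]
  simp

theorem two_kappa_mul_lt_one {N : Set (E L)} (hκ : 0 ≤ kappa N) {ρ : ℝ}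
    (hρ : ENNReal.ofReal ρ < radiusOfCurvature N / 2) : 2 * kappa N * ρ < 1 := by
  rcases hκ.eq_or_lt with h | h
  · rw [← h]; simp
  · rw [radiusOfCurvature, ← ENNReal.ofReal_inv_of_pos h, ← ENNReal.ofReal_ofNat 2,
      ← ENNReal.ofReal_div_of_pos two_pos, ENNReal.ofReal_lt_ofReal_iff (by positivity),
      lt_div_iff₀ two_pos, inv_eq_one_div, lt_div_iff₀ h] at hρ
    linarith

end

end FreeBdry

theorem theorem3p4 (L m n k : ℕ) (M N : Set (FreeBdry.E L)) (Λ : ℝ) (hΛ : 0 < Λ)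
    (hM : FreeBdry.IsEmbeddedSubmanifold m M)
    (hA : FreeBdry.SecondFundamentalFormBound M Λ)
    (hN : FreeBdry.IsEmbeddedSubmanifold n N) (hNc : IsCompact N) (hNM : N ⊆ M)
    (V : FreeBdry.Varifold L k) (hV : V ∈ FreeBdry.varifoldsIn k M)
    (hstat : V.IsStationaryFreeBoundary M N)
    (p : FreeBdry.E L) (hp : p ∈ N) (σ ρ : ℝ) (hσ : 0 < σ) (hσρ : σ < ρ)
    (hρ : ENNReal.ofReal ρ < FreeBdry.radiusOfCurvature N / 2)
    (γ Λ₁ : ℝ) (hγ : γ = (2 / FreeBdry.radiusOfCurvature N).toReal)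
    (hΛ₁ : Λ₁ = k * (Λ + 3 * γ)) :
    IntegrableOn
      (fun z : FreeBdry.E L × FreeBdry.Grassmannian L k =>
        Real.exp (Λ₁ * ‖z.1 - p‖) * FreeBdry.sqNormPerpGradDist p z.1 z.2 /
          ((1 + γ * ‖z.1 - p‖) * ‖z.1 - p‖ ^ k))
      ((Metric.ball p ρ \ Metric.ball p σ) ×ˢ univ) V.toMeasure ∧
    Real.exp (Λ₁ * σ) * (V.weight.real (Metric.ball p σ) / σ ^ k) ≤
      Real.exp (Λ₁ * ρ) * (V.weight.real (Metric.ball p ρ) / ρ ^ k) -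
        ∫ z in (Metric.ball p ρ \ Metric.ball p σ) ×ˢ univ,
          Real.exp (Λ₁ * ‖z.1 - p‖) * FreeBdry.sqNormPerpGradDist p z.1 z.2 /
            ((1 + γ * ‖z.1 - p‖) * ‖z.1 - p‖ ^ k) ∂V.toMeasure := by
  have hκ := (hN.norm_normalProj_sub_le hNc).1
  have hγκ : γ = 2 * FreeBdry.kappa N :=
    hγ.trans (FreeBdry.two_div_radiusOfCurvature_toReal hκ)
  exact hstat.monotonicity hM hN hNc hNM hΛ.le hA hV hp hσ hσρ hγκ
    (by rw [hγκ]; exact FreeBdry.two_kappa_mul_lt_one hκ hρ) hΛ₁
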